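/- Let $p>3$ be real and $\kappa_p=\frac{2(p+1)}{(p-1)^2}$. Let $H^1(0,1)$ be the complex Sobolev space with $\|u\|_{H^1}^2=\int_0^1|u|^2+\int_0^1|u'|^2$, and let $\mathcal H=\{u\in H^1(0,1):u(0)=0\}\times H^1(0,1)$ with $\|(u_1,u_2)\|^2=\|u_1\|_{H^1}^2+\|u_2\|_{H^1}^2$. Let $$\tilde L_0\begin{pmatrix}u_1\\u_2\end{pmatrix}(\rho)=\begin{pmatrix}u_2'(\rho)-\rho u_1'(\rho)-\frac{2}{p-1}u_1(\rho)\\ u_1'(\rho)-\rho u_2'(\rho)-\frac{2}{p-1}u_2(\rho)\end{pmatrix},\qquad \mathcal D(\tilde L_0)=\{u\in C^2[0,1]\times C^2[0,1]:u_1(0)=0,\ u_2'(0)=0\},$$ $L'(u_1,u_2)(\rho)=\big(p\kappa_p\int_0^\rho u_2(s)\,ds,\,0\big)$ and $g(\rho)=\big(\frac{p+1}{p-1}\rho,\,1\big)$. Then $\tilde L_0$ is closable; let $L_0$ be its closure and $L=L_0+L'$ with $\mathcal D(L)=\mathcal D(L_0)$. The operator $L$ generates a strongly continuous one-parameter semigroup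 $S(\tau)$, $\tau\ge 0$, of bounded operators on $\mathcal H$. There is a bounded projection $P$ on $\mathcal H$ with one-dimensional range $\langle g\rangle$ such that: 1. $P$ is the spectral projection of $L$ associated with the isolated spectral point $1$, i.e. $1\in\sigma(L)$ and, for some $r>0$, all $\lambda$ with $0<|\lambda-1|\le r$ are in the resolvent set of $L$ and $P=\frac1{2\pi i}\oint_{|\lambda-1|=r}(\lambda-L)^{-1}\,d\lambda$; 2. $P\,S(\tau)=S(\tau)\,P$ for all $\tau\ge0$; 3. $S(\tau)Pf=e^{\tau}Pf$ for all $\tau\ge0$ and $f\in\mathcal H$; 4. for every $\varepsilon>0$ with $\mu_p:=\frac{2}{p-1}-\varepsilon>0$ there is a constant $C_\varepsilon>0$ such that $\|S(\tau)(1-P)f\|\le C_\varepsilon e^{-\mu_p\tau}\|(1-P)f\|$ for all $\tau\ge0$ and $f\in\mathcal H$. -/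

import Mathlib

open MeasureTheory Set Filter Topology
open scoped NNReal ENNReal ContDiff

noncomputable section

namespace SelfSimilarWave

/-! ### The Sobolev space `H¹(0,1)` -/

/-- Lebesgue measure on the interval `(0,1)`. -/
abbrev unitVol : Measure ℝ := volume.restrict (Ioo (0 : ℝ) 1)

/-- The complex Hilbert space `L²(0,1)`. -/
abbrev L2 : Type := Lp ℂ 2 unitVol

/-- `v` is the weak derivative of `u` on `(0,1)`: `∫ φ' u = - ∫ φ v` for all test functions
`φ ∈ C_c^∞(0,1)`. -/
def HasWeakDeriv (u v : L2) : Prop :=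
  ∀ φ : ℝ → ℝ, ContDiff ℝ ∞ φ → HasCompactSupport φ → tsupport φ ⊆ Ioo (0 : ℝ) 1 →
    ∫ x, deriv φ x • u x ∂unitVol = - ∫ x, φ x • v x ∂unitVol

lemma memLp_testFun {φ : ℝ → ℝ} (hφ : Continuous φ) (hc : HasCompactSupport φ) :
    MemLp φ 2 unitVol :=
  (hφ.memLp_of_hasCompactSupport hc).restrict _

lemma integrable_smul_L2 {φ : ℝ → ℝ} (hφ : Continuous φ) (hc : HasCompactSupport φ) (u : L2) :
    Integrable (fun x => φ x • u x) unitVol :=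
  memLp_one_iff_integrable.1 (MemLp.smul (Lp.memLp u) (memLp_testFun hφ hc) (r := 1))

/-- The pairs `(u, u')` in `L²(0,1) × L²(0,1)` such that `u'` is the weak derivative of `u`. -/
def sobolevPairs : Submodule ℂ (WithLp 2 (L2 × L2)) where
  carrier := {w | HasWeakDeriv w.fst w.snd}
  zero_mem' := by
    intro φ _ _ _
    have h : ∀ᵐ x ∂unitVol, ((0 : L2) : ℝ → ℂ) x = 0 := Lp.coeFn_zero ℂ 2 unitVol
    have e1 : ∀ᵐ x ∂unitVol, deriv φ x • ((0 : L2) : ℝ → ℂ) x = 0 :=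
      h.mono fun x hx => by rw [hx, smul_zero]
    have e2 : ∀ᵐ x ∂unitVol, φ x • ((0 : L2) : ℝ → ℂ) x = 0 :=
      h.mono fun x hx => by rw [hx, smul_zero]
    rw [WithLp.zero_fst, WithLp.zero_snd, integral_congr_ae e1, integral_congr_ae e2]
    simp
  add_mem' := by
    intro a b ha hb φ h1 h2 h3
    have hd : Continuous (deriv φ) := h1.continuous_deriv (by simp)
    have e1 : ∀ᵐ x ∂unitVol, deriv φ x • (a + b).fst x
        = deriv φ x • a.fst x + deriv φ x • b.fst x := by
      filter_upwards [Lp.coeFn_add a.fst b.fst] with x hx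
      rw [WithLp.add_fst, hx, Pi.add_apply, smul_add]
    have e2 : ∀ᵐ x ∂unitVol, φ x • (a + b).snd x = φ x • a.snd x + φ x • b.snd x := by
      filter_upwards [Lp.coeFn_add a.snd b.snd] with x hx
      rw [WithLp.add_snd, hx, Pi.add_apply, smul_add]
    rw [integral_congr_ae e1, integral_congr_ae e2,
      integral_add (integrable_smul_L2 hd h2.deriv _) (integrable_smul_L2 hd h2.deriv _),
      integral_add (integrable_smul_L2 h1.continuous h2 _)
        (integrable_smul_L2 h1.continuous h2 _), ha φ h1 h2 h3, hb φ h1 h2 h3]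
    ring
  smul_mem' := by
    intro c a ha φ h1 h2 h3
    have e1 : ∀ᵐ x ∂unitVol, deriv φ x • (c • a).fst x = c • (deriv φ x • a.fst x) := by
      filter_upwards [Lp.coeFn_smul c a.fst] with x hx
      rw [WithLp.smul_fst, hx, Pi.smul_apply, smul_comm]
    have e2 : ∀ᵐ x ∂unitVol, φ x • (c • a).snd x = c • (φ x • a.snd x) := by
      filter_upwards [Lp.coeFn_smul c a.snd] with x hx
      rw [WithLp.smul_snd, hx, Pi.smul_apply, smul_comm]
    rw [integral_congr_ae e1, integral_congr_ae e2, integral_smul, integral_smul,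
      ha φ h1 h2 h3, smul_neg]

/-- `H¹(0,1)`, realized as the space of pairs `(u, u')`, with the norm
`‖u‖²_{H¹} = ‖u‖²_{L²} + ‖u'‖²_{L²}` inherited from the `ℓ²`-product. -/
def H1 : Type := sobolevPairs

instance : NormedAddCommGroup H1 := inferInstanceAs (NormedAddCommGroup sobolevPairs)

instance : InnerProductSpace ℂ H1 := inferInstanceAs (InnerProductSpace ℂ sobolevPairs)

/-- The class in `L²(0,1)` of an element of `H¹(0,1)`. -/
def toL2 (u : H1) : L2 := WithLp.fst (Subtype.val (p := fun w => w ∈ sobolevPairs) u)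

/-- The weak derivative of an element of `H¹(0,1)`. -/
def weakD (u : H1) : L2 := WithLp.snd (Subtype.val (p := fun w => w ∈ sobolevPairs) u)

lemma hasWeakDeriv_weakD (u : H1) : HasWeakDeriv (toL2 u) (weakD u) :=
  Subtype.property (p := fun w => w ∈ sobolevPairs) u

lemma h1_norm_sq (u : H1) : ‖u‖ ^ 2 = ‖toL2 u‖ ^ 2 + ‖weakD u‖ ^ 2 :=
  WithLp.prod_norm_sq_eq_of_L2 (α := L2) (β := L2) _

lemma h1_ext {u v : H1} (h1 : toL2 u = toL2 v) (h2 : weakD u = weakD v) : u = v :=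
  Subtype.ext (p := fun w => w ∈ sobolevPairs) ((WithLp.ofLp_injective 2) (Prod.ext h1 h2))

/-- The element `(u, v)` of `H¹(0,1)`, where `v` is the weak derivative of `u`. -/
def mkH1 (u v : L2) (h : HasWeakDeriv u v) : H1 :=
  Subtype.mk (p := fun w => w ∈ sobolevPairs) (WithLp.toLp 2 (u, v)) h

/-- The function underlying an element of `H¹(0,1)` (determined almost everywhere on `(0,1)`). -/
def fn (u : H1) : ℝ → ℂ := toL2 u

lemma fn_add (u v : H1) : fn (u + v) =ᵐ[unitVol] fn u + fn v :=
  Lp.coeFn_add (toL2 u) (toL2 v)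

lemma fn_smul (c : ℂ) (u : H1) : fn (c • u) =ᵐ[unitVol] c • fn u :=
  Lp.coeFn_smul c (toL2 u)

lemma fn_zero : fn (0 : H1) =ᵐ[unitVol] 0 := Lp.coeFn_zero ℂ 2 unitVol

/-- An element of `H¹(0,1)` is determined by the underlying function. -/
lemma ext_fn {u v : H1} (h : fn u =ᵐ[unitVol] fn v) : u = v := by
  have h1 : toL2 u = toL2 v := Lp.ext h
  have hw := hasWeakDeriv_weakD (u - v)
  set d : L2 := weakD (u - v) with hd
  have h0 : toL2 (u - v) = 0 := sub_eq_zero.2 h1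
  have hint : Integrable d unitVol := (Lp.memLp d).integrable (by norm_num)
  have hz : ∀ᵐ x ∂volume, x ∈ Ioo (0 : ℝ) 1 → d x = 0 := by
    refine isOpen_Ioo.ae_eq_zero_of_integral_contDiff_smul_eq_zero
      (IntegrableOn.locallyIntegrableOn hint) ?_
    intro φ h1 h2 h3
    have hw' := hw φ h1 h2 h3
    have e1 : ∀ᵐ x ∂unitVol, deriv φ x • ((0 : L2) : ℝ → ℂ) x = 0 :=
      (Lp.coeFn_zero ℂ 2 unitVol).mono fun x hx => by rw [hx]; simp
    rw [h0, integral_congr_ae e1, integral_zero] at hw'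
    have hw'' : ∫ x in Ioo (0 : ℝ) 1, φ x • d x = 0 := by
      rw [← neg_eq_zero]; exact hw'.symm
    rw [← hw'', setIntegral_eq_integral_of_forall_compl_eq_zero]
    intro x hx
    rw [image_eq_zero_of_notMem_tsupport fun hx' => hx (h3 hx'), zero_smul]
  have hdz : d = 0 := by
    refine Lp.ext ?_
    have := (ae_restrict_iff' measurableSet_Ioo).2 hz
    filter_upwards [this, Lp.coeFn_zero ℂ 2 unitVol] with x hx hx0
    rw [hx, hx0]; rfl
  have h2 : weakD u = weakD v := by
    exact sub_eq_zero.1 (hd.symm.trans hdz)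
  exact h1_ext h1 h2

/-! ### Elements of `H¹(0,1)` given by antiderivatives -/

lemma intervalIntegrable_of_memLp {v : ℝ → ℂ} (hv : MemLp v 2 unitVol) :
    IntervalIntegrable v volume 0 1 := by
  rw [intervalIntegrable_iff_integrableOn_Ioo_of_le zero_le_one]
  exact hv.integrable (by norm_num)

lemma continuousOn_primitive {f v : ℝ → ℂ} (hv : MemLp v 2 unitVol)
    (hf : ∀ x ∈ Icc (0 : ℝ) 1, f x = f 0 + ∫ t in (0 : ℝ)..x, v t) :
    ContinuousOn f (Icc 0 1) := by
  have h := intervalIntegral.continuousOn_primitive_interval' (intervalIntegrable_of_memLp hv)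
    (left_mem_uIcc)
  rw [uIcc_of_le zero_le_one] at h
  exact (continuousOn_const.add h).congr hf

lemma memLp_of_continuousOn {f : ℝ → ℂ} (hf : ContinuousOn f (Icc 0 1)) :
    MemLp f 2 unitVol := by
  obtain ⟨C, hC⟩ := isCompact_Icc.exists_bound_of_continuousOn hf
  refine MemLp.of_bound ((hf.mono Ioo_subset_Icc_self).aestronglyMeasurable measurableSet_Ioo) C ?_
  exact (ae_restrict_iff' measurableSet_Ioo).2 (.of_forall fun x hx => hC x (Ioo_subset_Icc_self hx))

/-- Integration by parts of an antiderivative against a test function. -/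
lemma weakDeriv_primitive {f v : ℝ → ℂ} (hv : MemLp v 2 unitVol)
    (hf : ∀ x ∈ Icc (0 : ℝ) 1, f x = f 0 + ∫ t in (0 : ℝ)..x, v t)
    {φ : ℝ → ℝ} (h1 : ContDiff ℝ ∞ φ) (h3 : tsupport φ ⊆ Ioo (0 : ℝ) 1) :
    ∫ x, deriv φ x • f x ∂unitVol = - ∫ x, φ x • v x ∂unitVol := by
  have hd : Continuous (deriv φ) := h1.continuous_deriv (by simp)
  have hφ0 : φ 0 = 0 := image_eq_zero_of_notMem_tsupport fun h => lt_irrefl _ (h3 h).1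
  have hφ1 : φ 1 = 0 := image_eq_zero_of_notMem_tsupport fun h => lt_irrefl _ (h3 h).2
  have ftc : ∀ t, ∫ x in t..1, deriv φ x = - φ t := fun t => by
    rw [intervalIntegral.integral_deriv_eq_sub
      (fun x _ => (h1.differentiable (by simp)) x) (hd.intervalIntegrable _ _), hφ1, zero_sub]
  have hvi : Integrable v unitVol := hv.integrable (by norm_num)
  have hdi : Integrable (deriv φ) unitVol :=
    (hd.continuousOn.integrableOn_Icc (a := 0) (b := 1)).mono_set Ioo_subset_Icc_self
  have hK : Integrable (fun z : ℝ × ℝ => {z : ℝ × ℝ | z.2 ≤ z.1}.indicator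
      (fun z => deriv φ z.1 • v z.2) z) (unitVol.prod unitVol) :=
    (hdi.smul_prod hvi).indicator (measurableSet_le measurable_snd measurable_fst)
  have e1 : ∀ x ∈ Ioo (0 : ℝ) 1, deriv φ x • f x = deriv φ x • f 0 +
      ∫ t, {z : ℝ × ℝ | z.2 ≤ z.1}.indicator (fun z => deriv φ z.1 • v z.2) (x, t) ∂unitVol := by
    intro x hx
    rw [hf x (Ioo_subset_Icc_self hx), smul_add]
    congr 1
    have hs : Ioo (0 : ℝ) 1 ∩ Iic x = Ioc 0 x := by
      ext t; simp only [mem_inter_iff, mem_Ioo, mem_Iic, mem_Ioc]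
      exact ⟨fun h => ⟨h.1.1, h.2⟩, fun h => ⟨⟨h.1, h.2.trans_lt hx.2⟩, h.2⟩⟩
    have : ∀ t, {z : ℝ × ℝ | z.2 ≤ z.1}.indicator (fun z => deriv φ z.1 • v z.2) (x, t)
        = (Iic x).indicator (fun t => deriv φ x • v t) t := fun t => by
      simp [indicator]
    simp_rw [this]
    rw [setIntegral_indicator measurableSet_Iic, hs, integral_smul,
      intervalIntegral.integral_of_le hx.1.le]
  have e2 : ∀ t ∈ Ioo (0 : ℝ) 1, ∫ x, {z : ℝ × ℝ | z.2 ≤ z.1}.indicator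
      (fun z => deriv φ z.1 • v z.2) (x, t) ∂unitVol = - (φ t • v t) := by
    intro t ht
    have hs : Ioo (0 : ℝ) 1 ∩ Ici t = Ico t 1 := by
      ext x; simp only [mem_inter_iff, mem_Ioo, mem_Ici, mem_Ico]
      exact ⟨fun h => ⟨h.2, h.1.2⟩, fun h => ⟨⟨ht.1.trans_le h.1, h.2⟩, h.1⟩⟩
    have : ∀ x, {z : ℝ × ℝ | z.2 ≤ z.1}.indicator (fun z => deriv φ z.1 • v z.2) (x, t)
        = (Ici t).indicator (fun x => deriv φ x • v t) x := fun x => by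
      simp [indicator]
    simp_rw [this]
    rw [setIntegral_indicator measurableSet_Ici, hs, integral_Ico_eq_integral_Ioc,
      integral_smul_const, ← intervalIntegral.integral_of_le ht.2.le, ftc, neg_smul]
  have z0 : ∫ x, deriv φ x • f 0 ∂unitVol = 0 := by
    rw [integral_smul_const, ← integral_Ioc_eq_integral_Ioo,
      ← intervalIntegral.integral_of_le zero_le_one, ftc, hφ0, neg_zero, zero_smul]
  rw [setIntegral_congr_fun measurableSet_Ioo e1, integral_add (hdi.smul_const _)
    hK.integral_prod_left, z0, zero_add, integral_integral_swap hK,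
    setIntegral_congr_fun measurableSet_Ioo e2, integral_neg]

/-- The element of `H¹(0,1)` given by a function `f` with `f(x) = f(0) + ∫₀ˣ v`, `v ∈ L²(0,1)`. -/
def ofPrimitive (f v : ℝ → ℂ) (hv : MemLp v 2 unitVol)
    (hf : ∀ x ∈ Icc (0 : ℝ) 1, f x = f 0 + ∫ t in (0 : ℝ)..x, v t) : H1 :=
  mkH1 ((memLp_of_continuousOn (continuousOn_primitive hv hf)).toLp f) (hv.toLp v) (by
    intro φ h1 h2 h3
    have e1 := (MemLp.coeFn_toLp (memLp_of_continuousOn (continuousOn_primitive hv hf))).mono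
      fun x hx => congrArg (deriv φ x • ·) hx
    have e2 := (MemLp.coeFn_toLp hv).mono fun x hx => congrArg (φ x • ·) hx
    exact (integral_congr_ae e1).trans ((weakDeriv_primitive hv hf h1 h3).trans
      (congrArg Neg.neg (integral_congr_ae e2).symm)))

lemma fn_ofPrimitive (f v : ℝ → ℂ) (hv : MemLp v 2 unitVol)
    (hf : ∀ x ∈ Icc (0 : ℝ) 1, f x = f 0 + ∫ t in (0 : ℝ)..x, v t) :
    fn (ofPrimitive f v hv hf) =ᵐ[unitVol] f :=
  MemLp.coeFn_toLp (memLp_of_continuousOn (continuousOn_primitive hv hf))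

/-! ### The energy space -/

/-- The subspace `{u ∈ H¹(0,1) : u(0) = 0}`; the value at `0` is that of the continuous
representative. -/
def H10 : Submodule ℂ H1 where
  carrier := {u | ∃ f : ℝ → ℂ, ContinuousOn f (Icc 0 1) ∧ fn u =ᵐ[unitVol] f ∧ f 0 = 0}
  zero_mem' := ⟨0, continuousOn_const, fn_zero, rfl⟩
  add_mem' := by
    rintro a b ⟨f, hf, haf, hf0⟩ ⟨g, hg, hbg, hg0⟩
    exact ⟨f + g, hf.add hg, (fn_add a b).trans (haf.add hbg), by simp [hf0, hg0]⟩
  smul_mem' := by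
    rintro c a ⟨f, hf, haf, hf0⟩
    exact ⟨c • f, hf.const_smul c, (fn_smul c a).trans (haf.const_smul c), by simp [hf0]⟩

/-- The Hilbert space `{u ∈ H¹(0,1) : u(0) = 0} × H¹(0,1)` with
`‖(u₁,u₂)‖² = ‖u₁‖²_{H¹} + ‖u₂‖²_{H¹}`. -/
def EnergySpace : Type := WithLp 2 (H10 × H1)

namespace EnergySpace

instance : NormedAddCommGroup EnergySpace := inferInstanceAs (NormedAddCommGroup (WithLp 2 (H10 × H1)))

instance : InnerProductSpace ℂ EnergySpace :=
  inferInstanceAs (InnerProductSpace ℂ (WithLp 2 (H10 × H1)))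

/-- The element `(u₁, u₂)` of the energy space. -/
def mk (u₁ : H10) (u₂ : H1) : EnergySpace := WithLp.toLp 2 (u₁, u₂)

/-- First component. -/
def fst (u : EnergySpace) : H10 := WithLp.fst (p := 2) u

/-- Second component. -/
def snd (u : EnergySpace) : H1 := WithLp.snd (p := 2) u

@[ext] lemma ext {u v : EnergySpace} (h₁ : u.fst = v.fst) (h₂ : u.snd = v.snd) : u = v :=
  (WithLp.ofLp_injective 2) (Prod.ext h₁ h₂)

@[simp] lemma fst_mk (u₁ : H10) (u₂ : H1) : (mk u₁ u₂).fst = u₁ := rfl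
@[simp] lemma snd_mk (u₁ : H10) (u₂ : H1) : (mk u₁ u₂).snd = u₂ := rfl
@[simp] lemma fst_zero : (0 : EnergySpace).fst = 0 := rfl
@[simp] lemma snd_zero : (0 : EnergySpace).snd = 0 := rfl
@[simp] lemma fst_add (u v : EnergySpace) : (u + v).fst = u.fst + v.fst := rfl
@[simp] lemma snd_add (u v : EnergySpace) : (u + v).snd = u.snd + v.snd := rfl
@[simp] lemma fst_smul (c : ℂ) (u : EnergySpace) : (c • u).fst = c • u.fst := rfl
@[simp] lemma snd_smul (c : ℂ) (u : EnergySpace) : (c • u).snd = c • u.snd := rfl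

lemma norm_sq (u : EnergySpace) : ‖u‖ ^ 2 = ‖u.fst‖ ^ 2 + ‖u.snd‖ ^ 2 :=
  WithLp.prod_norm_sq_eq_of_L2 (α := H10) (β := H1) u

end EnergySpace

/-- The pair of functions `(f₁, f₂)` represents `u`, i.e. `u = (f₁, f₂)` a.e. on `(0,1)`. -/
def Represents (u : EnergySpace) (f₁ f₂ : ℝ → ℂ) : Prop :=
  fn (u.fst : H1) =ᵐ[unitVol] f₁ ∧ fn u.snd =ᵐ[unitVol] f₂

lemma Represents.ext {u v : EnergySpace} {f₁ f₂ : ℝ → ℂ} (hu : Represents u f₁ f₂)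
    (hv : Represents v f₁ f₂) : u = v :=
  EnergySpace.ext (Subtype.ext (ext_fn (hu.1.trans hv.1.symm))) (ext_fn (hu.2.trans hv.2.symm))

lemma Represents.congr {u : EnergySpace} {f₁ f₂ g₁ g₂ : ℝ → ℂ} (hu : Represents u f₁ f₂)
    (h₁ : EqOn f₁ g₁ (Icc 0 1)) (h₂ : EqOn f₂ g₂ (Icc 0 1)) : Represents u g₁ g₂ :=
  ⟨hu.1.trans ((ae_restrict_iff' measurableSet_Ioo).2
      (.of_forall fun _ hx => h₁ (Ioo_subset_Icc_self hx))),
    hu.2.trans ((ae_restrict_iff' measurableSet_Ioo).2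
      (.of_forall fun _ hx => h₂ (Ioo_subset_Icc_self hx)))⟩

lemma Represents.zero : Represents 0 0 0 := ⟨fn_zero, fn_zero⟩

lemma Represents.add {u v : EnergySpace} {f₁ f₂ g₁ g₂ : ℝ → ℂ} (hu : Represents u f₁ f₂)
    (hv : Represents v g₁ g₂) : Represents (u + v) (f₁ + g₁) (f₂ + g₂) :=
  ⟨(fn_add (u.fst : H1) (v.fst : H1)).trans (hu.1.add hv.1),
    (fn_add u.snd v.snd).trans (hu.2.add hv.2)⟩

lemma Represents.smul {u : EnergySpace} {f₁ f₂ : ℝ → ℂ} (c : ℂ) (hu : Represents u f₁ f₂) :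
    Represents (c • u) (c • f₁) (c • f₂) :=
  ⟨(fn_smul c (u.fst : H1)).trans (hu.1.const_smul c),
    (fn_smul c u.snd).trans (hu.2.const_smul c)⟩

/-! ### The free operator -/

/-- Derivative of a function on `[0,1]`, one-sided at the end points. -/
abbrev D (f : ℝ → ℂ) : ℝ → ℂ := derivWithin f (Icc 0 1)

/-- First component `u₂' - ρ u₁' - 2/(p-1) u₁` of the free operator. -/
def free₁ (p : ℝ) (f₁ f₂ : ℝ → ℂ) (ρ : ℝ) : ℂ :=
  D f₂ ρ - ρ * D f₁ ρ - ((2 / (p - 1) : ℝ) : ℂ) * f₁ ρ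

/-- Second component `u₁' - ρ u₂' - 2/(p-1) u₂` of the free operator. -/
def free₂ (p : ℝ) (f₁ f₂ : ℝ → ℂ) (ρ : ℝ) : ℂ :=
  D f₁ ρ - ρ * D f₂ ρ - ((2 / (p - 1) : ℝ) : ℂ) * f₂ ρ

/-- `u₁, u₂ ∈ C²[0,1]` with `u₁(0) = 0` and `u₂'(0) = 0`. -/
def IsClassical (f₁ f₂ : ℝ → ℂ) : Prop :=
  ContDiffOn ℝ 2 f₁ (Icc 0 1) ∧ ContDiffOn ℝ 2 f₂ (Icc 0 1) ∧ f₁ 0 = 0 ∧ D f₂ 0 = 0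

/-- The graph of the free operator on classical functions. -/
def freeGraph (p : ℝ) : Submodule ℂ (EnergySpace × EnergySpace) where
  carrier := {x | ∃ f₁ f₂ : ℝ → ℂ, IsClassical f₁ f₂ ∧ Represents x.1 f₁ f₂ ∧
    Represents x.2 (free₁ p f₁ f₂) (free₂ p f₁ f₂)}
  zero_mem' := by
    refine ⟨0, 0, ⟨contDiffOn_const, contDiffOn_const, rfl, ?_⟩, Represents.zero, ?_⟩
    · simp [D]
    · refine Represents.zero.congr (fun x _ => ?_) (fun x _ => ?_) <;> simp [free₁, free₂, D]
  add_mem' := by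
    rintro a b ⟨f₁, f₂, ⟨hf₁, hf₂, hf, hf'⟩, ha, ha'⟩ ⟨g₁, g₂, ⟨hg₁, hg₂, hg, hg'⟩, hb, hb'⟩
    have d₁ : ∀ x ∈ Icc (0 : ℝ) 1, D (f₁ + g₁) x = D f₁ x + D g₁ x := fun x hx =>
      derivWithin_add (hf₁.differentiableOn (by norm_num) x hx)
        (hg₁.differentiableOn (by norm_num) x hx)
    have d₂ : ∀ x ∈ Icc (0 : ℝ) 1, D (f₂ + g₂) x = D f₂ x + D g₂ x := fun x hx =>
      derivWithin_add (hf₂.differentiableOn (by norm_num) x hx)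
        (hg₂.differentiableOn (by norm_num) x hx)
    refine ⟨f₁ + g₁, f₂ + g₂, ⟨hf₁.add hg₁, hf₂.add hg₂, by simp [hf, hg], ?_⟩, ha.add hb, ?_⟩
    · rw [d₂ 0 (by simp), hf', hg', add_zero]
    · refine (ha'.add hb').congr (fun x hx => ?_) (fun x hx => ?_)
      · simp only [free₁, Pi.add_apply, d₁ x hx, d₂ x hx]; ring
      · simp only [free₂, Pi.add_apply, d₁ x hx, d₂ x hx]; ring
  smul_mem' := by
    rintro c a ⟨f₁, f₂, ⟨hf₁, hf₂, hf, hf'⟩, ha, ha'⟩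
    have d₁ : ∀ x ∈ Icc (0 : ℝ) 1, D (c • f₁) x = c * D f₁ x := fun x hx =>
      derivWithin_const_smul c (hf₁.differentiableOn (by norm_num) x hx)
    have d₂ : ∀ x ∈ Icc (0 : ℝ) 1, D (c • f₂) x = c * D f₂ x := fun x hx =>
      derivWithin_const_smul c (hf₂.differentiableOn (by norm_num) x hx)
    refine ⟨c • f₁, c • f₂, ⟨hf₁.const_smul c, hf₂.const_smul c, by simp [hf], ?_⟩, ha.smul c, ?_⟩
    · rw [d₂ 0 (by simp), hf', mul_zero]
    · refine (ha'.smul c).congr (fun x hx => ?_) (fun x hx => ?_)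
      · simp only [free₁, Pi.smul_apply, smul_eq_mul, d₁ x hx, d₂ x hx]; ring
      · simp only [free₂, Pi.smul_apply, smul_eq_mul, d₁ x hx, d₂ x hx]; ring

/-- The free operator
`(u₁, u₂) ↦ (u₂' - ρ u₁' - 2/(p-1) u₁, u₁' - ρ u₂' - 2/(p-1) u₂)` with domain
`{u ∈ C²[0,1] × C²[0,1] : u₁(0) = 0, u₂'(0) = 0}`. -/
def freeOp (p : ℝ) : EnergySpace →ₗ.[ℂ] EnergySpace := (freeGraph p).toLinearPMap

lemma eqOn_of_ae_eq {f g : ℝ → ℂ} (hf : ContinuousOn f (Icc 0 1)) (hg : ContinuousOn g (Icc 0 1))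
    (h : f =ᵐ[unitVol] g) : EqOn f g (Icc 0 1) :=
  Measure.eqOn_Icc_of_ae_eq volume zero_ne_one
    (by rwa [← restrict_Ioo_eq_restrict_Icc]) hf hg

lemma ofPrimitive_of_contDiffOn {f : ℝ → ℂ} (hf : ContDiffOn ℝ 1 f (Icc 0 1)) :
    MemLp (D f) 2 unitVol ∧ ∀ x ∈ Icc (0 : ℝ) 1, f x = f 0 + ∫ t in (0 : ℝ)..x, D f t := by
  have hc : ContinuousOn (D f) (Icc 0 1) :=
    hf.continuousOn_derivWithin (uniqueDiffOn_Icc zero_lt_one) le_rfl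
  refine ⟨memLp_of_continuousOn hc, fun x hx => ?_⟩
  have hsub : Icc 0 x ⊆ Icc (0 : ℝ) 1 := Icc_subset_Icc_right hx.2
  rw [intervalIntegral.integral_eq_sub_of_hasDerivAt_of_le hx.1 (hf.continuousOn.mono hsub)
    (f' := D f) ?_ ?_]
  · ring
  · intro t ht
    exact ((hf.differentiableOn (by norm_num)) t ⟨ht.1.le, ht.2.le.trans hx.2⟩).hasDerivWithinAt.hasDerivAt
        (Icc_mem_nhds ht.1 (ht.2.trans_le hx.2))
  · exact ContinuousOn.intervalIntegrable_of_Icc hx.1 (hc.mono hsub)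

/-- `(u, w)` lies in the graph of the free operator iff `u` is classical and `w` is given by the
formula for the free operator. -/
lemma freeOp_graph (p : ℝ) : (freeOp p).graph = freeGraph p := by
  refine Submodule.toLinearPMap_graph_eq _ ?_
  rintro ⟨u, w⟩ ⟨f₁, f₂, ⟨h₁, h₂, -, -⟩, hu, hw⟩ rfl
  have z₁ : EqOn f₁ 0 (Icc 0 1) :=
    eqOn_of_ae_eq h₁.continuousOn continuousOn_const (hu.1.symm.trans fn_zero)
  have z₂ : EqOn f₂ 0 (Icc 0 1) :=
    eqOn_of_ae_eq h₂.continuousOn continuousOn_const (hu.2.symm.trans fn_zero)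
  have d₁ : ∀ x ∈ Icc (0 : ℝ) 1, D f₁ x = 0 := fun x hx => by
    rw [D, derivWithin_congr z₁ (z₁ hx)]; simp
  have d₂ : ∀ x ∈ Icc (0 : ℝ) 1, D f₂ x = 0 := fun x hx => by
    rw [D, derivWithin_congr z₂ (z₂ hx)]; simp
  refine (hw.congr (fun x hx => ?_) (fun x hx => ?_)).ext Represents.zero
  · simp [free₁, d₁ x hx, d₂ x hx, z₁ hx]
  · simp [free₂, d₁ x hx, d₂ x hx, z₂ hx]

/-- The domain of the free operator consists of all classical pairs. -/
lemma mem_freeOp_domain_iff (p : ℝ) (u : EnergySpace) :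
    u ∈ (freeOp p).domain ↔ ∃ f₁ f₂ : ℝ → ℂ, IsClassical f₁ f₂ ∧ Represents u f₁ f₂ := by
  rw [LinearPMap.mem_domain_iff, freeOp_graph]
  constructor
  · rintro ⟨w, f₁, f₂, hf, hu, -⟩
    exact ⟨f₁, f₂, hf, hu⟩
  · rintro ⟨f₁, f₂, hf, hu⟩
    have hD : ∀ f : ℝ → ℂ, ContDiffOn ℝ 2 f (Icc 0 1) → ContDiffOn ℝ 1 (D f) (Icc 0 1) :=
      fun f h => h.derivWithin (uniqueDiffOn_Icc zero_lt_one) (by norm_num)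
    have hid : ContDiffOn ℝ 1 (fun ρ : ℝ => (ρ : ℂ)) (Icc 0 1) :=
      Complex.ofRealCLM.contDiff.contDiffOn
    have c₁ : ContDiffOn ℝ 1 (free₁ p f₁ f₂) (Icc 0 1) :=
      ((hD _ hf.2.1).sub (hid.mul (hD _ hf.1))).sub
        (contDiffOn_const.mul (hf.1.of_le (by norm_num)))
    have c₂ : ContDiffOn ℝ 1 (free₂ p f₁ f₂) (Icc 0 1) :=
      ((hD _ hf.1).sub (hid.mul (hD _ hf.2.1))).sub
        (contDiffOn_const.mul (hf.2.1.of_le (by norm_num)))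
    obtain ⟨m₁, i₁⟩ := ofPrimitive_of_contDiffOn c₁
    obtain ⟨m₂, i₂⟩ := ofPrimitive_of_contDiffOn c₂
    refine ⟨EnergySpace.mk ⟨ofPrimitive _ _ m₁ i₁, _, c₁.continuousOn,
      fn_ofPrimitive _ _ m₁ i₁, ?_⟩ (ofPrimitive _ _ m₂ i₂), f₁, f₂, hf, hu,
      fn_ofPrimitive _ _ m₁ i₁, fn_ofPrimitive _ _ m₂ i₂⟩
    simp [free₁, hf.2.2.1, hf.2.2.2]

/-! ### The full linearized operator -/

/-- `κ_p = 2(p+1)/(p-1)²`. -/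
def kappa (p : ℝ) : ℝ := 2 * (p + 1) / (p - 1) ^ 2

lemma intervalIntegrable_fn (u : H1) {x : ℝ} (hx : x ∈ Ioo (0 : ℝ) 1) :
    IntervalIntegrable (fn u) volume 0 x :=
  (intervalIntegrable_of_memLp (Lp.memLp (toL2 u))).mono_set
    (uIcc_subset_uIcc_left (by rw [uIcc_of_le zero_le_one]; exact Ioo_subset_Icc_self hx))

lemma intervalIntegral_congr_fn {f g : ℝ → ℂ} (h : f =ᵐ[unitVol] g) {x : ℝ}
    (hx : x ∈ Ioo (0 : ℝ) 1) : ∫ s in (0 : ℝ)..x, f s = ∫ s in (0 : ℝ)..x, g s := by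
  refine intervalIntegral.integral_congr_ae ?_
  filter_upwards [(ae_restrict_iff' measurableSet_Ioo).1 h] with s hs hs'
  rw [uIoc_of_le hx.1.le] at hs'
  exact hs ⟨hs'.1, hs'.2.trans_lt hx.2⟩

lemma memLp_fn (u : H1) : MemLp (fn u) 2 unitVol := Lp.memLp (toL2 u)

/-- The element `ρ ↦ ∫₀^ρ u` of `H¹(0,1)`. -/
def primitive (u : H1) : H1 :=
  ofPrimitive (fun ρ => ∫ s in (0 : ℝ)..ρ, fn u s) (fn u) (memLp_fn u) (fun x _ => by simp)

lemma fn_primitive (u : H1) : fn (primitive u) =ᵐ[unitVol] fun ρ => ∫ s in (0 : ℝ)..ρ, fn u s :=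
  fn_ofPrimitive _ _ (memLp_fn u) (fun x _ => by simp)

/-- The Volterra operator `V : H¹(0,1) → {u ∈ H¹(0,1) : u(0) = 0}`, `(V u)(ρ) = ∫₀^ρ u`. -/
def volterra : H1 →ₗ[ℂ] H10 where
  toFun u := ⟨primitive u, fun ρ => ∫ s in (0 : ℝ)..ρ, fn u s,
    continuousOn_primitive (memLp_fn u) (fun x _ => by simp), fn_primitive u, by simp⟩
  map_add' u v := by
    refine Subtype.ext (ext_fn ?_)
    change fn (primitive (u + v)) =ᵐ[unitVol] fn (primitive u + primitive v)
    refine (fn_primitive _).trans (EventuallyEq.trans ?_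
      ((fn_add _ _).trans ((fn_primitive u).add (fn_primitive v))).symm)
    refine (ae_restrict_iff' measurableSet_Ioo).2 (.of_forall fun x hx => ?_)
    have hu := intervalIntegrable_fn u hx
    have hv := intervalIntegrable_fn v hx
    change ∫ s in (0 : ℝ)..x, fn (u + v) s = (∫ s in (0 : ℝ)..x, fn u s) + ∫ s in (0 : ℝ)..x, fn v s
    rw [intervalIntegral_congr_fn (fn_add u v) hx]
    exact intervalIntegral.integral_add hu hv
  map_smul' c u := by
    refine Subtype.ext (ext_fn ?_)
    change fn (primitive (c • u)) =ᵐ[unitVol] fn (c • primitive u)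
    refine (fn_primitive _).trans (EventuallyEq.trans ?_
      ((fn_smul _ _).trans ((fn_primitive u).const_smul c)).symm)
    refine (ae_restrict_iff' measurableSet_Ioo).2 (.of_forall fun x hx => ?_)
    change ∫ s in (0 : ℝ)..x, fn (c • u) s = c • ∫ s in (0 : ℝ)..x, fn u s
    rw [intervalIntegral_congr_fn (fn_smul c u) hx]
    exact intervalIntegral.integral_smul c _

/-- The perturbation `L' (u₁, u₂) = (p κ_p ∫₀^ρ u₂, 0)`. -/
def pertOp (p : ℝ) : EnergySpace →ₗ[ℂ] EnergySpace where
  toFun u := EnergySpace.mk (((p * kappa p : ℝ) : ℂ) • volterra u.snd) 0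
  map_add' u v := by
    refine EnergySpace.ext ?_ ?_ <;> simp
  map_smul' c u := by
    refine EnergySpace.ext ?_ ?_ <;> simp [smul_comm c]

/-- The linearized operator `L = L₀ + L'` with domain `D(L) = D(L₀)`, where `L₀` is the closure of
the free operator. -/
def linOp (p : ℝ) : EnergySpace →ₗ.[ℂ] EnergySpace := pertOp p +ᵥ (freeOp p).closure

/-- The symmetry mode `g(ρ) = ((p+1)/(p-1) ρ, 1)`. -/
def symMode (p : ℝ) : EnergySpace :=
  EnergySpace.mk
    ⟨ofPrimitive (fun ρ => (((p + 1) / (p - 1) * ρ : ℝ) : ℂ))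
        (fun _ => (((p + 1) / (p - 1) : ℝ) : ℂ)) (memLp_const _) (fun x _ => by simp; ring),
      fun ρ => (((p + 1) / (p - 1) * ρ : ℝ) : ℂ), by fun_prop, fn_ofPrimitive _ _ _ _, by simp⟩
    (ofPrimitive (fun _ => 1) (fun _ => 0) (memLp_const _) (fun x _ => by simp))

/-- The symmetry mode is represented by the pair of functions `((p+1)/(p-1) ρ, 1)`. -/
lemma represents_symMode (p : ℝ) :
    Represents (symMode p) (fun ρ => (((p + 1) / (p - 1) * ρ : ℝ) : ℂ)) (fun _ => 1) :=
  ⟨fn_ofPrimitive _ (fun _ => (((p + 1) / (p - 1) : ℝ) : ℂ)) (memLp_const _)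
      (fun x _ => by simp; ring),
    fn_ofPrimitive _ (fun _ => 0) (memLp_const _) (fun x _ => by simp)⟩

/-! ### Semigroups, generators and spectral projections -/

section Abstract

variable {E : Type*} [NormedAddCommGroup E] [NormedSpace ℂ E]

/-- A strongly continuous one-parameter semigroup of bounded linear operators. -/
structure C0Semigroup (E : Type*) [NormedAddCommGroup E] [NormedSpace ℂ E] where
  /-- The operator at time `τ`. -/
  op : ℝ≥0 → E →L[ℂ] E
  op_zero : op 0 = 1
  op_add : ∀ s t, op (s + t) = op s * op t
  continuous_orbit : ∀ x, Continuous fun t => op t x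

/-- `A` is the generator of `S`: `x ∈ D(A)` and `A x = y` iff `(S(h)x - x)/h → y` as `h → 0+`. -/
def C0Semigroup.IsGeneratedBy (S : C0Semigroup E) (A : E →ₗ.[ℂ] E) : Prop :=
  ∀ x y : E, (x, y) ∈ A.graph ↔
    Tendsto (fun h : ℝ≥0 => (((h : ℝ) : ℂ)⁻¹) • (S.op h x - x)) (𝓝[>] 0) (𝓝 y)

/-- `z` belongs to the resolvent set of `A` and `R = (z - A)⁻¹`:
for all `f`, `u = R f` is the unique solution `u ∈ D(A)` of `(z - A) u = f`. -/
def IsResolventAt (A : E →ₗ.[ℂ] E) (z : ℂ) (R : E →L[ℂ] E) : Prop :=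
  ∀ f u : E, R f = u ↔ (u, z • u - f) ∈ A.graph

/-- `P` is the spectral projection of `A` associated with the isolated spectral point `z₀`:
`z₀` is in the spectrum, some punctured closed disc around `z₀` lies in the resolvent set, and
`P = (2πi)⁻¹ ∮ (z - A)⁻¹ dz` over the positively oriented boundary of that disc. -/
def IsSpectralProjection (A : E →ₗ.[ℂ] E) (z₀ : ℂ) (P : E →L[ℂ] E) : Prop :=
  (¬ ∃ R, IsResolventAt A z₀ R) ∧
  ∃ (r : ℝ) (R : ℂ → E →L[ℂ] E), 0 < r ∧
    (∀ z, z ≠ z₀ → ‖z - z₀‖ ≤ r → IsResolventAt A z (R z)) ∧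
    P = (2 * Real.pi * Complex.I : ℂ)⁻¹ • ∮ z in C(z₀, r), R z

end Abstract

end SelfSimilarWave

end

open SelfSimilarWave

/-!
Write `a = 2 / (p - 1)`, so that `0 < a < 1`. The idea is to read a pair `(u₁, u₂)` with `u₁(0) = 0` as
the single function `F = u₁ + u₂` on `(-1,1)`, where `u₁` is extended to an odd and `u₂` to an even
function. The energy space becomes `H¹(-1,1)`, with polynomials as a dense subspace (`el`,
`denseRange_el`, `norm_el_sq`), and the free operator becomes the transport operator
`F ↦ (1 - x) F' - a F`. It generates the explicit semigroup `F ↦ e^{-a t} F(1 - e^{-t} (1 - x))`, of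
norm at most `3 e^{-a t}` (`exists_freeSemigroup`).

Polynomials are a core for the generator of this semigroup, since `1 - L₀` maps the space of
polynomials onto itself (`genGraph_le_closure`). As polynomials are classical and the generator extends
the free operator (`freeGraph_le_genGraph`), the generator is the closure of the free operator.

The perturbation `L'` is bounded and compact, so `L` generates a semigroup `S` given by Duhamel's
formula (`C0Semigroup.exists_duhamel`), and `S(t) - S₀(t)` is compact
(`C0Semigroup.isCompactOperator_sub_of_duhamel`). Let `P` be a compact projection commuting with `S`.
Since `‖S₀(T)‖ < e^{-b T}` for `b < a` and large `T`, a spectral point of `S(T) (1 - P)` of modulus at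
least `e^{-b T}` is, by the Fredholm alternative, the eigenvalue of some functional. Averaging this
functional over the time interval `[0,T]` makes it an eigenfunctional of all `S(t)`, that vanishes on
the range of `P`. If there is none, then `S(t) (1 - P)` decays like `e^{-b t}`
(`C0Semigroup.exists_decay`).

On polynomials, the eigenvalue equation for a functional `ψ` is a two-term recursion for the numbers
`ψ(xⁿ)`. It shows that in `Re z > -a` the only eigenvalue is `1`, and that an eigenfunctional to the
eigenvalue `1` does not vanish on the symmetry mode `g` (`eigenfunctional_eq_zero`). An eigenfunctional
to the eigenvalue `1` is given explicitly by integration against a power of `1 - x²` (`dualMode`), and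
`P` is the projection onto `g` along its kernel. Near `1` the resolvent of `L` is `(z - 1)⁻¹ P` plus a
holomorphic function, so that `P` is the spectral projection
(`C0Semigroup.isSpectralProjection_of_decay`).
-/

noncomputable section

namespace SelfSimilarWave

/-! ### Strongly continuous semigroups and their generators -/

section Semigroup

variable {E : Type*} [NormedAddCommGroup E] [NormedSpace ℂ E]

namespace C0Semigroup

variable (S : C0Semigroup E)

/-- The semigroup with real time; it is the identity for negative times. -/
def flow (t : ℝ) : E →L[ℂ] E := S.op t.toNNReal

@[simp] lemma flow_zero : S.flow 0 = 1 := by simp [flow, S.op_zero]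

lemma flow_coe (t : ℝ≥0) : S.flow t = S.op t := by simp [flow]

lemma flow_add {s t : ℝ} (hs : 0 ≤ s) (ht : 0 ≤ t) : S.flow (s + t) = S.flow s * S.flow t := by
  rw [flow, Real.toNNReal_add hs ht, S.op_add]; rfl

lemma flow_add_apply {s t : ℝ} (hs : 0 ≤ s) (ht : 0 ≤ t) (x : E) :
    S.flow (s + t) x = S.flow s (S.flow t x) := by
  rw [S.flow_add hs ht]; rfl

lemma continuous_flow (x : E) : Continuous fun t => S.flow t x :=
  (S.continuous_orbit x).comp continuous_real_toNNReal

/-- `x` lies in the domain of the generator of `S`, which maps `x` to `y`. The difference quotient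
of the orbit at time `0` is expressed as a one-sided derivative. -/
def Gen (x y : E) : Prop := HasDerivWithinAt (fun t : ℝ => S.flow t x) y (Ici 0) 0

lemma gen_iff_tendsto (x y : E) : S.Gen x y ↔
    Tendsto (fun h : ℝ≥0 => (((h : ℝ) : ℂ)⁻¹) • (S.op h x - x)) (𝓝[>] 0) (𝓝 y) := by
  have key : Tendsto (fun h : ℝ≥0 => (((h : ℝ) : ℂ)⁻¹) • (S.op h x - x)) (𝓝[>] 0) (𝓝 y) ↔
      Tendsto (fun t : ℝ => t⁻¹ • (S.flow (0 + t) x - S.flow 0 x)) (𝓝[>] 0) (𝓝 y) := by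
    constructor
    · intro h
      have h1 : Tendsto Real.toNNReal (𝓝[>] (0 : ℝ)) (𝓝[>] (0 : ℝ≥0)) := by
        refine tendsto_nhdsWithin_iff.2 ⟨?_, ?_⟩
        · have := continuous_real_toNNReal.tendsto (0 : ℝ)
          rw [Real.toNNReal_zero] at this
          exact this.mono_left nhdsWithin_le_nhds
        · filter_upwards [self_mem_nhdsWithin] with t ht
          simpa using ht
      refine (h.comp h1).congr' ?_
      filter_upwards [self_mem_nhdsWithin] with t ht
      have ht' : (0 : ℝ) ≤ t := le_of_lt ht
      simp only [Function.comp_apply, zero_add, flow_zero, one_apply_eq_self]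
      rw [flow, Real.coe_toNNReal t ht', ← Complex.ofReal_inv, Complex.coe_smul]
    · intro h
      have h1 : Tendsto ((↑) : ℝ≥0 → ℝ) (𝓝[>] (0 : ℝ≥0)) (𝓝[>] (0 : ℝ)) := by
        refine tendsto_nhdsWithin_iff.2 ⟨?_, ?_⟩
        · exact (NNReal.continuous_coe.tendsto 0).mono_left nhdsWithin_le_nhds
        · filter_upwards [self_mem_nhdsWithin] with t ht
          simpa using ht
      refine (h.comp h1).congr fun t => ?_
      simp only [Function.comp_apply, zero_add, flow_zero, one_apply_eq_self, flow_coe]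
      rw [← Complex.ofReal_inv, Complex.coe_smul]
  rw [key, Gen, ← hasDerivWithinAt_Ioi_iff_Ici, hasDerivWithinAt_iff_tendsto_slope]
  have e : Ioi (0 : ℝ) \ {0} = Ioi 0 := by simp
  rw [e]
  refine tendsto_congr fun t => ?_
  simp [slope_def_module]

lemma isGeneratedBy_iff (A : E →ₗ.[ℂ] E) :
    S.IsGeneratedBy A ↔ ∀ x y, (x, y) ∈ A.graph ↔ S.Gen x y := by
  simp only [IsGeneratedBy, gen_iff_tendsto]

variable {S}

lemma Gen.unique {x y z : E} (hy : S.Gen x y) (hz : S.Gen x z) : y = z :=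
  UniqueDiffWithinAt.eq_deriv _ (uniqueDiffWithinAt_Ici 0) hy hz

lemma Gen.add {x x' y y' : E} (h : S.Gen x y) (h' : S.Gen x' y') : S.Gen (x + x') (y + y') := by
  unfold Gen; simpa only [map_add] using! HasDerivWithinAt.add h h'

lemma Gen.smul {x y : E} (c : ℂ) (h : S.Gen x y) : S.Gen (c • x) (c • y) := by
  unfold Gen; simpa only [map_smul] using! HasDerivWithinAt.const_smul c h

lemma Gen.sub {x x' y y' : E} (h : S.Gen x y) (h' : S.Gen x' y') : S.Gen (x - x') (y - y') := by
  unfold Gen; simpa only [map_sub] using! HasDerivWithinAt.sub h h'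

/-- Orbits starting in the domain of the generator are differentiable from the right. -/
lemma Gen.hasDerivWithinAt {x y : E} (h : S.Gen x y) {t : ℝ} (ht : 0 ≤ t) :
    HasDerivWithinAt (fun t : ℝ => S.flow t x) (S.flow t y) (Ici t) t := by
  have h1 : HasDerivWithinAt (fun s : ℝ => S.flow (s - t) x) y (Ici t) t := by
    have h2 : HasDerivWithinAt (fun s : ℝ => s - t) 1 (Ici t) t :=
      (hasDerivWithinAt_id t _).sub_const t
    have h3 : HasDerivWithinAt (fun s : ℝ => S.flow s x) y (Ici 0) (t - t) := by
      rw [sub_self]; exact h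
    simpa using! HasDerivWithinAt.scomp (h := fun s : ℝ => s - t) t h3 h2
      (fun s (hs : t ≤ s) => sub_nonneg.2 hs)
  have h4 := ((S.flow t).restrictScalars ℝ).hasFDerivAt.comp_hasDerivWithinAt t h1
  refine h4.congr (fun s hs => ?_) ?_
  · have hs' : 0 ≤ s - t := sub_nonneg.2 hs
    have := S.flow_add_apply ht hs' x
    simpa using this
  · simp

/-- The domain of the generator is invariant under the semigroup. -/
lemma Gen.flow {x y : E} (h : S.Gen x y) {t : ℝ} (ht : 0 ≤ t) :
    S.Gen (S.flow t x) (S.flow t y) := by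
  have h4 := ((S.flow t).restrictScalars ℝ).hasFDerivAt.comp_hasDerivWithinAt 0 h
  refine h4.congr (fun s hs => ?_) ?_
  · have := S.flow_add_apply ht hs x
    rw [add_comm, S.flow_add_apply hs ht] at this
    simpa using this
  · simp

/-- An eigenvector of the generator is an eigenvector of the semigroup. -/
lemma Gen.flow_eigenvector {x : E} {z : ℂ} (h : S.Gen x (z • x)) {t : ℝ} (ht : 0 ≤ t) :
    S.flow t x = Complex.exp (z * t) • x := by
  have hd : ∀ s ∈ Ico 0 t, HasDerivWithinAt
      (fun s : ℝ => Complex.exp (-(z * s)) • S.flow s x) 0 (Ici s) s := by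
    intro s hs
    have h1 : HasDerivAt (fun s : ℝ => Complex.exp (-(z * s))) (Complex.exp (-(z * s)) * (-(z * 1))) s :=
      (((Complex.ofRealCLM.hasDerivAt (x := s)).const_mul z).neg).cexp
    have h2 := h1.hasDerivWithinAt (s := Ici s) |>.smul (h.hasDerivWithinAt hs.1)
    convert! h2 using 1
    simp only [map_smul, smul_smul, ← add_smul]
    ring_nf
    simp
  have hc : ContinuousOn (fun s : ℝ => Complex.exp (-(z * s)) • S.flow s x) (Icc 0 t) := by
    have := S.continuous_flow x
    fun_prop
  have := constant_of_has_deriv_right_zero hc hd t ⟨ht, le_rfl⟩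
  simp only [Complex.ofReal_zero, mul_zero, neg_zero, Complex.exp_zero, one_smul, flow_zero,
    one_apply_eq_self] at this
  nth_rewrite 2 [← this]
  rw [smul_smul, ← Complex.exp_add]
  simp

/-- A functional that is an eigenvector of the adjoint of the generator is an eigenvector of the
adjoint semigroup. -/
lemma flow_eigenfunctional {ψ : E →L[ℂ] ℂ} {z : ℂ} (hψ : ∀ x y, S.Gen x y → ψ y = z * ψ x)
    (hd : Dense {x | ∃ y, S.Gen x y}) {t : ℝ} (ht : 0 ≤ t) (x : E) :
    ψ (S.flow t x) = Complex.exp (z * t) * ψ x := by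
  refine hd.induction (P := fun x => ψ (S.flow t x) = Complex.exp (z * t) * ψ x) ?_
    (isClosed_eq (by fun_prop) (by fun_prop)) x
  rintro x ⟨y, h⟩
  have hd : ∀ s ∈ Ico 0 t, HasDerivWithinAt
      (fun s : ℝ => Complex.exp (-(z * s)) • ψ (S.flow s x)) 0 (Ici s) s := by
    intro s hs
    have h1 : HasDerivAt (fun s : ℝ => Complex.exp (-(z * s))) (Complex.exp (-(z * s)) * (-(z * 1))) s :=
      (((Complex.ofRealCLM.hasDerivAt (x := s)).const_mul z).neg).cexp
    have h3 := (ψ.restrictScalars ℝ).hasFDerivAt.comp_hasDerivWithinAt s (h.hasDerivWithinAt hs.1)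
    have h2 := h1.hasDerivWithinAt (s := Ici s) |>.smul h3
    convert! h2 using 1
    have := hψ _ _ (h.flow hs.1)
    simp only [ContinuousLinearMap.coe_restrictScalars', this, smul_eq_mul, Function.comp_apply]
    ring
  have hc : ContinuousOn (fun s : ℝ => Complex.exp (-(z * s)) • ψ (S.flow s x)) (Icc 0 t) := by
    have := S.continuous_flow x
    fun_prop
  have := constant_of_has_deriv_right_zero hc hd t ⟨ht, le_rfl⟩
  simp only [Complex.ofReal_zero, mul_zero, neg_zero, Complex.exp_zero, one_smul, flow_zero,
    one_apply_eq_self] at this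
  rw [← this, smul_eq_mul, ← mul_assoc, ← Complex.exp_add]
  simp

/-- An exponentially bounded semigroup is jointly continuous. -/
lemma continuous_flow_uncurry {M w : ℝ} (hM : ∀ t, 0 ≤ t → ∀ x, ‖S.flow t x‖ ≤ M * Real.exp (w * t) * ‖x‖) :
    Continuous fun z : ℝ × E => S.flow z.1 z.2 := by
  refine continuous_iff_continuousAt.2 fun ⟨t, x⟩ => ?_
  have h1 : Tendsto (fun z : ℝ × E => S.flow z.1 (z.2 - x)) (𝓝 (t, x)) (𝓝 0) := by
    have h2 : Tendsto (fun z : ℝ × E => M * Real.exp (w * max z.1 0) * ‖z.2 - x‖) (𝓝 (t, x)) (𝓝 0) := by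
      have : Continuous (fun z : ℝ × E => M * Real.exp (w * max z.1 0) * ‖z.2 - x‖) := by fun_prop
      simpa using this.tendsto (t, x)
    refine squeeze_zero_norm (fun z => ?_) h2
    have := hM (max z.1 0) (le_max_right _ _) (z.2 - x)
    rwa [show S.flow (max z.1 0) = S.flow z.1 by
      rcases le_total z.1 0 with h | h
      · simp [flow, h, Real.toNNReal_of_nonpos h]
      · simp [h]] at this
  have h3 : Tendsto (fun z : ℝ × E => S.flow z.1 x) (𝓝 (t, x)) (𝓝 (S.flow t x)) :=
    ((S.continuous_flow x).comp continuous_fst).tendsto (t, x)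
  have := h1.add h3
  simpa [ContinuousAt] using this

/-- A semigroup is determined by its generator. -/
lemma flow_eq_of_gen {S' : C0Semigroup E} {M w : ℝ}
    (hM : ∀ t, 0 ≤ t → ∀ x, ‖S'.flow t x‖ ≤ M * Real.exp (w * t) * ‖x‖)
    (hg : ∀ x y, S.Gen x y → S'.Gen x y) (hd : Dense {x | ∃ y, S.Gen x y}) {t : ℝ} (ht : 0 ≤ t) (x : E) :
    S.flow t x = S'.flow t x := by
  refine hd.induction (P := fun x => S.flow t x = S'.flow t x) ?_
    (isClosed_eq (by fun_prop) (by fun_prop)) x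
  rintro x ⟨y, h⟩
  have hj := continuous_flow_uncurry hM
  have hc : ContinuousOn (fun s : ℝ => S'.flow (t - s) (S.flow s x)) (Icc 0 t) := by
    have h1 : Continuous fun s : ℝ => (t - s, S.flow s x) := by
      have := S.continuous_flow x
      fun_prop
    exact (hj.comp h1).continuousOn
  have hd : ∀ s ∈ Ico 0 t, HasDerivWithinAt
      (fun s : ℝ => S'.flow (t - s) (S.flow s x)) 0 (Ici s) s := by
    intro s hs
    have g1 := h.flow hs.1
    have g2 : HasDerivWithinAt (fun r : ℝ => S.flow r (S.flow s x) - S'.flow r (S.flow s x))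
        0 (Ici 0) 0 := by
      simpa using! HasDerivWithinAt.sub g1 (hg _ _ g1)
    rw [← hasDerivWithinAt_Ioi_iff_Ici, hasDerivWithinAt_iff_tendsto_slope] at g2 ⊢
    have e (s : ℝ) : Ioi s \ {s} = Ioi s := by simp
    rw [e] at g2 ⊢
    -- the difference quotient is `S'(t - r)` applied to that of `g2`, shifted by `s`
    have h0 : Tendsto (fun r : ℝ => r - s) (𝓝[>] s) (𝓝[>] 0) := by
      refine tendsto_nhdsWithin_iff.2 ⟨?_, ?_⟩
      · have : Continuous fun r : ℝ => r - s := by fun_prop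
        simpa using (this.tendsto s).mono_left nhdsWithin_le_nhds
      · filter_upwards [self_mem_nhdsWithin] with r hr
        simpa using hr
    have h5 : Tendsto (fun r : ℝ => (t - r,
        slope (fun r : ℝ => S.flow r (S.flow s x) - S'.flow r (S.flow s x)) 0 (r - s)))
        (𝓝[>] s) (𝓝 (t - s, 0)) := by
      refine Tendsto.prodMk_nhds ?_ (g2.comp h0)
      have : Continuous fun r : ℝ => t - r := by fun_prop
      exact (this.tendsto s).mono_left nhdsWithin_le_nhds
    have h6 := (hj.tendsto (t - s, 0)).comp h5
    simp only [map_zero] at h6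
    refine h6.congr' ?_
    have hlt : ∀ᶠ r in 𝓝[>] s, r < t := mem_nhdsWithin_of_mem_nhds (Iio_mem_nhds hs.2)
    filter_upwards [self_mem_nhdsWithin, hlt] with r hr hrt
    have hr' : 0 ≤ r - s := sub_nonneg.2 (le_of_lt hr)
    simp only [Function.comp_apply, slope_def_module, sub_zero, flow_zero]
    rw [← ContinuousLinearMap.coe_restrictScalars' (R := ℝ), map_smul]
    congr 1
    have e1 := S.flow_add_apply hr' hs.1 x
    have e2 := S'.flow_add_apply (sub_nonneg.2 hrt.le) hr' (S.flow s x)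
    rw [sub_add_cancel] at e1
    rw [show t - r + (r - s) = t - s by ring] at e2
    simp [e1, e2]
  have := constant_of_has_deriv_right_zero hc hd t ⟨ht, le_rfl⟩
  simpa using this

/-- If the orbits of `S` starting in the range of `Q` are bounded, then `u - A u = Q f`, where `A` is the
generator of `S`, is solved by the Laplace transform `∫₀^∞ e^{-t} S(t) Q f`. -/
lemma exists_laplace [CompleteSpace E] (S : C0Semigroup E) (Q : E →L[ℂ] E) {C : ℝ}
    (hC : ∀ t, 0 ≤ t → ∀ f, ‖S.flow t (Q f)‖ ≤ C * ‖f‖) :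
    ∃ R : E →L[ℂ] E, ∀ f, S.Gen (R f) (R f - Q f) := by
  have hcont : ∀ f, Continuous fun t : ℝ => Real.exp (-t) • S.flow t (Q f) := fun f => by
    have := S.continuous_flow (Q f)
    fun_prop
  have hexp : IntegrableOn (fun t : ℝ => Real.exp (-t)) (Ioi 0) := integrableOn_exp_neg_Ioi 0
  have hbd : ∀ f, ∀ t ∈ Ioi (0 : ℝ), ‖Real.exp (-t) • S.flow t (Q f)‖ ≤ Real.exp (-t) * (C * ‖f‖) := by
    intro f t ht
    rw [norm_smul, Real.norm_of_nonneg (Real.exp_pos _).le]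
    exact mul_le_mul_of_nonneg_left (hC t (le_of_lt ht) f) (Real.exp_pos _).le
  have hint : ∀ f, IntegrableOn (fun t : ℝ => Real.exp (-t) • S.flow t (Q f)) (Ioi 0) := fun f =>
    Integrable.mono' (hexp.mul_const (C * ‖f‖)) (hcont f).aestronglyMeasurable
      ((ae_restrict_iff' measurableSet_Ioi).2 (.of_forall (hbd f)))
  let Rl : E →ₗ[ℂ] E :=
    { toFun f := ∫ t in Ioi (0 : ℝ), Real.exp (-t) • S.flow t (Q f)
      map_add' f g := by
        rw [← integral_add (hint f) (hint g)]
        simp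
      map_smul' c f := by
        rw [RingHom.id_apply, ← integral_smul]
        simp [smul_comm c] }
  refine ⟨Rl.mkContinuous C fun f => ?_, fun f => ?_⟩
  · have h1 : ‖Rl f‖ ≤ ∫ t in Ioi (0 : ℝ), Real.exp (-t) * (C * ‖f‖) :=
      norm_integral_le_of_norm_le (hexp.mul_const (C * ‖f‖))
        ((ae_restrict_iff' measurableSet_Ioi).2 (.of_forall (hbd f)))
    rwa [integral_mul_const, integral_exp_neg_Ioi_zero, one_mul] at h1
  · change S.Gen (Rl f) (Rl f - Q f)
    have hshift : ∀ t ∈ Ici (0 : ℝ), S.flow t (Rl f) =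
        Real.exp t • (Rl f - ∫ s in (0 : ℝ)..t, Real.exp (-s) • S.flow s (Q f)) := by
      intro t ht
      have h1 : Rl f - ∫ s in (0 : ℝ)..t, Real.exp (-s) • S.flow s (Q f) =
          ∫ s in Ioi t, Real.exp (-s) • S.flow s (Q f) :=
        (eq_sub_of_add_eq' (intervalIntegral.integral_interval_add_Ioi (hint f)
          ((hint f).mono_set (Ioi_subset_Ioi ht)))).symm
      have h2 : S.flow t (Rl f) = ∫ s in Ioi (0 : ℝ), S.flow t (Real.exp (-s) • S.flow s (Q f)) :=
        ((S.flow t).integral_comp_comm (hint f)).symm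
      rw [h1, h2, ← integral_smul]
      have h3 := (measurePreserving_add_right volume t).setIntegral_preimage_emb
        (measurableEmbedding_addRight t) (fun s => Real.exp t • Real.exp (-s) • S.flow s (Q f)) (Ioi t)
      rw [preimage_add_const_Ioi, sub_self] at h3
      rw [← h3]
      refine setIntegral_congr_fun measurableSet_Ioi fun s hs => ?_
      have hs' : (0 : ℝ) ≤ s := le_of_lt hs
      rw [add_comm s t, S.flow_add_apply ht hs', smul_smul, ← Real.exp_add,
        ← ContinuousLinearMap.coe_restrictScalars' (R := ℝ), map_smul]
      ring_nf
    have h1 : HasDerivAt (fun t => ∫ s in (0 : ℝ)..t, Real.exp (-s) • S.flow s (Q f)) (Q f) 0 := by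
      have := intervalIntegral.integral_hasDerivAt_right ((hcont f).intervalIntegrable 0 0)
        (hcont f).aestronglyMeasurable.stronglyMeasurableAtFilter (hcont f).continuousAt
      simpa using this
    have h2 := (Real.hasDerivAt_exp 0).smul (h1.const_sub (Rl f))
    refine (h2.hasDerivWithinAt (s := Ici 0)).congr_deriv ?_ |>.congr hshift (hshift 0 self_mem_Ici)
    simp
    abel

end C0Semigroup

end Semigroup

/-! ### Bounded perturbations of semigroups -/

section Perturbation

variable {E : Type*} [NormedAddCommGroup E] [NormedSpace ℂ E]

namespace C0Semigroup

lemma integral_exp_neg_mul_sub_le {δ t : ℝ} (hδ : 0 < δ) :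
    ∫ s in (0 : ℝ)..t, Real.exp (-(δ * (t - s))) ≤ δ⁻¹ := by
  have h : ∀ s ∈ uIcc 0 t, HasDerivAt (fun s => δ⁻¹ * Real.exp (-(δ * (t - s))))
      (Real.exp (-(δ * (t - s)))) s := by
    intro s _
    have := ((((hasDerivAt_id s).const_sub t).const_mul δ).neg.exp).const_mul δ⁻¹
    refine this.congr_deriv ?_
    simp only [Pi.neg_apply, id]
    field_simp
  rw [intervalIntegral.integral_eq_sub_of_hasDerivAt h
    (by apply Continuous.intervalIntegrable; fun_prop)]
  have : 0 < δ⁻¹ * Real.exp (-(δ * (t - 0))) := by positivity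
  simp only [sub_self, mul_zero, neg_zero, Real.exp_zero, mul_one]
  linarith

/-- Bounded perturbation theorem: the Duhamel equation with a bounded perturbation `B` is solved by
a strongly continuous semigroup. -/
theorem exists_duhamel [CompleteSpace E] (S₀ : C0Semigroup E) {M w : ℝ} (hM0 : 0 ≤ M)
    (hM : ∀ t, 0 ≤ t → ∀ x, ‖S₀.flow t x‖ ≤ M * Real.exp (w * t) * ‖x‖) (B : E →L[ℂ] E) :
    ∃ S : C0Semigroup E,
      (∃ M' w', 0 ≤ M' ∧ ∀ t, 0 ≤ t → ∀ x, ‖S.flow t x‖ ≤ M' * Real.exp (w' * t) * ‖x‖) ∧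
      ∀ t, 0 ≤ t → ∀ x, S.flow t x =
        S₀.flow t x + ∫ s in (0 : ℝ)..t, S₀.flow (t - s) (B (S.flow s x)) := by
  -- with the weight `exp (-w' t)`, the integral operator in Duhamel's formula is a contraction
  set δ : ℝ := 2 * (M * ‖B‖) + 1 with hδ_def
  have hδ : 0 < δ := by positivity
  have hδ2 : M * ‖B‖ * δ⁻¹ ≤ 1 / 2 := by
    rw [mul_inv_le_iff₀ hδ]; linarith
  set w' : ℝ := w + δ with hw'
  let U : ℝ → E →L[ℂ] E := fun t => Real.exp (-(w' * t)) • S₀.flow t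
  have hU : ∀ t x, U t x = Real.exp (-(w' * t)) • S₀.flow t x := fun t x => rfl
  have hUb : ∀ t, 0 ≤ t → ∀ x, ‖U t x‖ ≤ M * Real.exp (-(δ * t)) * ‖x‖ := by
    intro t ht x
    rw [hU, norm_smul, Real.norm_of_nonneg (Real.exp_pos _).le]
    calc _ ≤ Real.exp (-(w' * t)) * (M * Real.exp (w * t) * ‖x‖) :=
          mul_le_mul_of_nonneg_left (hM t ht x) (Real.exp_pos _).le
      _ = M * (Real.exp (-(w' * t)) * Real.exp (w * t)) * ‖x‖ := by ring
      _ = _ := by rw [← Real.exp_add]; congr 3; rw [hw']; ring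
  have hUadd : ∀ s t, 0 ≤ s → 0 ≤ t → ∀ x, U (s + t) x = U s (U t x) := by
    intro s t hs ht x
    simp only [hU]
    rw [S₀.flow_add_apply hs ht, ← ContinuousLinearMap.coe_restrictScalars' (R := ℝ), map_smul,
      smul_smul, ← Real.exp_add]
    congr 2; ring
  have hU0 : ∀ x, U 0 x = x := fun x => by simp [hU]
  have hUc : Continuous fun z : ℝ × E => U z.1 z.2 := by
    have := continuous_flow_uncurry hM
    simp only [hU]
    fun_prop
  have hker : ∀ u : BoundedContinuousFunction ℝ≥0 E,
      Continuous fun z : ℝ × ℝ => U (z.1 - z.2) (B (u z.2.toNNReal)) := by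
    intro u
    have h1 : Continuous fun z : ℝ × ℝ => (z.1 - z.2, B (u z.2.toNNReal)) := by fun_prop
    exact hUc.comp h1
  have hkert : ∀ (u : BoundedContinuousFunction ℝ≥0 E) (t : ℝ),
      Continuous fun s : ℝ => U (t - s) (B (u s.toNNReal)) := fun u t =>
    (hker u).comp (by fun_prop : Continuous fun s : ℝ => (t, s))
  let Vf : BoundedContinuousFunction ℝ≥0 E → ℝ≥0 → E := fun u t =>
    ∫ s in (0 : ℝ)..t, U (t - s) (B (u s.toNNReal))
  have hVb : ∀ u t, ‖Vf u t‖ ≤ 1 / 2 * ‖u‖ := by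
    intro u t
    have h1 : ‖Vf u t‖ ≤ ∫ s in (0 : ℝ)..t, M * Real.exp (-(δ * (t - s))) * (‖B‖ * ‖u‖) := by
      refine intervalIntegral.norm_integral_le_of_norm_le t.coe_nonneg ?_
        (by apply Continuous.intervalIntegrable; fun_prop)
      refine ae_of_all _ fun s hs => (hUb (t - s) (sub_nonneg.2 hs.2) _).trans ?_
      refine mul_le_mul_of_nonneg_left ?_ (by positivity)
      exact (B.le_opNorm _).trans (mul_le_mul_of_nonneg_left (u.norm_coe_le_norm _) (norm_nonneg _))
    rw [intervalIntegral.integral_mul_const, intervalIntegral.integral_const_mul] at h1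
    calc _ ≤ _ := h1
      _ ≤ M * δ⁻¹ * (‖B‖ * ‖u‖) := by
        gcongr
        exact integral_exp_neg_mul_sub_le hδ
      _ = M * ‖B‖ * δ⁻¹ * ‖u‖ := by ring
      _ ≤ _ := by gcongr
  let Vl : BoundedContinuousFunction ℝ≥0 E →ₗ[ℂ] BoundedContinuousFunction ℝ≥0 E :=
    { toFun u := BoundedContinuousFunction.ofNormedAddCommGroup (Vf u) (by
        have := intervalIntegral.continuous_parametric_intervalIntegral_of_continuous
          (μ := volume) (a₀ := 0) (f := fun (t : ℝ) s => U (t - s) (B (u s.toNNReal))) (hker u) continuous_id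
        exact this.comp NNReal.continuous_coe) (1 / 2 * ‖u‖) (hVb u)
      map_add' u v := by
        ext t
        simp only [BoundedContinuousFunction.coe_ofNormedAddCommGroup,
          BoundedContinuousFunction.coe_add, Pi.add_apply, Vf, map_add]
        exact intervalIntegral.integral_add ((hkert u t).intervalIntegrable _ _)
          ((hkert v t).intervalIntegrable _ _)
      map_smul' c u := by
        ext t
        simp only [BoundedContinuousFunction.coe_ofNormedAddCommGroup,
          BoundedContinuousFunction.coe_smul, Vf, map_smul, RingHom.id_apply]
        exact intervalIntegral.integral_smul c _ }
  let V := Vl.mkContinuous (1 / 2) fun u => by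
    refine (BoundedContinuousFunction.norm_le (by positivity)).2 (hVb u)
  have hVapp : ∀ u t, V u t = ∫ s in (0 : ℝ)..t, U (t - s) (B (u s.toNNReal)) := fun u t => rfl
  have hVn : ‖V‖ < 1 := (LinearMap.mkContinuous_norm_le _ (by norm_num) _).trans_lt (by norm_num)
  have hUb' : ∀ x (t : ℝ≥0), ‖U t x‖ ≤ M * ‖x‖ := by
    intro x t
    refine (hUb t t.coe_nonneg x).trans ?_
    have : Real.exp (-(δ * t)) ≤ 1 :=
      Real.exp_le_one_iff.2 (neg_nonpos.2 (mul_nonneg hδ.le t.coe_nonneg))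
    have := mul_le_mul_of_nonneg_left this hM0
    rw [mul_one] at this
    gcongr
  let ιl : E →ₗ[ℂ] BoundedContinuousFunction ℝ≥0 E :=
    { toFun x := BoundedContinuousFunction.ofNormedAddCommGroup (fun t : ℝ≥0 => U t x) (by
        exact hUc.comp (by fun_prop : Continuous fun t : ℝ≥0 => ((t : ℝ), x))) (M * ‖x‖) (hUb' x)
      map_add' x y := by ext t; simp
      map_smul' c x := by ext t; simp }
  let ι := ιl.mkContinuous M fun x => by
    exact (BoundedContinuousFunction.norm_le (by positivity)).2 (hUb' x)
  have hι : ∀ x (t : ℝ≥0), ι x t = U t x := fun x t => rfl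
  set X := BoundedContinuousFunction ℝ≥0 E
  let N := Units.oneSub V hVn
  let sol : E →L[ℂ] BoundedContinuousFunction ℝ≥0 E := (↑N⁻¹ : X →L[ℂ] X) ∘L ι
  have hsol : ∀ x t, sol x t = U t x + ∫ s in (0 : ℝ)..t, U (t - s) (B (sol x s.toNNReal)) := by
    intro x t
    have h1 : (N : X →L[ℂ] X) (sol x) = ι x := by
      change ((N : X →L[ℂ] X) * (↑N⁻¹ : X →L[ℂ] X)) (ι x) = ι x
      rw [Units.mul_inv]; rfl
    have h2 : sol x - V (sol x) = ι x := h1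
    have h3 := congrArg (fun u => u t) (sub_eq_iff_eq_add.1 h2)
    simpa [hVapp, hι] using h3
  have huniq : ∀ x v, (∀ t : ℝ≥0, v t = U t x + ∫ s in (0 : ℝ)..t, U (t - s) (B (v s.toNNReal))) →
      v = sol x := by
    intro x v hv
    have h1 : (N : X →L[ℂ] X) v = ι x := by
      change v - V v = ι x
      ext t
      rw [BoundedContinuousFunction.sub_apply, hVapp, hι, hv t, add_sub_cancel_right]
    change v = (↑N⁻¹ : X →L[ℂ] X) (ι x)
    rw [← h1]
    change v = ((↑N⁻¹ : X →L[ℂ] X) * (N : X →L[ℂ] X)) v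
    rw [Units.inv_mul]; rfl
  have hshift : ∀ x (r t : ℝ≥0), sol x (r + t) = sol (sol x r) t := by
    intro x r t
    have key := huniq (sol x r) ((sol x).compContinuous ⟨fun t => r + t, by fun_prop⟩) ?_
    · exact congrArg (fun u => u t) key
    intro t
    simp only [BoundedContinuousFunction.compContinuous_apply, ContinuousMap.coe_mk]
    have i := fun a b => (hkert (sol x) (r + t)).intervalIntegrable (μ := volume) a b
    rw [hsol x (r + t), NNReal.coe_add,
      ← intervalIntegral.integral_add_adjacent_intervals (i 0 r) (i r (r + t)), ← add_assoc]
    congr 1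
    · rw [hsol x r, map_add, ← hUadd t r t.coe_nonneg r.coe_nonneg, add_comm (t : ℝ) r,
        ← ContinuousLinearMap.intervalIntegral_comp_comm (U t) ((hkert (sol x) r).intervalIntegrable 0 r)]
      congr 1
      refine intervalIntegral.integral_congr fun s hs => ?_
      rw [uIcc_of_le r.coe_nonneg] at hs
      rw [← hUadd t (r - s) t.coe_nonneg (sub_nonneg.2 hs.2)]
      congr 2; ring
    · have h1 := intervalIntegral.integral_comp_add_right (a := 0) (b := (t : ℝ))
        (fun s => U (r + t - s) (B (sol x s.toNNReal))) (r : ℝ)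
      rw [zero_add, add_comm (t : ℝ) r] at h1
      rw [← h1]
      refine intervalIntegral.integral_congr fun s hs => ?_
      rw [uIcc_of_le t.coe_nonneg] at hs
      rw [Real.toNNReal_add hs.1 r.coe_nonneg, Real.toNNReal_coe, add_comm s.toNNReal r]
      congr 2; ring
  have hsol0 : ∀ x, sol x 0 = x := fun x => by
    rw [hsol]; simp [hU0]
  let S : C0Semigroup E :=
    { op t := Real.exp (w' * t) • (BoundedContinuousFunction.evalCLM ℂ t ∘L sol)
      op_zero := by
        ext x
        have := hsol0 x
        simp [this]
      op_add s t := by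
        ext x
        have e : Real.exp (w' * (s + t : ℝ≥0)) = Real.exp (w' * t) * Real.exp (w' * s) := by
          rw [← Real.exp_add]; congr 1; push_cast; ring
        have h := hshift x t s
        rw [add_comm] at h
        change Real.exp (w' * (s + t : ℝ≥0)) • sol x (s + t) =
          Real.exp (w' * s) • sol (Real.exp (w' * t) • sol x t) s
        rw [h, e, ← Complex.coe_smul (Real.exp (w' * t)) (sol x t), map_smul, Complex.coe_smul,
          mul_comm, mul_smul]
        rfl
      continuous_orbit x := by
        change Continuous fun t : ℝ≥0 => Real.exp (w' * t) • sol x t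
        have := (sol x).continuous
        fun_prop }
  have hS : ∀ t, 0 ≤ t → ∀ x, S.flow t x = Real.exp (w' * t) • sol x t.toNNReal := by
    intro t ht x
    change Real.exp (w' * t.toNNReal) • sol x t.toNNReal = _
    rw [Real.coe_toNNReal t ht]
  refine ⟨S, ⟨‖sol‖, w', norm_nonneg _, fun t ht x => ?_⟩, fun t ht x => ?_⟩
  · rw [hS t ht, norm_smul, Real.norm_of_nonneg (Real.exp_pos _).le, mul_comm ‖sol‖, mul_assoc]
    refine mul_le_mul_of_nonneg_left ?_ (Real.exp_pos _).le
    exact ((sol x).norm_coe_le_norm _).trans (sol.le_opNorm x)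
  · rw [hS t ht, hsol, Real.coe_toNNReal t ht, smul_add, ← intervalIntegral.integral_smul, hU,
      smul_smul, ← Real.exp_add]
    congr 1
    · simp
    refine intervalIntegral.integral_congr fun s hs => ?_
    rw [uIcc_of_le ht] at hs
    rw [hS s hs.1, hU, smul_smul, ← Real.exp_add, ← Complex.coe_smul, ← Complex.coe_smul,
      map_smul, map_smul]
    congr 3; ring

section Duhamel

variable {S₀ S : C0Semigroup E} {B : E →L[ℂ] E} {M w M' w' : ℝ}

lemma continuous_duhamel_kernel
    (hM : ∀ t, 0 ≤ t → ∀ x, ‖S₀.flow t x‖ ≤ M * Real.exp (w * t) * ‖x‖) (x : E) :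
    Continuous fun z : ℝ × ℝ => S₀.flow (z.1 - z.2) (B (S.flow z.2 x)) := by
  have h1 : Continuous fun z : ℝ × ℝ => (z.1 - z.2, B (S.flow z.2 x)) := by
    have := S.continuous_flow x
    fun_prop
  exact (continuous_flow_uncurry hM).comp h1

/-- The generator of the perturbed semigroup is the perturbed generator. -/
lemma gen_iff_of_duhamel [CompleteSpace E]
    (hM : ∀ t, 0 ≤ t → ∀ x, ‖S₀.flow t x‖ ≤ M * Real.exp (w * t) * ‖x‖)
    (hS : ∀ t, 0 ≤ t → ∀ x, S.flow t x =
      S₀.flow t x + ∫ s in (0 : ℝ)..t, S₀.flow (t - s) (B (S.flow s x))) (x y : E) :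
    S.Gen x y ↔ S₀.Gen x (y - B x) := by
  have hk := continuous_duhamel_kernel (S := S) (B := B) hM x
  have hD : HasDerivWithinAt (fun t : ℝ => ∫ s in (0 : ℝ)..t, S₀.flow (t - s) (B (S.flow s x)))
      (B x) (Ici 0) 0 := by
    rw [hasDerivWithinAt_iff_isLittleO, Asymptotics.isLittleO_iff]
    intro c hc
    have h0 : Tendsto (fun z : ℝ × ℝ => S₀.flow (z.1 - z.2) (B (S.flow z.2 x))) (𝓝 (0, 0))
        (𝓝 (B x)) := by simpa using hk.tendsto (0, 0)
    obtain ⟨r, hr, hrb⟩ := Metric.eventually_nhds_iff.1 (Metric.tendsto_nhds.1 h0 c hc)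
    have hr' : ∀ᶠ t in 𝓝[≥] (0 : ℝ), t < r := mem_nhdsWithin_of_mem_nhds (Iio_mem_nhds hr)
    filter_upwards [self_mem_nhdsWithin, hr'] with t ht htr
    have ht' : (0 : ℝ) ≤ t := ht
    have e : (t - 0) • B x = ∫ s in (0 : ℝ)..t, B x := (intervalIntegral.integral_const _).symm
    have i1 : IntervalIntegrable (fun s => S₀.flow (t - s) (B (S.flow s x))) volume 0 t :=
      (hk.comp (by fun_prop : Continuous fun s : ℝ => (t, s))).intervalIntegrable _ _
    rw [e, intervalIntegral.integral_same, sub_zero, ← intervalIntegral.integral_sub i1 (by simp)]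
    have := intervalIntegral.norm_integral_le_of_norm_le_const (a := 0) (b := t) (C := c)
      (f := fun s => S₀.flow (t - s) (B (S.flow s x)) - B x) ?_
    · simpa using this
    intro s hs
    rw [uIoc_of_le ht'] at hs
    have hd : dist (t, s) ((0 : ℝ), (0 : ℝ)) < r := by
      rw [Prod.dist_eq, Real.dist_eq, Real.dist_eq, sub_zero, sub_zero, abs_of_nonneg ht',
        abs_of_nonneg hs.1.le]
      exact max_lt htr (hs.2.trans_lt htr)
    have := hrb hd
    rw [dist_eq_norm] at this
    exact this.le
  constructor
  · intro h
    have := HasDerivWithinAt.sub h hD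
    refine this.congr (fun t ht => ?_) ?_
    · simp [hS t ht]
    · simp
  · intro h
    have := HasDerivWithinAt.add h hD
    rw [sub_add_cancel] at this
    refine this.congr (fun t ht => ?_) ?_
    · simp [hS t ht]
    · simp

/-- If the perturbation is compact, the two semigroups differ by compact operators: by Duhamel's
formula the difference maps the unit ball into a multiple of the closed convex hull of a compact
set. -/
lemma isCompactOperator_sub_of_duhamel [CompleteSpace E]
    (hM : ∀ t, 0 ≤ t → ∀ x, ‖S₀.flow t x‖ ≤ M * Real.exp (w * t) * ‖x‖) (hM'0 : 0 ≤ M')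
    (hM' : ∀ t, 0 ≤ t → ∀ x, ‖S.flow t x‖ ≤ M' * Real.exp (w' * t) * ‖x‖)
    (hS : ∀ t, 0 ≤ t → ∀ x, S.flow t x =
      S₀.flow t x + ∫ s in (0 : ℝ)..t, S₀.flow (t - s) (B (S.flow s x)))
    (hB : IsCompactOperator B) {t : ℝ} (ht : 0 < t) :
    IsCompactOperator (S.flow t - S₀.flow t) := by
  set R : ℝ := M' * Real.exp (|w'| * t) with hR
  obtain ⟨K, hK, hKB⟩ := hB.image_closedBall_subset_compact R
  set K' : Set E := (fun z : ℝ × E => S₀.flow z.1 z.2) '' (Icc 0 t ×ˢ K) with hK'_def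
  have hK' : IsCompact K' := (isCompact_Icc.prod hK).image (continuous_flow_uncurry hM)
  have hKc : IsCompact (closure (convexHull ℝ K')) :=
    isCompact_iff_totallyBounded_isComplete.2
      ⟨(TotallyBounded.convexHull hK'.totallyBounded).closure, isClosed_closure.isComplete⟩
  rw [isCompactOperator_iff_exists_mem_nhds_image_subset_compact]
  refine ⟨Metric.closedBall 0 1, Metric.closedBall_mem_nhds 0 one_pos,
    (fun y : E => t • y) '' closure (convexHull ℝ K'), hKc.image (by fun_prop), ?_⟩
  rintro _ ⟨x, hx, rfl⟩
  have hx' : ‖x‖ ≤ 1 := by simpa using hx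
  have hk := continuous_duhamel_kernel (S := S) (B := B) hM x
  have hmem : ∀ s ∈ Ioc 0 t, S₀.flow (t - s) (B (S.flow s x)) ∈ closure (convexHull ℝ K') := by
    intro s hs
    refine subset_closure (subset_convexHull ℝ _ ⟨(t - s, B (S.flow s x)), ⟨?_, ?_⟩, rfl⟩)
    · exact ⟨sub_nonneg.2 hs.2, by linarith [hs.1]⟩
    · refine hKB ⟨_, ?_, rfl⟩
      rw [mem_closedBall_zero_iff]
      refine (hM' s hs.1.le x).trans ?_
      have h1 : Real.exp (w' * s) ≤ Real.exp (|w'| * t) := Real.exp_le_exp.2 (by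
        calc w' * s ≤ |w'| * s := mul_le_mul_of_nonneg_right (le_abs_self _) hs.1.le
          _ ≤ _ := mul_le_mul_of_nonneg_left hs.2 (abs_nonneg _))
      calc _ ≤ M' * Real.exp (w' * s) * 1 := by gcongr
        _ ≤ R := by rw [mul_one]; exact mul_le_mul_of_nonneg_left h1 hM'0
  have hi : IntegrableOn (fun s => S₀.flow (t - s) (B (S.flow s x))) (Ioc 0 t) :=
    ((hk.comp (by fun_prop : Continuous fun s : ℝ => (t, s))).intervalIntegrable 0 t).1
  have hav := Convex.set_average_mem (convex_convexHull ℝ K').closure isClosed_closure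
    (μ := volume) (t := Ioc 0 t) (by simp [ht]) (by simp)
    ((ae_restrict_iff' measurableSet_Ioc).2 (.of_forall hmem)) hi
  refine ⟨_, hav, ?_⟩
  change _ = S.flow t x - S₀.flow t x
  rw [hS t ht.le x, add_sub_cancel_left, intervalIntegral.integral_of_le ht.le, setAverage_eq]
  simp [ht.le, ht.ne', measureReal_def, smul_smul]

end Duhamel

end C0Semigroup

end Perturbation

/-! ### Compact perturbations and exponential decay -/

section Decay

/-- A continuous function on `[0,T]` with `g 0 = g T`, all of whose Fourier coefficients vanish,
vanishes at `0`. -/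
lemma eq_zero_of_fourier_integral_eq_zero {T : ℝ} (hT : 0 < T) {g : ℝ → ℂ} (hg : Continuous g)
    (hp : g 0 = g T)
    (h : ∀ n : ℤ, ∫ t in (0 : ℝ)..T, Complex.exp (-(2 * Real.pi * Complex.I * n / T * t)) * g t = 0) :
    g 0 = 0 := by
  have : Fact (0 < T) := ⟨hT⟩
  let G : C(AddCircle T, ℂ) := ⟨AddCircle.liftIco T 0 g,
    AddCircle.liftIco_zero_continuous hp hg.continuousOn⟩
  have hcoef : ∀ n, fourierCoeff G n = 0 := by
    intro n
    change fourierCoeff (AddCircle.liftIco T 0 g) n = 0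
    rw [fourierCoeff_liftIco_eq, fourierCoeffOn_eq_integral]
    have h2 := h n
    have : ∫ x in (0 : ℝ)..0 + T, fourier (-n) (x : AddCircle (0 + T - 0)) • g x = 0 := by
      rw [← h2, zero_add]
      refine intervalIntegral.integral_congr fun t _ => ?_
      simp only [smul_eq_mul]
      congr 1
      rw [fourier_coe_apply]
      congr 1
      push_cast
      ring
    rw [this, smul_zero]
  have hs := has_pointwise_sum_fourier_series_of_summable (f := G) (by
    rw [show fourierCoeff G = 0 from funext hcoef]; exact summable_zero) ((0 : ℝ) : AddCircle T)
  simp only [hcoef, zero_smul] at hs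
  have h0 : G ((0 : ℝ) : AddCircle T) = 0 := hs.unique hasSum_zero
  have h1 : G ((0 : ℝ) : AddCircle T) = g 0 :=
    AddCircle.liftIco_coe_apply (by simp [hT])
  rw [← h1, h0]

variable {E : Type*} [NormedAddCommGroup E] [InnerProductSpace ℂ E]

/-- Schauder's theorem on Hilbert spaces: `‖T† x - T† y‖² ≤ ‖T T† x - T T† y‖ ‖x - y‖`. -/
lemma isCompactOperator_adjoint [CompleteSpace E] {T : E →L[ℂ] E} (hT : IsCompactOperator T) :
    IsCompactOperator (ContinuousLinearMap.adjoint T) := by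
  set A := ContinuousLinearMap.adjoint T with hA
  have hTA : IsCompactOperator (T ∘L A) := hT.comp_clm A
  rw [isCompactOperator_iff_exists_mem_nhds_image_subset_compact]
  refine ⟨Metric.closedBall 0 1, Metric.closedBall_mem_nhds 0 one_pos,
    closure (A '' Metric.closedBall 0 1), ?_, subset_closure⟩
  refine isCompact_iff_totallyBounded_isComplete.2
    ⟨TotallyBounded.closure ?_, isClosed_closure.isComplete⟩
  obtain ⟨K, hK, hKsub⟩ := hTA.image_closedBall_subset_compact 1
  have htb : TotallyBounded ((T ∘L A) '' Metric.closedBall 0 1) :=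
    hK.totallyBounded.subset hKsub
  refine Metric.totallyBounded_iff.2 fun ε hε => ?_
  obtain ⟨t, hts, htf, htc⟩ := Metric.finite_approx_of_totallyBounded htb (ε ^ 2 / 2) (by positivity)
  obtain ⟨u, hus, huf, rfl⟩ := exists_subset_image_finite_and.1 ⟨t, hts, htf, rfl⟩
  refine ⟨A '' u, huf.image _, ?_⟩
  rintro _ ⟨x, hx, rfl⟩
  obtain ⟨_, ⟨y, hy, rfl⟩, hxy⟩ := mem_iUnion₂.1 (htc ⟨x, hx, rfl⟩)
  refine mem_iUnion₂.2 ⟨A y, ⟨y, hy, rfl⟩, ?_⟩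
  have hy' := hus hy
  rw [mem_closedBall_zero_iff] at hx hy'
  rw [Metric.mem_ball, dist_eq_norm] at hxy ⊢
  rw [← map_sub] at hxy ⊢
  have h1 : ‖A (x - y)‖ ^ 2 ≤ ‖(T ∘L A) (x - y)‖ * ‖x - y‖ := by
    have h2 : ((‖A (x - y)‖ : ℂ)) ^ 2 = inner ℂ ((T ∘L A) (x - y)) (x - y) := by
      rw [ContinuousLinearMap.comp_apply, ← ContinuousLinearMap.adjoint_inner_right,
        ← hA, inner_self_eq_norm_sq_to_K]
      rfl
    have h3 : ‖((‖A (x - y)‖ : ℂ)) ^ 2‖ ≤ ‖(T ∘L A) (x - y)‖ * ‖x - y‖ := by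
      rw [h2]; exact norm_inner_le_norm _ _
    simpa using h3
  have h4 : ‖x - y‖ ≤ 2 := (norm_sub_le _ _).trans (by linarith)
  have h5 : ‖A (x - y)‖ ^ 2 < ε ^ 2 := by
    calc _ ≤ _ := h1
      _ ≤ ‖(T ∘L A) (x - y)‖ * 2 := by gcongr
      _ < ε ^ 2 / 2 * 2 := by gcongr
      _ = ε ^ 2 := by ring
  exact lt_of_pow_lt_pow_left₀ 2 hε.le h5

/-- If `A + K` is a compact perturbation of `A`, then spectral points of modulus larger than `‖A‖`
have an eigenfunctional: this is the Fredholm alternative for the adjoint. -/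
lemma exists_eigenfunctional [CompleteSpace E] {A K : E →L[ℂ] E} (hK : IsCompactOperator K) {z : ℂ}
    (hz : ‖A‖ < ‖z‖) (hs : z ∈ spectrum ℂ (A + K)) :
    ∃ ψ : E →L[ℂ] ℂ, ψ ≠ 0 ∧ ∀ x, ψ ((A + K) x) = z * ψ x := by
  have hz0 : z ≠ 0 := norm_pos_iff.1 ((norm_nonneg _).trans_lt hz)
  set c : ℂ := star z with hc
  have hc0 : c ≠ 0 := star_ne_zero.2 hz0
  have hcn : ‖c‖ = ‖z‖ := norm_star z
  set T := A + K with hT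
  have hs' : c ∈ spectrum ℂ (star T) := by
    rw [spectrum.map_star]; simpa [hc] using hs
  have hA1 : ‖c⁻¹ • star A‖ < 1 := by
    rw [norm_smul, norm_star, norm_inv, hcn, inv_mul_lt_iff₀ (norm_pos_iff.2 hz0)]
    simpa using hz
  let N := Units.oneSub (c⁻¹ • star A) hA1
  set C : E →L[ℂ] E := (↑N⁻¹ : E →L[ℂ] E) * (c⁻¹ • star K) with hC
  have hCc : IsCompactOperator C := by
    have h1 : IsCompactOperator ((star K : E →L[ℂ] E)) := isCompactOperator_adjoint hK
    have h2 : IsCompactOperator ((c⁻¹ • star K : E →L[ℂ] E)) := h1.smul c⁻¹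
    exact h2.clm_comp (↑N⁻¹ : E →L[ℂ] E)
  have hfac : algebraMap ℂ (E →L[ℂ] E) c - star T = c • ((N : E →L[ℂ] E) * (1 - C)) := by
    have h1 : (N : E →L[ℂ] E) * C = c⁻¹ • star K := by
      rw [hC, ← mul_assoc, Units.mul_inv, one_mul]
    have h2 : (N : E →L[ℂ] E) = 1 - c⁻¹ • star A := rfl
    rw [mul_sub, h1, h2, mul_one, smul_sub, smul_sub, smul_smul, smul_smul, mul_inv_cancel₀ hc0,
      one_smul, one_smul, hT, star_add, Algebra.algebraMap_eq_smul_one]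
    abel
  have h1 : (1 : ℂ) ∈ spectrum ℂ C := by
    rw [spectrum.mem_iff] at hs' ⊢
    intro hu
    refine hs' ?_
    rw [hfac]
    rw [map_one] at hu
    have h3 : IsUnit ((N : E →L[ℂ] E) * (1 - C)) := N.isUnit.mul hu
    simpa using h3.smul (Units.mk0 c hc0)
  obtain ⟨v, hv⟩ := ((hCc.hasEigenvalue_iff_mem_spectrum one_ne_zero).2 h1).exists_hasEigenvector
  have hv1 : C v = v := by simpa using hv.apply_eq_smul
  have hv2 : star T v = c • v := by
    have h3 := congrArg (fun B : E →L[ℂ] E => B v) hfac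
    simp only [Algebra.algebraMap_eq_smul_one] at h3
    change c • v - star T v = c • (N : E →L[ℂ] E) (v - C v) at h3
    rw [hv1, sub_self, map_zero, smul_zero, sub_eq_zero] at h3
    exact h3.symm
  refine ⟨innerSL ℂ v, fun h => hv.2 ?_, fun x => ?_⟩
  · have := congrArg (fun f => f v) h
    simpa using this
  · rw [innerSL_apply_apply, innerSL_apply_apply, ← ContinuousLinearMap.adjoint_inner_left,
      ← ContinuousLinearMap.star_eq_adjoint, hv2, inner_smul_left, hc]
    simp

namespace C0Semigroup

variable {S₀ S : C0Semigroup E} {M a M' w' : ℝ}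

lemma norm_flow_le_of_mem_Icc (hM'0 : 0 ≤ M')
    (hM' : ∀ t, 0 ≤ t → ∀ x, ‖S.flow t x‖ ≤ M' * Real.exp (w' * t) * ‖x‖) {T t : ℝ}
    (ht : t ∈ Icc 0 T) (x : E) : ‖S.flow t x‖ ≤ M' * Real.exp (|w'| * T) * ‖x‖ := by
  refine (hM' t ht.1 x).trans ?_
  have h1 : Real.exp (w' * t) ≤ Real.exp (|w'| * T) := Real.exp_le_exp.2 (by
    calc w' * t ≤ |w'| * t := mul_le_mul_of_nonneg_right (le_abs_self _) ht.1
      _ ≤ _ := mul_le_mul_of_nonneg_left ht.2 (abs_nonneg _))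
  gcongr

/-- An eigenfunctional `ψ` of the single operator `S(T)` yields an eigenfunctional of the whole
semigroup: a nonzero Fourier coefficient of the `T`-periodic function `exp (-ν t) ψ(S(t) x)`. -/
lemma exists_joint_eigenfunctional (hM'0 : 0 ≤ M')
    (hM' : ∀ t, 0 ≤ t → ∀ x, ‖S.flow t x‖ ≤ M' * Real.exp (w' * t) * ‖x‖) {T : ℝ} (hT : 0 < T)
    {ψ : E →L[ℂ] ℂ} (hψ0 : ψ ≠ 0) {ν : ℂ} (hψ : ∀ x, ψ (S.flow T x) = Complex.exp (ν * T) * ψ x)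
    {P : E →L[ℂ] E} (hc : ∀ t, 0 ≤ t → ∀ x, P (S.flow t x) = S.flow t (P x))
    (hP : ∀ x, ψ (P x) = 0) :
    ∃ (Ψ : E →L[ℂ] ℂ) (z : ℂ), Ψ ≠ 0 ∧ z.re = ν.re ∧ (∀ x, Ψ (P x) = 0) ∧
      ∀ t, 0 ≤ t → ∀ x, Ψ (S.flow t x) = Complex.exp (z * t) * Ψ x := by
  obtain ⟨x, hx⟩ : ∃ x, ψ x ≠ 0 := by
    by_contra! h
    exact hψ0 (ContinuousLinearMap.ext h)
  have hcont : ∀ x, Continuous fun t : ℝ => ψ (S.flow t x) := fun x =>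
    ψ.continuous.comp (S.continuous_flow x)
  set g : ℝ → ℂ := fun t => Complex.exp (-(ν * t)) * ψ (S.flow t x) with hg
  have hgc : Continuous g := Continuous.mul (by fun_prop) (hcont x)
  have hg0 : g 0 = ψ x := by simp [hg]
  have hgT : g 0 = g T := by
    rw [hg0]
    simp only [hg]
    rw [hψ, ← mul_assoc, ← Complex.exp_add]
    simp
  obtain ⟨n, hn⟩ : ∃ n : ℤ, ∫ t in (0 : ℝ)..T,
      Complex.exp (-(2 * Real.pi * Complex.I * n / T * t)) * g t ≠ 0 := by
    by_contra! h
    exact hx (hg0 ▸ eq_zero_of_fourier_integral_eq_zero hT hgc hgT h)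
  have hT' : (T : ℂ) ≠ 0 := by exact_mod_cast hT.ne'
  set z : ℂ := ν + 2 * Real.pi * Complex.I * n / T with hz
  have hzT : Complex.exp (-(z * T)) * Complex.exp (ν * T) = 1 := by
    rw [← Complex.exp_add, Complex.exp_eq_one_iff]
    refine ⟨-n, ?_⟩
    rw [hz]
    push_cast
    field_simp
    ring
  have hci : ∀ x, Continuous fun t : ℝ => Complex.exp (-(z * t)) * ψ (S.flow t x) := fun x =>
    Continuous.mul (by fun_prop) (hcont x)
  let Ψl : E →ₗ[ℂ] ℂ :=
    { toFun x := ∫ t in (0 : ℝ)..T, Complex.exp (-(z * t)) * ψ (S.flow t x)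
      map_add' x y := by
        rw [← intervalIntegral.integral_add ((hci x).intervalIntegrable _ _)
          ((hci y).intervalIntegrable _ _)]
        simp [mul_add]
      map_smul' c x := by
        rw [RingHom.id_apply, ← intervalIntegral.integral_smul]
        simp [mul_left_comm] }
  let Ψ : E →L[ℂ] ℂ := Ψl.mkContinuous
      (Real.exp (|z.re| * T) * (‖ψ‖ * (M' * Real.exp (|w'| * T))) * T) fun x => by
    have h1 := intervalIntegral.norm_integral_le_of_norm_le_const (a := 0) (b := T)
      (C := Real.exp (|z.re| * T) * (‖ψ‖ * (M' * Real.exp (|w'| * T) * ‖x‖)))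
      (f := fun t => Complex.exp (-(z * t)) * ψ (S.flow t x)) fun t ht => by
        rw [uIoc_of_le hT.le] at ht
        rw [norm_mul, Complex.norm_exp]
        have e1 : (-(z * t)).re ≤ |z.re| * T := by
          simp only [Complex.neg_re, Complex.mul_re, Complex.ofReal_re, Complex.ofReal_im, mul_zero,
            sub_zero]
          calc -(z.re * t) ≤ |z.re * t| := neg_le_abs _
            _ = |z.re| * t := by rw [abs_mul, abs_of_pos ht.1]
            _ ≤ _ := mul_le_mul_of_nonneg_left ht.2 (abs_nonneg _)
        have e2 := (ψ.le_opNorm (S.flow t x)).trans (mul_le_mul_of_nonneg_left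
          (norm_flow_le_of_mem_Icc hM'0 hM' ⟨ht.1.le, ht.2⟩ x) (norm_nonneg _))
        gcongr
    rw [sub_zero, abs_of_pos hT] at h1
    calc ‖Ψl x‖ ≤ _ := h1
      _ = _ := by ring
  have hΨ : ∀ x, Ψ x = ∫ t in (0 : ℝ)..T, Complex.exp (-(z * t)) * ψ (S.flow t x) := fun x => rfl
  refine ⟨Ψ, z, fun h => hn ?_, ?_, fun x => ?_, fun s hs x => ?_⟩
  · have h1 : Ψ x = 0 := by rw [h]; rfl
    rw [← h1, hΨ]
    refine intervalIntegral.integral_congr fun t _ => ?_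
    simp only [hg]
    rw [← mul_assoc, ← Complex.exp_add, hz]
    congr 2
    ring
  · have : (2 * Real.pi * Complex.I * n / T : ℂ) = ((2 * Real.pi * n / T : ℝ) : ℂ) * Complex.I := by
      push_cast; ring
    rw [hz, this]
    simp
  · rw [hΨ]
    have : ∀ t ∈ uIcc 0 T, Complex.exp (-(z * t)) * ψ (S.flow t (P x)) = 0 := by
      intro t ht
      rw [uIcc_of_le hT.le] at ht
      rw [← hc t ht.1, hP, mul_zero]
    rw [intervalIntegral.integral_congr this]
    simp
  · -- the integrand is `T`-periodic, so its integral over `[s, s + T]` does not depend on `s`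
    set f : ℝ → ℂ := fun t => Complex.exp (-(z * t)) * ψ (S.flow t x) with hf
    have hfper : ∀ t, 0 ≤ t → f (t + T) = f t := by
      intro t ht
      simp only [hf]
      rw [add_comm t T, S.flow_add_apply hT.le ht, hψ]
      have : Complex.exp (-(z * ((T + t : ℝ) : ℂ))) = Complex.exp (-(z * T)) * Complex.exp (-(z * t)) := by
        rw [← Complex.exp_add]; congr 1; push_cast; ring
      rw [this]
      linear_combination Complex.exp (-(z * t)) * ψ (S.flow t x) * hzT
    have hfi : ∀ a b, IntervalIntegrable f volume a b := fun a b => (hci x).intervalIntegrable a b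
    have h1 : ∫ t in T..s + T, f t = ∫ t in (0 : ℝ)..s, f t := by
      have := intervalIntegral.integral_comp_add_right (a := 0) (b := s) f T
      rw [zero_add] at this
      rw [← this]
      refine intervalIntegral.integral_congr fun t ht => ?_
      rw [uIcc_of_le hs] at ht
      exact hfper t ht.1
    have h2 : ∫ t in s..s + T, f t = ∫ t in (0 : ℝ)..T, f t := by
      have e1 := intervalIntegral.integral_add_adjacent_intervals (hfi 0 s) (hfi s (s + T))
      have e2 := intervalIntegral.integral_add_adjacent_intervals (hfi 0 T) (hfi T (s + T))
      rw [h1] at e2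
      exact add_left_cancel (a := ∫ t in (0 : ℝ)..s, f t) (by rw [e1, ← e2, add_comm])
    rw [hΨ, hΨ, ← h2, ← intervalIntegral.integral_const_mul]
    have h3 := intervalIntegral.integral_comp_add_right (a := 0) (b := T)
      (fun t => Complex.exp (z * s) * f t) s
    rw [zero_add, add_comm T s] at h3
    rw [← h3]
    refine intervalIntegral.integral_congr fun t ht => ?_
    rw [uIcc_of_le hT.le] at ht
    simp only [hf]
    rw [S.flow_add_apply ht.1 hs, ← mul_assoc, ← Complex.exp_add]
    congr 2
    push_cast
    ring

/-- If `S` is a compact perturbation of a semigroup with decay rate `a`, and off the range of the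
compact projection `P` there is no eigenfunctional with eigenvalue `exp (z t)`, `Re z ≥ -b > -a`,
then `S` decays at the rate `b` off the range of `P`. -/
theorem exists_decay [CompleteSpace E] (hM0 : 0 ≤ M)
    (hM : ∀ t, 0 ≤ t → ∀ x, ‖S₀.flow t x‖ ≤ M * Real.exp (-a * t) * ‖x‖) (hM'0 : 0 ≤ M')
    (hM' : ∀ t, 0 ≤ t → ∀ x, ‖S.flow t x‖ ≤ M' * Real.exp (w' * t) * ‖x‖)
    (hK : ∀ t, 0 < t → IsCompactOperator (S.flow t - S₀.flow t)) {P : E →L[ℂ] E}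
    (hP : IsCompactOperator P) (hPP : ∀ x, P (P x) = P x)
    (hc : ∀ t, 0 ≤ t → ∀ x, P (S.flow t x) = S.flow t (P x)) {b : ℝ} (hba : b < a)
    (hψ : ∀ (ψ : E →L[ℂ] ℂ) (z : ℂ), -b ≤ z.re → (∀ x, ψ (P x) = 0) →
      (∀ t : ℝ, 0 ≤ t → ∀ x, ψ (S.flow t x) = Complex.exp (z * t) * ψ x) → ψ = 0) :
    ∃ C : ℝ, 0 < C ∧ ∀ t : ℝ, 0 ≤ t → ∀ f,
      ‖S.flow t ((1 - P) f)‖ ≤ C * Real.exp (-b * t) * ‖(1 - P) f‖ := by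
  have hab : 0 < a - b := sub_pos.2 hba
  -- a time at which the free part is smaller than `exp (-b T)`
  set T : ℝ := (M + 1) / (a - b) with hTdef
  have hT : 0 < T := by positivity
  have hMT : M * Real.exp (-a * T) < Real.exp (-b * T) := by
    have h1 : (a - b) * T = M + 1 := by rw [hTdef]; field_simp
    have h2 : M < Real.exp ((a - b) * T) := by
      rw [h1]; linarith [Real.add_one_le_exp (M + 1)]
    calc _ < Real.exp ((a - b) * T) * Real.exp (-a * T) := by gcongr
      _ = _ := by rw [← Real.exp_add]; congr 1; ring
  set A := S₀.flow T with hA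
  have hAn : ‖A‖ < Real.exp (-b * T) :=
    (A.opNorm_le_bound (by positivity) (hM T hT.le)).trans_lt hMT
  set K : E →L[ℂ] E := (S.flow T - S₀.flow T) - S.flow T * P with hKdef
  have hKc : IsCompactOperator K := (hK T hT).sub (hP.clm_comp (S.flow T))
  set U : E →L[ℂ] E := A + K with hU
  have hUapp : ∀ x, U x = S.flow T ((1 - P) x) := by
    intro x
    change S₀.flow T x + ((S.flow T x - S₀.flow T x) - S.flow T (P x)) = S.flow T (x - P x)
    rw [map_sub]; abel
  have hspec : ∀ z ∈ spectrum ℂ U, ‖z‖ < Real.exp (-b * T) := by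
    intro z hz
    by_contra! hzn
    obtain ⟨ψ, hψ0, hψU⟩ := exists_eigenfunctional hKc (hAn.trans_le hzn) hz
    have hz0 : z ≠ 0 := norm_pos_iff.1 ((Real.exp_pos _).trans_le hzn)
    have hψP : ∀ x, ψ (P x) = 0 := by
      intro x
      have h1 := hψU (P x)
      rw [← hU, hUapp] at h1
      have h2 : (1 - P) (P x) = 0 := by
        change P x - P (P x) = 0
        rw [hPP, sub_self]
      rw [h2, map_zero, map_zero] at h1
      exact (mul_eq_zero.1 h1.symm).resolve_left hz0
    have hTc : (T : ℂ) ≠ 0 := by exact_mod_cast hT.ne'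
    have hψS : ∀ x, ψ (S.flow T x) = Complex.exp (Complex.log z / T * T) * ψ x := by
      intro x
      rw [div_mul_cancel₀ _ hTc, Complex.exp_log hz0, ← hψU x, ← hU, hUapp]
      change _ = ψ (S.flow T (x - P x))
      rw [map_sub, ← hc T hT.le, map_sub, hψP, sub_zero]
    obtain ⟨Ψ, w, hΨ0, hw, hΨP, hΨS⟩ :=
      exists_joint_eigenfunctional hM'0 hM' hT hψ0 hψS hc hψP
    refine hΨ0 (hψ Ψ w ?_ hΨP hΨS)
    rw [hw, Complex.div_ofReal_re, Complex.log_re, le_div_iff₀ hT]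
    exact (Real.le_log_iff_exp_le (norm_pos_iff.2 hz0)).2 hzn
  -- by Gelfand's formula a power of `U` is small
  obtain ⟨N, hN0, hN⟩ : ∃ N : ℕ, 0 < N ∧ ‖U ^ N‖ ≤ Real.exp (-b * T) ^ N := by
    set q : ℝ≥0 := (Real.exp (-b * T)).toNNReal with hq
    have hqc : (q : ℝ) = Real.exp (-b * T) := Real.coe_toNNReal _ (Real.exp_pos _).le
    have hr : spectralRadius ℂ U < q := by
      rcases (spectrum ℂ U).eq_empty_or_nonempty with h | h
      · have : spectralRadius ℂ U = 0 := by simp [spectralRadius, h]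
        rw [this]
        have : 0 < q := by rw [← NNReal.coe_pos, hqc]; exact Real.exp_pos _
        exact_mod_cast this
      · refine spectrum.spectralRadius_lt_of_forall_lt_of_nonempty h fun z hz => ?_
        rw [← NNReal.coe_lt_coe, hqc]
        exact hspec z hz
    have hev := (spectrum.pow_nnnorm_pow_one_div_tendsto_nhds_spectralRadius U).eventually_lt_const hr
    obtain ⟨N, hNlt, hN0⟩ := (hev.and (eventually_gt_atTop 0)).exists
    refine ⟨N, hN0, ?_⟩
    have hN0' : (0 : ℝ) < N := by exact_mod_cast hN0
    have h1 : (‖U ^ N‖₊ : ℝ≥0∞) ≤ (q : ℝ≥0∞) ^ (N : ℝ) := by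
      have := ENNReal.rpow_le_rpow hNlt.le hN0'.le
      rwa [← ENNReal.rpow_mul, one_div, inv_mul_cancel₀ hN0'.ne', ENNReal.rpow_one] at this
    rw [ENNReal.rpow_natCast, ← ENNReal.coe_pow, ENNReal.coe_le_coe, ← NNReal.coe_le_coe] at h1
    simpa [hqc] using h1
  have hpow : ∀ (m : ℕ) f, S.flow (m * T) ((1 - P) f) = (U ^ m) ((1 - P) f) := by
    intro m f
    induction m with
    | zero => simp
    | succ m ih =>
      have hQ : ∀ t, 0 ≤ t → (1 - P) (S.flow t ((1 - P) f)) = S.flow t ((1 - P) f) := by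
        intro t ht
        change S.flow t (f - P f) - P (S.flow t (f - P f)) = S.flow t (f - P f)
        rw [hc t ht, map_sub P, hPP, sub_self, map_zero, sub_zero]
      rw [show ((m + 1 : ℕ) : ℝ) * T = T + m * T by push_cast; ring,
        S.flow_add_apply hT.le (by positivity), pow_succ']
      change _ = U ((U ^ m) ((1 - P) f))
      rw [← ih, hUapp, hQ _ (by positivity)]
  set L : ℝ := N * T with hL
  have hLpos : 0 < L := by positivity
  have hstep : ∀ (k : ℕ) f, ‖S.flow (k * L) ((1 - P) f)‖ ≤ Real.exp (-b * (k * L)) * ‖(1 - P) f‖ := by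
    intro k f
    have h1 : (k : ℝ) * L = ((N * k : ℕ) : ℝ) * T := by rw [hL]; push_cast; ring
    rw [h1, hpow, pow_mul]
    calc _ ≤ ‖(U ^ N) ^ k‖ * ‖(1 - P) f‖ := ContinuousLinearMap.le_opNorm _ _
      _ ≤ (Real.exp (-b * T) ^ N) ^ k * ‖(1 - P) f‖ := by
        gcongr
        refine le_trans ?_ (pow_le_pow_left₀ (norm_nonneg _) hN k)
        rcases Nat.eq_zero_or_pos k with rfl | hk
        · rw [pow_zero, pow_zero]
          exact ContinuousLinearMap.norm_id_le
        · exact norm_pow_le' _ hk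
      _ = _ := by
        rw [← pow_mul, ← Real.exp_nat_mul]
        congr 2
        push_cast; ring
  refine ⟨M' * Real.exp (|w'| * L) * Real.exp (|b| * L) + 1, by positivity, fun t ht f => ?_⟩
  obtain ⟨k, s, hs, rfl⟩ : ∃ (k : ℕ) (s : ℝ), s ∈ Icc 0 L ∧ t = s + k * L := by
    refine ⟨⌊t / L⌋₊, t - ⌊t / L⌋₊ * L, ⟨?_, ?_⟩, by ring⟩
    · have := Nat.floor_le (div_nonneg ht hLpos.le)
      rw [le_div_iff₀ hLpos] at this
      linarith
    · have := Nat.lt_floor_add_one (t / L)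
      rw [div_lt_iff₀ hLpos] at this
      linarith
  rw [S.flow_add_apply hs.1 (by positivity)]
  have h1 := norm_flow_le_of_mem_Icc hM'0 hM' hs (S.flow (k * L) ((1 - P) f))
  have h2 : Real.exp (-b * (k * L)) ≤ Real.exp (|b| * L) * Real.exp (-b * (s + k * L)) := by
    rw [← Real.exp_add, Real.exp_le_exp]
    have : b * s ≤ |b| * L := by
      calc b * s ≤ |b| * s := mul_le_mul_of_nonneg_right (le_abs_self _) hs.1
        _ ≤ _ := mul_le_mul_of_nonneg_left hs.2 (abs_nonneg _)
    linarith
  calc _ ≤ _ := h1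
    _ ≤ M' * Real.exp (|w'| * L) *
        (Real.exp (|b| * L) * Real.exp (-b * (s + k * L)) * ‖(1 - P) f‖) := by
      gcongr
      exact (hstep k f).trans (by gcongr)
    _ = M' * Real.exp (|w'| * L) * Real.exp (|b| * L) * Real.exp (-b * (s + k * L)) *
        ‖(1 - P) f‖ := by ring
    _ ≤ _ := by
      gcongr
      linarith

end C0Semigroup

end Decay

/-! ### The spectral projection -/

section SpectralProjection

variable {E : Type*} [NormedAddCommGroup E] [NormedSpace ℂ E]

/-- If `S` acts on the range of the projection `P` by `exp t` and decays off the range of `P`, then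
`P` is the spectral projection of the generator at `1`: near `1` the resolvent is
`(z - 1)⁻¹ P` plus a holomorphic function. -/
theorem C0Semigroup.isSpectralProjection_of_decay [CompleteSpace E] {S : C0Semigroup E}
    {A : E →ₗ.[ℂ] E} (hA : ∀ x y, (x, y) ∈ A.graph ↔ S.Gen x y) {P : E →L[ℂ] E}
    (hPP : ∀ x, P (P x) = P x) (hP0 : P ≠ 0)
    (hc : ∀ t, 0 ≤ t → ∀ x, P (S.flow t x) = S.flow t (P x)) (hP : ∀ x, S.Gen (P x) (P x))
    {C b : ℝ} (hb : 0 < b)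
    (hC : ∀ t : ℝ, 0 ≤ t → ∀ f, ‖S.flow t ((1 - P) f)‖ ≤ C * Real.exp (-b * t) * ‖(1 - P) f‖) :
    IsSpectralProjection A 1 P := by
  have hgenP : ∀ x y, S.Gen x y → S.Gen (P x) (P y) := by
    intro x y h
    refine ((P.restrictScalars ℝ).hasFDerivAt.comp_hasDerivWithinAt 0 h).congr
      (fun t ht => ?_) ?_
    · exact (hc t ht x).symm
    · exact (hc 0 le_rfl x).symm
  have hPgen : ∀ x y, S.Gen x y → P y = P x := fun x y h => (hgenP x y h).unique (hP x)
  have hQapp : ∀ x, (1 - P) x = x - P x := fun x => rfl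
  have hPQ : ∀ x, P ((1 - P) x) = 0 := fun x => by rw [hQapp, map_sub, hPP, sub_self]
  constructor
  · rintro ⟨R, hR⟩
    obtain ⟨x, hx⟩ : ∃ x, P x ≠ 0 := by
      by_contra! h
      exact hP0 (ContinuousLinearMap.ext h)
    have h1 : R 0 = P x := (hR 0 (P x)).2 ((hA _ _).2 (by simpa using hP x))
    exact hx (by rw [← h1, map_zero])
  have hC0 : ∀ t, 0 ≤ t → ∀ f, ‖S.flow t ((1 - P) f)‖ ≤ (|C| * ‖1 - P‖) * ‖f‖ := by
    intro t ht f
    have h1 : Real.exp (-b * t) ≤ 1 := Real.exp_le_one_iff.2 (by nlinarith)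
    calc _ ≤ _ := hC t ht f
      _ ≤ |C| * 1 * (‖1 - P‖ * ‖f‖) := by
        gcongr
        · exact le_abs_self C
        · exact ContinuousLinearMap.le_opNorm _ _
      _ = _ := by ring
  obtain ⟨R₀, hR₀⟩ := S.exists_laplace (1 - P) hC0
  set H : E →L[ℂ] E := (1 - P) ∘L R₀ with hH
  have hPH : ∀ x, P (H x) = 0 := fun x => hPQ _
  have hHgen : ∀ f, S.Gen (H f) (H f - (1 - P) f) := by
    intro f
    have h := (hR₀ f).sub (hgenP _ _ (hR₀ f))
    rw [map_sub, hPQ, sub_zero] at h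
    convert! h using 1
    change R₀ f - P (R₀ f) - (1 - P) f = _
    abel
  set r : ℝ := (‖H‖ + 1)⁻¹ / 2 with hr
  have hr0 : 0 < r := by positivity
  have hr1 : r < 1 := by
    have : (‖H‖ + 1)⁻¹ ≤ 1 := inv_le_one_of_one_le₀ (by linarith [norm_nonneg H])
    rw [hr]; linarith
  have hW : ∀ z : ℂ, ‖z - 1‖ ≤ r → IsUnit (1 + (z - 1) • H) := by
    intro z hz
    have h1 : ‖-((z - 1) • H)‖ < 1 := by
      rw [norm_neg, norm_smul]
      have h2 : r * (‖H‖ + 1) = 1 / 2 := by rw [hr]; field_simp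
      have h3 : ‖z - 1‖ * ‖H‖ ≤ r * (‖H‖ + 1) := by gcongr; linarith
      linarith
    have := (Units.oneSub _ h1).isUnit
    rwa [Units.val_oneSub, sub_neg_eq_add] at this
  set G : ℂ → E →L[ℂ] E := fun z => H * Ring.inverse (1 + (z - 1) • H) * (1 - P) with hG
  have hGd : DifferentiableOn ℂ (fun z => P + (z - 1) • G z) (Metric.closedBall 1 r) := by
    intro z hz
    rw [mem_closedBall_iff_norm] at hz
    have h2 : DifferentiableAt ℂ (fun z : ℂ => 1 + (z - 1) • H) z := by fun_prop
    have h3 := h2.inverse (hW z hz)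
    have h4 : DifferentiableAt ℂ G z := (h3.const_mul H).mul_const (1 - P)
    have h5 : DifferentiableAt ℂ (fun z : ℂ => P + (z - 1) • G z) z := by fun_prop
    exact h5.differentiableWithinAt
  refine ⟨r, fun z => (z - 1)⁻¹ • P + G z, hr0, fun z hz1 hzr f u => ?_, ?_⟩
  · have hz1' : z - 1 ≠ 0 := sub_ne_zero.2 hz1
    have hsol : S.Gen (((z - 1)⁻¹ • P + G z) f) (z • ((z - 1)⁻¹ • P + G z) f - f) := by
      set v := Ring.inverse (1 + (z - 1) • H) ((1 - P) f) with hv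
      have h1 : v + (z - 1) • H v = (1 - P) f := by
        have := congrArg (fun B : E →L[ℂ] E => B ((1 - P) f)) (Ring.mul_inverse_cancel _ (hW z hzr))
        exact this
      have h2 : P v = 0 := by
        have := congrArg P h1
        rwa [map_add, map_smul, hPH, hPQ, smul_zero, add_zero] at this
      have h3 : S.Gen (H v) (H v - v) := by
        have := hHgen v
        rwa [hQapp, h2, sub_zero] at this
      have h4 := ((hP f).smul (z - 1)⁻¹).add h3
      have e1 : ((z - 1)⁻¹ • P + G z) f = (z - 1)⁻¹ • P f + H v := rfl
      rw [e1]
      convert! h4 using 1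
      have e2 : v = f - P f - (z - 1) • H v := by rw [← hQapp, ← h1]; abel
      have e3 : z • (z - 1)⁻¹ • P f = (z - 1)⁻¹ • P f + P f := by
        rw [smul_smul, show z * (z - 1)⁻¹ = (z - 1)⁻¹ + 1 by field_simp; ring, add_smul, one_smul]
      rw [smul_add, e3]
      nth_rewrite 3 [e2]
      rw [sub_smul, one_smul]
      abel
    rw [hA]
    constructor
    · rintro rfl
      exact hsol
    · intro h
      set d := ((z - 1)⁻¹ • P + G z) f - u with hd
      have hdg : S.Gen d (z • d) := by
        have := hsol.sub h
        rwa [show z • (((z - 1)⁻¹ • P + G z) f) - f - (z • u - f) = z • d by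
          rw [hd, smul_sub]; abel] at this
      have hPd : P d = 0 := by
        have h1 := hPgen _ _ hdg
        rw [map_smul, ← sub_eq_zero] at h1
        have h2 : (z - 1) • P d = 0 := by rw [sub_smul, one_smul, h1]
        exact (smul_eq_zero.1 h2).resolve_left hz1'
      have hzre : 0 ≤ z.re := by
        have h1 : |(z - 1).re| ≤ r := (Complex.abs_re_le_norm _).trans hzr
        have h2 := (abs_le.1 h1).1
        simp only [Complex.sub_re, Complex.one_re] at h2
        linarith
      have hbound : ∀ t : ℝ, 0 ≤ t → ‖d‖ ≤ C * Real.exp (-b * t) * ‖d‖ := by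
        intro t ht
        have h1 := hC t ht d
        rw [hQapp, hPd, sub_zero, hdg.flow_eigenvector ht, norm_smul, Complex.norm_exp] at h1
        refine le_trans ?_ h1
        have h2 : 1 ≤ Real.exp (z * t).re := by
          rw [Real.one_le_exp_iff]
          simpa using mul_nonneg hzre ht
        nlinarith [norm_nonneg d]
      have hlim : Tendsto (fun t : ℝ => C * Real.exp (-b * t) * ‖d‖) atTop (𝓝 (C * 0 * ‖d‖)) := by
        refine (Tendsto.const_mul C ?_).mul_const _
        refine Real.tendsto_exp_atBot.comp ?_
        exact tendsto_id.const_mul_atTop_of_neg (neg_neg_of_pos hb)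
      rw [mul_zero, zero_mul] at hlim
      have hd0 : ‖d‖ ≤ 0 := ge_of_tendsto hlim ((eventually_ge_atTop 0).mono hbound)
      exact sub_eq_zero.1 (norm_le_zero_iff.1 hd0)
  · have h1 := hGd.circleIntegral_sub_inv_smul (Metric.mem_ball_self hr0)
    have h2 : ∮ z in C(1, r), ((z - 1)⁻¹ • P + G z) = ∮ z in C(1, r), (z - 1)⁻¹ • (P + (z - 1) • G z) := by
      refine circleIntegral.integral_congr hr0.le fun z hz => ?_
      have hz1 : z - 1 ≠ 0 := by
        rw [mem_sphere_iff_norm] at hz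
        intro h
        rw [h, norm_zero] at hz
        exact hr0.ne hz
      rw [smul_add, smul_smul, inv_mul_cancel₀ hz1, one_smul]
    rw [h2, h1, sub_self, zero_smul, add_zero, smul_smul, inv_mul_cancel₀, one_smul]
    exact Complex.two_pi_I_ne_zero

end SpectralProjection

/-! ### Structure of the Sobolev space -/

instance : IsProbabilityMeasure unitVol := ⟨by simp⟩

lemma ae_unitVol_of_forall {q : ℝ → Prop} (h : ∀ x ∈ Ioo (0 : ℝ) 1, q x) : ∀ᵐ x ∂unitVol, q x :=
  (ae_restrict_iff' measurableSet_Ioo).2 (.of_forall h)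

lemma integrable_L2 (v : L2) : Integrable v unitVol := (Lp.memLp v).integrable (by norm_num)

/-- An integrable function that integrates to zero against all test functions vanishes. -/
lemma ae_eq_zero_of_testFun {v : ℝ → ℂ} (hv : Integrable v unitVol)
    (h : ∀ φ : ℝ → ℝ, ContDiff ℝ ∞ φ → HasCompactSupport φ → tsupport φ ⊆ Ioo (0 : ℝ) 1 →
      ∫ x, φ x • v x ∂unitVol = 0) : v =ᵐ[unitVol] 0 := by
  refine (ae_restrict_iff' measurableSet_Ioo).2 ?_
  refine isOpen_Ioo.ae_eq_zero_of_integral_contDiff_smul_eq_zero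
    (IntegrableOn.locallyIntegrableOn hv) fun φ h1 h2 h3 => ?_
  rw [← h φ h1 h2 h3]
  refine (setIntegral_eq_integral_of_forall_compl_eq_zero fun x hx => ?_).symm
  rw [image_eq_zero_of_notMem_tsupport fun hx' => hx (h3 hx'), zero_smul]

lemma exists_Icc_of_compact_subset_Ioo {K : Set ℝ} (hK : IsCompact K) (h : K ⊆ Ioo 0 1) :
    ∃ α β : ℝ, 0 < α ∧ β < 1 ∧ K ⊆ Icc α β := by
  rcases K.eq_empty_or_nonempty with rfl | hne
  · exact ⟨1, 0, one_pos, zero_lt_one, empty_subset _⟩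
  · exact ⟨sInf K, sSup K, (h (hK.sInf_mem hne)).1, (h (hK.sSup_mem hne)).2,
      fun x hx => ⟨csInf_le hK.bddBelow hx, le_csSup hK.bddAbove hx⟩⟩

/-- A test function of mean zero is the derivative of a test function. -/
lemma exists_testFun_deriv_eq {h : ℝ → ℝ} (h1 : ContDiff ℝ ∞ h) (h2 : HasCompactSupport h)
    (h3 : tsupport h ⊆ Ioo (0 : ℝ) 1) (h0 : ∫ x in (0 : ℝ)..1, h x = 0) :
    ∃ φ : ℝ → ℝ, ContDiff ℝ ∞ φ ∧ HasCompactSupport φ ∧ tsupport φ ⊆ Ioo (0 : ℝ) 1 ∧ deriv φ = h := by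
  set φ : ℝ → ℝ := fun x => ∫ t in (0 : ℝ)..x, h t with hφ
  have hc : Continuous h := h1.continuous
  have hd : ∀ x, HasDerivAt φ (h x) x := fun x =>
    intervalIntegral.integral_hasDerivAt_right (hc.intervalIntegrable _ _)
      hc.aestronglyMeasurable.stronglyMeasurableAtFilter hc.continuousAt
  have hderiv : deriv φ = h := funext fun x => (hd x).deriv
  obtain ⟨α, β, hα, hβ, hK⟩ := exists_Icc_of_compact_subset_Ioo h2 h3
  have hz : ∀ t, t ∉ Icc α β → h t = 0 := fun t ht =>
    image_eq_zero_of_notMem_tsupport fun h' => ht (hK h')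
  have hzero : ∀ x, x ∉ Icc α β → φ x = 0 := by
    intro x hx
    rcases lt_or_ge x α with hlt | hge
    · have : ∀ t ∈ uIcc 0 x, h t = 0 := fun t ht => hz t fun ht' => by
        have := ht.2.trans (sup_le hα.le hlt.le)
        have h5 : max 0 x < α := max_lt hα hlt
        exact absurd ht'.1 (not_le.2 (ht.2.trans_lt h5))
      simp only [hφ]
      rw [intervalIntegral.integral_congr this]
      simp
    · have hgt : β < x := by
        by_contra! hle
        exact hx ⟨hge, hle⟩
      have : ∀ t ∈ uIcc 1 x, h t = 0 := fun t ht => hz t fun ht' =>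
        absurd ht'.2 (not_le.2 ((lt_min hβ hgt).trans_le ht.1))
      simp only [hφ]
      rw [← intervalIntegral.integral_add_adjacent_intervals (hc.intervalIntegrable 0 1)
        (hc.intervalIntegrable 1 x), h0, intervalIntegral.integral_congr this]
      simp
  have hsupp : tsupport φ ⊆ Icc α β :=
    closure_minimal (fun x hx => by
      by_contra h'
      exact hx (hzero x h')) isClosed_Icc
  refine ⟨φ, ?_, ?_, hsupp.trans fun x hx => ⟨hα.trans_le hx.1, hx.2.trans_lt hβ⟩, hderiv⟩
  · rw [contDiff_infty_iff_deriv]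
    exact ⟨fun x => (hd x).differentiableAt, by rwa [hderiv]⟩
  · exact isCompact_Icc.of_isClosed_subset (isClosed_tsupport _) hsupp

/-- The lemma of du Bois-Reymond: a function with vanishing weak derivative is constant. -/
lemma exists_const_of_integral_deriv_eq_zero {v : ℝ → ℂ} (hv : MemLp v 2 unitVol)
    (h : ∀ φ : ℝ → ℝ, ContDiff ℝ ∞ φ → HasCompactSupport φ → tsupport φ ⊆ Ioo (0 : ℝ) 1 →
      ∫ x, deriv φ x • v x ∂unitVol = 0) : ∃ d : ℂ, v =ᵐ[unitVol] fun _ => d := by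
  let f : ContDiffBump (1 / 2 : ℝ) := ⟨1 / 8, 1 / 4, by norm_num, by norm_num⟩
  set η : ℝ → ℝ := f.normed volume with hη
  have η1 : ContDiff ℝ ∞ η := f.contDiff_normed
  have η2 : HasCompactSupport η := f.hasCompactSupport_normed
  have η3 : tsupport η ⊆ Ioo (0 : ℝ) 1 := by
    rw [hη, f.tsupport_normed_eq, Real.closedBall_eq_Icc]
    intro x hx
    have h1 : (1 / 2 : ℝ) - 1 / 4 ≤ x := hx.1
    have h2 : x ≤ (1 / 2 : ℝ) + 1 / 4 := hx.2
    exact ⟨by linarith, by linarith⟩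
  have hη1 : ∫ x in (0 : ℝ)..1, η x = 1 := by
    rw [intervalIntegral.integral_eq_integral_of_support_subset, f.integral_normed]
    exact ((subset_tsupport η).trans η3).trans Ioo_subset_Ioc_self
  have hvi : Integrable v unitVol := hv.integrable (by norm_num)
  have hsm : ∀ φ : ℝ → ℝ, Continuous φ → HasCompactSupport φ →
      Integrable (fun x => φ x • v x) unitVol := fun φ h1 h2 =>
    memLp_one_iff_integrable.1 (MemLp.smul hv (memLp_testFun h1 h2) (r := 1))
  set d : ℂ := ∫ x, η x • v x ∂unitVol with hd
  refine ⟨d, ?_⟩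
  have key : (fun x => v x - d) =ᵐ[unitVol] 0 := by
    refine ae_eq_zero_of_testFun (hvi.sub (integrable_const _)) fun ψ ψ1 ψ2 ψ3 => ?_
    set m : ℝ := ∫ x in (0 : ℝ)..1, ψ x with hm
    have g1 : ContDiff ℝ ∞ (fun x => ψ x - m * η x) := ψ1.sub (contDiff_const.mul η1)
    have g2 : HasCompactSupport (fun x => ψ x - m * η x) := ψ2.sub η2.mul_left
    have g3 : tsupport (fun x => ψ x - m * η x) ⊆ Ioo (0 : ℝ) 1 := by
      refine (closure_mono ?_ : _ ⊆ closure (tsupport ψ ∪ tsupport η)).trans ?_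
      · intro x hx
        by_contra h'
        rw [mem_union, not_or] at h'
        refine hx ?_
        simp only
        rw [image_eq_zero_of_notMem_tsupport h'.1, image_eq_zero_of_notMem_tsupport h'.2]
        simp
      · rw [((isClosed_tsupport ψ).union (isClosed_tsupport η)).closure_eq]
        exact union_subset ψ3 η3
    have g0 : ∫ x in (0 : ℝ)..1, (ψ x - m * η x) = 0 := by
      have i1 : IntervalIntegrable (fun x => m * η x) volume 0 1 :=
        (continuous_const.mul η1.continuous).intervalIntegrable _ _
      rw [intervalIntegral.integral_sub (ψ1.continuous.intervalIntegrable _ _) i1,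
        intervalIntegral.integral_const_mul, hη1, ← hm, mul_one, sub_self]
    obtain ⟨φ, φ1, φ2, φ3, hφ⟩ := exists_testFun_deriv_eq g1 g2 g3 g0
    have e1 := h φ φ1 φ2 φ3
    rw [hφ] at e1
    have e2 : ∀ x, (ψ x - m * η x) • v x = ψ x • v x - m • (η x • v x) := fun x => by
      rw [sub_smul, mul_smul]
    simp_rw [e2] at e1
    have iη : Integrable (fun x => m • (η x • v x)) unitVol := (hsm η η1.continuous η2).smul m
    rw [integral_sub (hsm ψ ψ1.continuous ψ2) iη, integral_smul, ← hd] at e1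
    have iψ : Integrable ψ unitVol :=
      (ψ1.continuous.integrable_of_hasCompactSupport ψ2).restrict
    have e3 : ∫ x, ψ x ∂unitVol = m := by
      rw [hm, intervalIntegral.integral_of_le zero_le_one, integral_Ioc_eq_integral_Ioo]
    simp_rw [smul_sub]
    rw [integral_sub (hsm ψ ψ1.continuous ψ2) (iψ.smul_const d), integral_smul_const, e3]
    exact e1
  filter_upwards [key] with x hx
  exact sub_eq_zero.1 hx

/-- A function in `L²(0,1)` all of whose even moments vanish is zero. -/
lemma ae_eq_zero_of_even_moments {v : ℝ → ℂ} (hv : Integrable v unitVol)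
    (h : ∀ k : ℕ, ∫ x, ((x : ℝ) ^ (2 * k)) • v x ∂unitVol = 0) : v =ᵐ[unitVol] 0 := by
  refine ae_eq_zero_of_testFun hv fun φ h1 h2 h3 => ?_
  have hint : ∀ f : ℝ → ℝ, Continuous f → Integrable (fun x => f x • v x) unitVol := by
    intro f hf
    obtain ⟨C, hC⟩ := isCompact_Icc.exists_bound_of_continuousOn (hf.continuousOn (s := Icc 0 1))
    exact hv.bdd_smul C hf.aestronglyMeasurable
      (ae_unitVol_of_forall fun x hx => hC x (Ioo_subset_Icc_self hx))
  have hpoly : ∀ q : Polynomial ℝ, ∫ x, q.eval (x ^ 2) • v x ∂unitVol = 0 := by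
    intro q
    induction q using Polynomial.induction_on' with
    | add p q hp hq =>
      simp_rw [Polynomial.eval_add, add_smul]
      rw [integral_add (hint _ (by fun_prop)) (hint _ (by fun_prop)), hp, hq, add_zero]
    | monomial n c =>
      simp_rw [Polynomial.eval_monomial, mul_smul, ← pow_mul]
      rw [integral_smul, h, smul_zero]
  rw [← norm_le_zero_iff]
  refine le_of_forall_pos_le_add fun ε hε => ?_
  set I : ℝ := ∫ x, ‖v x‖ ∂unitVol with hI
  have hI0 : 0 ≤ I := integral_nonneg fun x => norm_nonneg _
  obtain ⟨q, hq⟩ := exists_polynomial_near_of_continuousOn 0 1 (fun y => φ (Real.sqrt y))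
    (h1.continuous.comp Real.continuous_sqrt).continuousOn (ε / (I + 1)) (by positivity)
  have e : ∫ x, φ x • v x ∂unitVol = ∫ x, (φ x - q.eval (x ^ 2)) • v x ∂unitVol := by
    simp_rw [sub_smul]
    rw [integral_sub (hint φ h1.continuous) (hint _ (by fun_prop)), hpoly, sub_zero]
  rw [e, zero_add]
  have hb : ‖∫ x, (φ x - q.eval (x ^ 2)) • v x ∂unitVol‖ ≤ ∫ x, ε / (I + 1) * ‖v x‖ ∂unitVol := by
    refine norm_integral_le_of_norm_le (hv.norm.const_mul _) (ae_unitVol_of_forall fun x hx => ?_)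
    rw [norm_smul]
    refine mul_le_mul_of_nonneg_right ?_ (norm_nonneg _)
    have h5 := hq (x ^ 2) ⟨by positivity, by nlinarith [hx.1, hx.2]⟩
    rw [Real.sqrt_sq hx.1.le] at h5
    rw [Real.norm_eq_abs, abs_sub_comm]
    exact h5.le
  refine hb.trans ?_
  rw [integral_const_mul, ← hI, div_mul_eq_mul_div, div_le_iff₀ (by positivity)]
  nlinarith

/-! ### Antiderivatives and the decomposition of the energy space -/

lemma norm_toL2_le (u : H1) : ‖toL2 u‖ ≤ ‖u‖ := by
  refine abs_le_of_sq_le_sq' ?_ (norm_nonneg u) |>.2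
  rw [h1_norm_sq]
  exact le_add_of_nonneg_right (sq_nonneg _)

lemma norm_weakD_le (u : H1) : ‖weakD u‖ ≤ ‖u‖ := by
  refine abs_le_of_sq_le_sq' ?_ (norm_nonneg u) |>.2
  rw [h1_norm_sq]
  exact le_add_of_nonneg_left (sq_nonneg _)

/-- The inclusion `H¹(0,1) → L²(0,1)`. -/
def toL2L : H1 →L[ℂ] L2 :=
  LinearMap.mkContinuous { toFun := toL2, map_add' := fun _ _ => rfl, map_smul' := fun _ _ => rfl } 1
    fun u => by rw [one_mul]; exact norm_toL2_le u

/-- The weak derivative as a bounded operator `H¹(0,1) → L²(0,1)`. -/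
def weakDL : H1 →L[ℂ] L2 :=
  LinearMap.mkContinuous { toFun := weakD, map_add' := fun _ _ => rfl, map_smul' := fun _ _ => rfl } 1
    fun u => by rw [one_mul]; exact norm_weakD_le u

@[simp] lemma weakDL_apply (u : H1) : weakDL u = weakD u := rfl

lemma h1_norm_le (u : H1) : ‖u‖ ≤ ‖toL2 u‖ + ‖weakD u‖ := by
  refine abs_le_of_sq_le_sq' ?_ (by positivity) |>.2
  rw [h1_norm_sq]
  nlinarith [mul_nonneg (norm_nonneg (toL2 u)) (norm_nonneg (weakD u))]

lemma integral_norm_le_norm_L2 (v : L2) : ∫ x, ‖v x‖ ∂unitVol ≤ ‖v‖ := by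
  have h1 : eLpNorm v 1 unitVol ≤ eLpNorm v 2 unitVol :=
    eLpNorm_le_eLpNorm_of_exponent_le (by norm_num) (Lp.memLp v).1
  rw [integral_norm_eq_lintegral_enorm (Lp.memLp v).1, ← eLpNorm_one_eq_lintegral_enorm, Lp.norm_def]
  exact ENNReal.toReal_mono (Lp.memLp v).eLpNorm_lt_top.ne h1

lemma norm_L2_le_of_bound {v : L2} {C : ℝ} (hC : 0 ≤ C) (h : ∀ᵐ x ∂unitVol, ‖v x‖ ≤ C) : ‖v‖ ≤ C := by
  have h1 : measureUnivNNReal unitVol = 1 := by simp [measureUnivNNReal]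
  have h2 := Lp.norm_le_of_ae_bound hC h
  rwa [h1, NNReal.coe_one, Real.one_rpow, one_mul] at h2

lemma intervalIntegrable_L2 (v : L2) {x y : ℝ} (hx : x ∈ Icc (0 : ℝ) 1) (hy : y ∈ Icc (0 : ℝ) 1) :
    IntervalIntegrable v volume x y :=
  (intervalIntegrable_of_memLp (Lp.memLp v)).mono_set (by
    rw [uIcc_of_le zero_le_one]
    exact uIcc_subset_Icc hx hy)

lemma norm_integral_L2_le (v : L2) {x : ℝ} (hx : x ∈ Icc (0 : ℝ) 1) :
    ‖∫ t in (0 : ℝ)..x, v t‖ ≤ ‖v‖ := by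
  refine le_trans ?_ (integral_norm_le_norm_L2 v)
  refine (intervalIntegral.norm_integral_le_integral_norm hx.1).trans ?_
  have h1 : ∫ t, ‖v t‖ ∂unitVol = ∫ t in Ioc (0 : ℝ) 1, ‖v t‖ := integral_Ioc_eq_integral_Ioo.symm
  rw [h1, intervalIntegral.integral_of_le hx.1]
  refine setIntegral_mono_set ?_ (.of_forall fun t => norm_nonneg _) (Ioc_subset_Ioc_right hx.2).eventuallyLE
  have h2 := (intervalIntegrable_of_memLp (Lp.memLp v)).norm
  rwa [intervalIntegrable_iff_integrableOn_Ioc_of_le zero_le_one] at h2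

/-- The antiderivative `∫₀ˣ v` as an element of `H¹(0,1)`. -/
def antiH1 (v : L2) : H1 :=
  ofPrimitive (fun x => ∫ t in (0 : ℝ)..x, v t) v (Lp.memLp v) (fun x _ => by simp)

lemma fn_antiH1 (v : L2) : fn (antiH1 v) =ᵐ[unitVol] fun x => ∫ t in (0 : ℝ)..x, v t :=
  fn_ofPrimitive _ _ (Lp.memLp v) (fun x _ => by simp)

lemma weakD_antiH1 (v : L2) : weakD (antiH1 v) = v := Lp.toLp_coeFn v (Lp.memLp v)

/-- The antiderivative as a bounded operator `L²(0,1) → H¹(0,1)`. -/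
def anti : L2 →L[ℂ] H1 :=
  LinearMap.mkContinuous
    { toFun := antiH1
      map_add' := fun u v => by
        refine ext_fn ((fn_antiH1 _).trans (EventuallyEq.trans ?_
          ((fn_add _ _).trans ((fn_antiH1 u).add (fn_antiH1 v))).symm))
        refine ae_unitVol_of_forall fun x hx => ?_
        refine (intervalIntegral_congr_fn (Lp.coeFn_add u v) hx).trans ?_
        exact intervalIntegral.integral_add
          (intervalIntegrable_L2 u (by simp) (Ioo_subset_Icc_self hx))
          (intervalIntegrable_L2 v (by simp) (Ioo_subset_Icc_self hx))
      map_smul' := fun c u => by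
        refine ext_fn ((fn_antiH1 _).trans (EventuallyEq.trans ?_
          ((fn_smul _ _).trans ((fn_antiH1 u).const_smul c)).symm))
        refine ae_unitVol_of_forall fun x hx => ?_
        refine (intervalIntegral_congr_fn (Lp.coeFn_smul c u) hx).trans ?_
        exact intervalIntegral.integral_smul c _ } 2 fun v => by
      refine (h1_norm_le _).trans ?_
      change ‖toL2 (antiH1 v)‖ + ‖weakD (antiH1 v)‖ ≤ 2 * ‖v‖
      have h1 : ‖toL2 (antiH1 v)‖ ≤ ‖v‖ := by
        refine norm_L2_le_of_bound (norm_nonneg v) ?_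
        filter_upwards [fn_antiH1 v,
          ae_unitVol_of_forall (q := fun x => x ∈ Ioo (0 : ℝ) 1) (fun x hx => hx)] with x hx hx'
        change ‖fn (antiH1 v) x‖ ≤ _
        rw [hx]
        exact norm_integral_L2_le v (Ioo_subset_Icc_self hx')
      rw [weakD_antiH1]
      linarith

lemma fn_anti (v : L2) : fn (anti v) =ᵐ[unitVol] fun x => ∫ t in (0 : ℝ)..x, v t := fn_antiH1 v

@[simp] lemma weakD_anti (v : L2) : weakD (anti v) = v := weakD_antiH1 v

/-- The Volterra operator `v ↦ ∫₀ˣ v` on `L²(0,1)`. -/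
def volt : L2 →L[ℂ] L2 := toL2L ∘L anti

lemma coeFn_volt (v : L2) : volt v =ᵐ[unitVol] fun x => ∫ t in (0 : ℝ)..x, v t := fn_anti v

/-- The constant function `1`. -/
def oneH1 : H1 := ofPrimitive (fun _ => 1) (fun _ => 0) (memLp_const _) (fun x _ => by simp)

lemma fn_oneH1 : fn oneH1 =ᵐ[unitVol] fun _ => 1 :=
  fn_ofPrimitive _ (fun _ => 0) (memLp_const _) (fun x _ => by simp)

lemma oneH1_ne_zero : oneH1 ≠ 0 := by
  intro h
  have h1 : (fun _ : ℝ => (1 : ℂ)) =ᵐ[unitVol] 0 := by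
    refine fn_oneH1.symm.trans ?_
    rw [h]; exact fn_zero
  have h2 := eqOn_of_ae_eq continuousOn_const continuousOn_const h1 (x := 0) (by simp)
  exact one_ne_zero (α := ℂ) h2

/-- Every element of `H¹(0,1)` is the antiderivative of its weak derivative, up to a constant. -/
lemma exists_eq_anti_add (u : H1) : ∃ d : ℂ, u = anti (weakD u) + d • oneH1 := by
  set r : H1 := u - anti (weakD u) with hr
  have hD : weakD r = 0 := by
    change weakDL (u - anti (weakD u)) = 0
    rw [map_sub, weakDL_apply, weakDL_apply, weakD_anti, sub_self]
  obtain ⟨d, hd⟩ := exists_const_of_integral_deriv_eq_zero (Lp.memLp (toL2 r)) fun φ h1 h2 h3 => by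
    have h4 := hasWeakDeriv_weakD r φ h1 h2 h3
    rw [hD] at h4
    rw [h4, neg_eq_zero]
    refine integral_eq_zero_of_ae ?_
    filter_upwards [Lp.coeFn_zero ℂ 2 unitVol] with x hx
    rw [hx]; simp
  refine ⟨d, ?_⟩
  have h5 : r = d • oneH1 := by
    refine ext_fn (hd.trans ?_)
    filter_upwards [fn_smul d oneH1, fn_oneH1] with x h1 h2
    rw [h1, Pi.smul_apply, h2]; simp
  rw [← h5, hr]; abel

lemma anti_mem_H10 (v : L2) : anti v ∈ H10 :=
  ⟨_, continuousOn_primitive (Lp.memLp v) (fun x _ => by simp), fn_antiH1 v, by simp⟩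

/-- The antiderivative with values in the functions vanishing at `0`. -/
def anti0 : L2 →L[ℂ] H10 := anti.codRestrict H10 anti_mem_H10

lemma eq_anti0 (u : H10) : u = anti0 (weakD (u : H1)) := by
  obtain ⟨d, hd⟩ := exists_eq_anti_add (u : H1)
  obtain ⟨f, hf, huf, hf0⟩ := u.2
  have h1 : f =ᵐ[unitVol] fun x => (∫ t in (0 : ℝ)..x, weakD (u : H1) t) + d := by
    refine huf.symm.trans ?_
    rw [hd]
    filter_upwards [fn_add (anti (weakD (u : H1))) (d • oneH1), fn_anti (weakD (u : H1)),
      fn_smul d oneH1, fn_oneH1] with x h1 h2 h3 h4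
    rw [← hd] at h1 ⊢
    rw [h1, Pi.add_apply, h2, h3, Pi.smul_apply, h4]
    simp
  have hc := continuousOn_primitive (f := fun x => ∫ t in (0 : ℝ)..x, weakD (u : H1) t)
    (Lp.memLp (weakD (u : H1))) (fun x _ => by simp)
  have h2 := eqOn_of_ae_eq hf (hc.add continuousOn_const) h1 (x := 0) (by simp)
  have hd0 : d = 0 := by simpa [hf0] using h2.symm
  refine Subtype.ext ?_
  rw [hd0, zero_smul, add_zero] at hd
  exact hd

namespace EnergySpace

lemma norm_fst_le (u : EnergySpace) : ‖u.fst‖ ≤ ‖u‖ := by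
  refine abs_le_of_sq_le_sq' ?_ (norm_nonneg u) |>.2
  rw [norm_sq]
  exact le_add_of_nonneg_right (sq_nonneg _)

lemma norm_snd_le (u : EnergySpace) : ‖u.snd‖ ≤ ‖u‖ := by
  refine abs_le_of_sq_le_sq' ?_ (norm_nonneg u) |>.2
  rw [norm_sq]
  exact le_add_of_nonneg_left (sq_nonneg _)

/-- The first component as a bounded operator. -/
def fstL : EnergySpace →L[ℂ] H10 :=
  LinearMap.mkContinuous { toFun := fst, map_add' := fun _ _ => rfl, map_smul' := fun _ _ => rfl } 1
    fun u => by rw [one_mul]; exact norm_fst_le u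

/-- The second component as a bounded operator. -/
def sndL : EnergySpace →L[ℂ] H1 :=
  LinearMap.mkContinuous { toFun := snd, map_add' := fun _ _ => rfl, map_smul' := fun _ _ => rfl } 1
    fun u => by rw [one_mul]; exact norm_snd_le u

lemma norm_mk_zero_right (v : H10) : ‖mk v 0‖ = ‖v‖ := by
  have := norm_sq (mk v 0)
  rw [fst_mk, snd_mk, norm_zero] at this
  refine (pow_left_inj₀ (norm_nonneg _) (norm_nonneg _) two_ne_zero).1 ?_
  rw [this]; ring

lemma norm_mk_zero_left (v : H1) : ‖mk 0 v‖ = ‖v‖ := by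
  have := norm_sq (mk 0 v)
  rw [fst_mk, snd_mk, norm_zero] at this
  refine (pow_left_inj₀ (norm_nonneg _) (norm_nonneg _) two_ne_zero).1 ?_
  rw [this]; ring

/-- The embedding of the first factor. -/
def inlL : H10 →L[ℂ] EnergySpace :=
  LinearMap.mkContinuous
    { toFun := fun v => mk v 0
      map_add' := fun _ _ => by ext1 <;> simp
      map_smul' := fun _ _ => by ext1 <;> simp } 1
    fun u => by rw [one_mul]; exact (norm_mk_zero_right u).le

/-- The embedding of the second factor. -/
def inrL : H1 →L[ℂ] EnergySpace :=
  LinearMap.mkContinuous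
    { toFun := fun v => mk 0 v
      map_add' := fun _ _ => by ext1 <;> simp
      map_smul' := fun _ _ => by ext1 <;> simp } 1
    fun u => by rw [one_mul]; exact (norm_mk_zero_left u).le

end EnergySpace

open EnergySpace

/-- The pair `(∫₀ˣ v, 0)`, an odd function on `(-1,1)` with derivative `v` on `(0,1)`. -/
def embOdd : L2 →L[ℂ] EnergySpace := inlL ∘L anti0

/-- The pair `(0, ∫₀ˣ v)`, an even function on `(-1,1)` with derivative `v` on `(0,1)`. -/
def embEven : L2 →L[ℂ] EnergySpace := inrL ∘L anti

/-- The pair `(0, 1)`, that is, the constant function `1` on `(-1,1)`. -/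
def oneE : EnergySpace := inrL oneH1

lemma represents_embOdd (v : L2) : Represents (embOdd v) (fun x => ∫ t in (0 : ℝ)..x, v t) 0 :=
  ⟨fn_antiH1 v, fn_zero⟩

lemma represents_embEven (v : L2) : Represents (embEven v) 0 (fun x => ∫ t in (0 : ℝ)..x, v t) :=
  ⟨fn_zero, fn_antiH1 v⟩

lemma represents_oneE : Represents oneE 0 (fun _ => 1) := ⟨fn_zero, fn_oneH1⟩

/-- The energy space is parametrized by the two derivatives and the value at `0` of the second
component. -/
lemma exists_eq_emb (u : EnergySpace) :
    ∃ d : ℂ, u = embOdd (weakD (u.fst : H1)) + embEven (weakD u.snd) + d • oneE := by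
  obtain ⟨d, hd⟩ := exists_eq_anti_add u.snd
  refine ⟨d, ?_⟩
  ext1
  · change u.fst = anti0 (weakD (u.fst : H1)) + 0 + d • 0
    rw [smul_zero, add_zero, add_zero]
    exact eq_anti0 u.fst
  · change u.snd = 0 + anti (weakD u.snd) + d • oneH1
    rw [zero_add]
    exact hd

/-- The parametrization `(v, w, d) ↦ (∫₀ˣ v, ∫₀ˣ w + d)` of the energy space is bounded from below. -/
instance : CompleteSpace EnergySpace := by
  obtain ⟨Φ, hΦ⟩ : ∃ Φ : L2 × L2 × ℂ →L[ℂ] EnergySpace,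
      ∀ v w d, Φ (v, w, d) = embOdd v + embEven w + d • oneE :=
    ⟨embOdd ∘L ContinuousLinearMap.fst ℂ _ _ +
      (embEven ∘L ContinuousLinearMap.fst ℂ _ _ + (ContinuousLinearMap.toSpanSingleton ℂ oneE) ∘L
        ContinuousLinearMap.snd ℂ _ _) ∘L ContinuousLinearMap.snd ℂ _ _,
      fun v w d => by rw [add_assoc]; rfl⟩
  have h1 : ∀ v w d, weakD ((Φ (v, w, d)).fst : H1) = v := by
    intro v w d
    rw [hΦ]
    change weakD (anti v + 0 + d • 0) = v
    rw [smul_zero, add_zero, add_zero, weakD_anti]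
  have h2 : ∀ v w d, (Φ (v, w, d)).snd = anti w + d • oneH1 := by
    intro v w d
    rw [hΦ]
    change 0 + anti w + d • oneH1 = _
    rw [zero_add]
  have h3 : ∀ v w d, weakD (Φ (v, w, d)).snd = w := by
    intro v w d
    rw [h2]
    have h4 : weakD oneH1 = 0 := Lp.ext ((MemLp.coeFn_toLp (memLp_const (0 : ℂ))).trans
      (Lp.coeFn_zero ℂ 2 unitVol).symm)
    change weakD (anti w) + d • weakD oneH1 = w
    rw [h4, smul_zero, add_zero, weakD_anti]
  have hsurj : Function.Surjective Φ := fun u => by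
    obtain ⟨d, hd⟩ := exists_eq_emb u
    exact ⟨(_, _, d), (hΦ _ _ _).trans hd.symm⟩
  obtain ⟨c, hc0, hc⟩ : ∃ c : ℝ, 0 < c ∧ ∀ d : ℂ, c * ‖d‖ = ‖d • oneH1‖ :=
    ⟨‖oneH1‖, norm_pos_iff.2 oneH1_ne_zero, fun d => by rw [norm_smul, mul_comm]⟩
  obtain ⟨K, hK0, hK⟩ : ∃ K : ℝ, 0 ≤ K ∧ ∀ w, ‖anti w‖ ≤ K * ‖w‖ :=
    ⟨‖anti‖, norm_nonneg _, anti.le_opNorm⟩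
  obtain ⟨C, hC0, hC⟩ : ∃ C : ℝ, 0 ≤ C ∧ ∀ x, ‖x‖ ≤ C * ‖Φ x‖ := by
    refine ⟨1 + (1 + K) * c⁻¹, by positivity, ?_⟩
    rintro ⟨v, w, d⟩
    have b1 : ‖v‖ ≤ ‖Φ (v, w, d)‖ := by
      have := (norm_weakD_le ((Φ (v, w, d)).fst : H1)).trans (EnergySpace.norm_fst_le _)
      rwa [h1] at this
    have b2 : ‖w‖ ≤ ‖Φ (v, w, d)‖ := by
      have := (norm_weakD_le (Φ (v, w, d)).snd).trans (EnergySpace.norm_snd_le _)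
      rwa [h3] at this
    have e : c * ‖d‖ ≤ ‖(Φ (v, w, d)).snd‖ + ‖anti w‖ := by
      rw [hc, show d • oneH1 = (Φ (v, w, d)).snd - anti w by rw [h2]; abel]
      exact norm_sub_le _ _
    have e1 := EnergySpace.norm_snd_le (Φ (v, w, d))
    have e2 := hK w
    generalize ‖Φ (v, w, d)‖ = N at *
    have e3 : K * ‖w‖ ≤ K * N := mul_le_mul_of_nonneg_left b2 hK0
    have hN : 0 ≤ N := (norm_nonneg _).trans b1
    have b3 : ‖d‖ ≤ (1 + K) * c⁻¹ * N := by
      rw [mul_right_comm, ← div_eq_mul_inv, le_div_iff₀ hc0]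
      linarith
    have hn : 0 ≤ (1 + K) * c⁻¹ * N := by positivity
    rw [add_mul, one_mul]
    exact max_le (by linarith) (max_le (by linarith) (by linarith))
  have hal : AntilipschitzWith C.toNNReal Φ :=
    AddMonoidHomClass.antilipschitz_of_bound Φ (by rwa [Real.coe_toNNReal _ hC0])
  exact (completeSpace_congr (e := Equiv.ofBijective Φ ⟨hal.injective, hsurj⟩)
    (hal.isUniformEmbedding Φ.uniformContinuous)).1 inferInstance

/-! ### Compactness of the Volterra operator -/

/-- The indicator function of `(a, b]` as an element of `L²(0,1)`. -/
def indL2 (a b : ℝ) : L2 :=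
  indicatorConstLp 2 (measurableSet_Ioc (a := a) (b := b)) (measure_ne_top unitVol _) (1 : ℂ)

lemma inner_indL2 (a b : ℝ) (v : L2) : inner ℂ (indL2 a b) v = ∫ x in Ioc a b, v x ∂unitVol :=
  L2.inner_indicatorConstLp_one _ _ v

lemma norm_indL2_le {a b : ℝ} (h : a ≤ b) : ‖indL2 a b‖ ≤ Real.sqrt (b - a) := by
  rw [indL2, norm_indicatorConstLp (by norm_num) (by norm_num), norm_one, one_mul,
    ENNReal.toReal_ofNat, ← Real.sqrt_eq_rpow]
  refine Real.sqrt_le_sqrt ?_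
  rw [measureReal_def, Measure.restrict_apply measurableSet_Ioc]
  refine (ENNReal.toReal_mono (by simp) (measure_mono inter_subset_left)).trans ?_
  rw [Real.volume_Ioc, ENNReal.toReal_ofReal (sub_nonneg.2 h)]

lemma inner_indL2_sub (v : L2) {x y : ℝ} (hy : 0 ≤ y) (hyx : y ≤ x) :
    inner ℂ (indL2 0 x) v - inner ℂ (indL2 0 y) v = inner ℂ (indL2 y x) v := by
  rw [inner_indL2, inner_indL2, inner_indL2, sub_eq_iff_eq_add', ← Ioc_union_Ioc_eq_Ioc hy hyx]
  exact setIntegral_union (Ioc_disjoint_Ioc_of_le le_rfl) measurableSet_Ioc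
    (integrable_L2 v).integrableOn (integrable_L2 v).integrableOn

lemma integral_eq_inner_indL2 (v : L2) {x : ℝ} (hx : x ∈ Ioo (0 : ℝ) 1) :
    ∫ t in (0 : ℝ)..x, v t = inner ℂ (indL2 0 x) v := by
  rw [inner_indL2, intervalIntegral.integral_of_le hx.1.le, Measure.restrict_restrict measurableSet_Ioc]
  congr 2
  ext t
  exact ⟨fun h => ⟨h, h.1, h.2.trans_lt hx.2⟩, fun h => h.1⟩

lemma coeFn_sum_L2 {ι : Type*} (s : Finset ι) (f : ι → L2) :
    ((∑ i ∈ s, f i : L2) : ℝ → ℂ) =ᵐ[unitVol] fun x => ∑ i ∈ s, f i x := by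
  classical
  induction s using Finset.induction_on with
  | empty =>
    filter_upwards [Lp.coeFn_zero ℂ 2 unitVol] with x hx
    simp
  | insert i s hi ih =>
    rw [Finset.sum_insert hi]
    filter_upwards [Lp.coeFn_add (f i) (∑ i ∈ s, f i), ih] with x h1 h2
    rw [h1, Pi.add_apply, h2, Finset.sum_insert hi]

lemma isCompactOperator_smulRight {E F : Type*} [NormedAddCommGroup E] [NormedSpace ℂ E]
    [NormedAddCommGroup F] [NormedSpace ℂ F] (f : E →L[ℂ] ℂ) (x : F) :
    IsCompactOperator (f.smulRight x) :=
  (isCompactOperator_of_locallyCompactSpace_rng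
    (ContinuousLinearMap.toSpanSingleton ℂ x)).comp_clm f

/-- The Volterra operator is compact: it is the limit of the finite rank operators obtained by
evaluating the antiderivative only at the points `k / n`. -/
lemma isCompactOperator_volt : IsCompactOperator volt := by
  let F : ℕ → L2 →L[ℂ] L2 := fun n => ∑ k ∈ Finset.range n,
    (innerSL ℂ (indL2 0 (k / n))).smulRight (indL2 (k / n) ((k + 1) / n))
  have hF : ∀ n, IsCompactOperator (F n) := by
    intro n
    have : ∀ s : Finset ℕ, IsCompactOperator (∑ k ∈ s,
        (innerSL ℂ (indL2 0 (k / n))).smulRight (indL2 (k / n) ((k + 1) / n)) : L2 →L[ℂ] L2) := by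
      intro s
      induction s using Finset.induction_on with
      | empty => exact isCompactOperator_zero
      | insert i s hi ih =>
        rw [Finset.sum_insert hi]
        exact (isCompactOperator_smulRight _ _).add ih
    exact this _
  have hbound : ∀ n : ℕ, 0 < n → ‖volt - F n‖ ≤ Real.sqrt (1 / n) := by
    intro n hn
    have hn' : (0 : ℝ) < n := by exact_mod_cast hn
    refine ContinuousLinearMap.opNorm_le_bound _ (Real.sqrt_nonneg _) fun v => ?_
    refine norm_L2_le_of_bound (by positivity) ?_
    have hFv : F n v = ∑ k ∈ Finset.range n,
        inner ℂ (indL2 0 (k / n)) v • indL2 (k / n) ((k + 1) / n) := by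
      simp only [F]
      rw [sum_apply]
      rfl
    have hind : ∀ᵐ x ∂unitVol, ∀ k : ℕ, indL2 (k / n) ((k + 1) / n) x =
        (Ioc ((k : ℝ) / n) ((k + 1) / n)).indicator (fun _ => (1 : ℂ)) x :=
      ae_all_iff.2 fun k => indicatorConstLp_coeFn
    have hsm : ∀ᵐ x ∂unitVol, ∀ k : ℕ,
        (inner ℂ (indL2 0 (k / n)) v • indL2 (k / n) ((k + 1) / n) : L2) x =
          inner ℂ (indL2 0 (k / n)) v * indL2 (k / n) ((k + 1) / n) x :=
      ae_all_iff.2 fun k => Lp.coeFn_smul _ _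
    filter_upwards [Lp.coeFn_sub (volt v) (F n v), coeFn_volt v,
      coeFn_sum_L2 (Finset.range n) fun k => inner ℂ (indL2 0 (k / n)) v • indL2 (k / n) ((k + 1) / n),
      hind, hsm, ae_unitVol_of_forall (q := fun x => x ∈ Ioo (0 : ℝ) 1) (fun x hx => hx)]
      with x h1 h2 h3 h4 h5 hx
    change ‖(volt v - F n v) x‖ ≤ _
    rw [h1, Pi.sub_apply, h2, hFv, h3, integral_eq_inner_indL2 v hx]
    -- the index of the cell containing `x`
    set m : ℕ := ⌈n * x⌉₊ - 1 with hm
    have hc0 : 0 < ⌈n * x⌉₊ := Nat.ceil_pos.2 (mul_pos hn' hx.1)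
    have hm1 : m + 1 = ⌈n * x⌉₊ := Nat.sub_add_cancel hc0
    have hm1' : ((m : ℝ) + 1) = (⌈n * x⌉₊ : ℝ) := by exact_mod_cast hm1
    have hlo : (m : ℝ) / n < x := by
      rw [div_lt_iff₀ hn']
      have := Nat.ceil_lt_add_one (mul_pos hn' hx.1).le
      linarith
    have hhi : x ≤ ((m : ℝ) + 1) / n := by
      rw [le_div_iff₀ hn', hm1']
      linarith [Nat.le_ceil (n * x)]
    have hmn : m < n := by
      have : ⌈n * x⌉₊ ≤ n := Nat.ceil_le.2 (by nlinarith [hx.2])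
      omega
    rw [Finset.sum_eq_single m]
    · rw [h5, h4, indicator_of_mem (show x ∈ Ioc ((m : ℝ) / n) ((m + 1) / n) from ⟨hlo, hhi⟩), mul_one,
        inner_indL2_sub v (by positivity) hlo.le]
      refine (norm_inner_le_norm _ _).trans (mul_le_mul_of_nonneg_right ?_ (norm_nonneg _))
      refine (norm_indL2_le hlo.le).trans (Real.sqrt_le_sqrt ?_)
      have : ((m : ℝ) + 1) / n = m / n + 1 / n := add_div _ _ _
      linarith
    · intro k _ hk
      rw [h5, h4, indicator_of_notMem, mul_zero]
      rintro ⟨hk1, hk2⟩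
      refine hk ?_
      have a1 : (k : ℝ) < m + 1 := by
        have := hk1.trans_le hhi
        rwa [div_lt_div_iff_of_pos_right hn'] at this
      have a2 : (m : ℝ) < k + 1 := by
        have := hlo.trans_le hk2
        rwa [div_lt_div_iff_of_pos_right hn'] at this
      have a3 : k < m + 1 := by exact_mod_cast a1
      have a4 : m < k + 1 := by exact_mod_cast a2
      omega
    · intro h
      exact absurd (Finset.mem_range.2 hmn) h
  refine isCompactOperator_of_tendsto (l := atTop) (F := F) ?_ (.of_forall hF)
  rw [tendsto_iff_norm_sub_tendsto_zero]
  have hlim : Tendsto (fun n : ℕ => Real.sqrt (1 / (n : ℝ))) atTop (𝓝 0) := by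
    have := (Real.continuous_sqrt.tendsto 0).comp
      (tendsto_one_div_atTop_nhds_zero_nat (𝕜 := ℝ))
    rwa [Real.sqrt_zero] at this
  refine squeeze_zero' (.of_forall fun _ => norm_nonneg _) ?_ hlim
  filter_upwards [eventually_gt_atTop 0] with n hn
  rw [norm_sub_rev]
  exact hbound n hn

/-! ### Polynomials -/

open Polynomial in
/-- A complex polynomial, restricted to `(0,1)`, as an element of `L²(0,1)`. -/
def polyL2 : ℂ[X] →ₗ[ℂ] L2 where
  toFun q := (memLp_of_continuousOn (f := fun x : ℝ => q.eval (x : ℂ)) (by fun_prop)).toLp _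
  map_add' q r := by
    rw [← MemLp.toLp_add]
    congr 1
    ext x
    simp
  map_smul' c q := by
    rw [← MemLp.toLp_const_smul]
    congr 1
    ext x
    simp

open Polynomial

lemma coeFn_polyL2 (q : ℂ[X]) : polyL2 q =ᵐ[unitVol] fun x : ℝ => q.eval (x : ℂ) :=
  MemLp.coeFn_toLp (memLp_of_continuousOn (f := fun x : ℝ => q.eval (x : ℂ)) (by fun_prop))

lemma inner_polyL2_X_pow (n : ℕ) (v : L2) :
    inner ℂ (polyL2 (X ^ n)) v = ∫ x, ((x : ℝ) ^ n) • v x ∂unitVol := by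
  rw [L2.inner_def]
  refine integral_congr_ae ?_
  filter_upwards [coeFn_polyL2 (X ^ n)] with x hx
  rw [hx, RCLike.inner_apply]
  simp only [eval_pow, eval_X, map_pow, Complex.conj_ofReal]
  rw [← Complex.ofReal_pow, mul_comm, Complex.real_smul]

/-- The even polynomials are dense in `L²(0,1)`. -/
lemma eq_top_of_even_mem {U : Submodule ℂ L2} (hU : IsClosed (U : Set L2))
    (h : ∀ k : ℕ, polyL2 (X ^ (2 * k)) ∈ U) : U = ⊤ := by
  have : CompleteSpace U := hU.completeSpace_coe
  rw [← Submodule.orthogonal_eq_bot_iff, Submodule.eq_bot_iff]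
  intro v hv
  refine Lp.ext ((ae_eq_zero_of_even_moments (integrable_L2 v) fun k => ?_).trans
    (Lp.coeFn_zero ℂ 2 unitVol).symm)
  rw [← inner_polyL2_X_pow]
  exact hv _ (h k)

/-- The odd polynomials are dense in `L²(0,1)`. -/
lemma eq_top_of_odd_mem {U : Submodule ℂ L2} (hU : IsClosed (U : Set L2))
    (h : ∀ k : ℕ, polyL2 (X ^ (2 * k + 1)) ∈ U) : U = ⊤ := by
  have : CompleteSpace U := hU.completeSpace_coe
  rw [← Submodule.orthogonal_eq_bot_iff, Submodule.eq_bot_iff]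
  intro v hv
  have hi : Integrable (fun x : ℝ => x • v x) unitVol :=
    (integrable_L2 v).bdd_smul 1 continuous_id.aestronglyMeasurable
      (ae_unitVol_of_forall fun x hx => by
        simp only [id]; rw [Real.norm_eq_abs, abs_of_pos hx.1]; exact hx.2.le)
  have h1 := ae_eq_zero_of_even_moments hi fun k => by
    have := hv _ (h k)
    rw [inner_polyL2_X_pow] at this
    rw [← this]
    simp_rw [pow_succ, mul_smul]
  refine Lp.ext ?_
  filter_upwards [h1, ae_unitVol_of_forall (q := fun x => x ∈ Ioo (0 : ℝ) 1) (fun x hx => hx),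
    Lp.coeFn_zero ℂ 2 unitVol] with x hx hx' h0
  rw [h0]
  exact (smul_eq_zero.1 hx).resolve_left hx'.1.ne'

open Polynomial EnergySpace

/-! ### Polynomial elements of the energy space -/

/-- Composition with a polynomial from the right, as a linear map. -/
def compL (r : ℂ[X]) : ℂ[X] →ₗ[ℂ] ℂ[X] where
  toFun q := q.comp r
  map_add' _ _ := add_comp
  map_smul' _ _ := smul_comp _ _ _

/-- The odd part of a polynomial. -/
def oddPart : ℂ[X] →ₗ[ℂ] ℂ[X] := (1 / 2 : ℂ) • (LinearMap.id - compL (-X))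

/-- The even part of a polynomial. -/
def evenPart : ℂ[X] →ₗ[ℂ] ℂ[X] := (1 / 2 : ℂ) • (LinearMap.id + compL (-X))

lemma oddPart_apply (q : ℂ[X]) : oddPart q = (1 / 2 : ℂ) • (q - q.comp (-X)) := rfl
lemma evenPart_apply (q : ℂ[X]) : evenPart q = (1 / 2 : ℂ) • (q + q.comp (-X)) := rfl

lemma oddPart_X_pow_odd (k : ℕ) : oddPart (X ^ (2 * k + 1)) = X ^ (2 * k + 1) := by
  rw [oddPart_apply, X_pow_comp, Odd.neg_pow ⟨k, rfl⟩, sub_neg_eq_add, ← two_smul ℂ, smul_smul]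
  norm_num

lemma oddPart_X_pow_even (k : ℕ) : oddPart (X ^ (2 * k)) = 0 := by
  rw [oddPart_apply, X_pow_comp, Even.neg_pow ⟨k, two_mul k⟩, sub_self, smul_zero]

lemma evenPart_X_pow_odd (k : ℕ) : evenPart (X ^ (2 * k + 1)) = 0 := by
  rw [evenPart_apply, X_pow_comp, Odd.neg_pow ⟨k, rfl⟩, add_neg_cancel, smul_zero]

lemma evenPart_X_pow_even (k : ℕ) : evenPart (X ^ (2 * k)) = X ^ (2 * k) := by
  rw [evenPart_apply, X_pow_comp, Even.neg_pow ⟨k, two_mul k⟩, ← two_smul ℂ, smul_smul]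
  norm_num

/-- The element of the energy space whose components are the odd and the even part of a
polynomial. In this way, the energy space becomes a space of functions on `(-1,1)`, on which the
free operator acts as `F ↦ (1 - x) F' - a F`. -/
def el : ℂ[X] →ₗ[ℂ] EnergySpace :=
  (embOdd : L2 →ₗ[ℂ] EnergySpace) ∘ₗ polyL2 ∘ₗ derivative ∘ₗ oddPart +
    (embEven : L2 →ₗ[ℂ] EnergySpace) ∘ₗ polyL2 ∘ₗ derivative ∘ₗ evenPart +
    (LinearMap.toSpanSingleton ℂ EnergySpace oneE) ∘ₗ leval 0

lemma el_apply (q : ℂ[X]) : el q = embOdd (polyL2 (derivative (oddPart q))) +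
    embEven (polyL2 (derivative (evenPart q))) + q.eval 0 • oneE := rfl

lemma el_X_pow_odd (k : ℕ) :
    el (X ^ (2 * k + 1)) = (2 * k + 1 : ℂ) • embOdd (polyL2 (X ^ (2 * k))) := by
  have h : derivative (X ^ (2 * k + 1) : ℂ[X]) = (2 * k + 1 : ℂ) • X ^ (2 * k) := by
    rw [derivative_X_pow, smul_eq_C_mul]; simp
  rw [el_apply, oddPart_X_pow_odd, evenPart_X_pow_odd, h]
  simp

lemma el_X_pow_even (k : ℕ) :
    el (X ^ (2 * k + 2)) = (2 * k + 2 : ℂ) • embEven (polyL2 (X ^ (2 * k + 1))) := by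
  have h : derivative (X ^ (2 * k + 2) : ℂ[X]) = (2 * k + 2 : ℂ) • X ^ (2 * k + 1) := by
    rw [derivative_X_pow, smul_eq_C_mul]; simp
  have h2 : 2 * k + 2 = 2 * (k + 1) := by ring
  rw [el_apply, h2, oddPart_X_pow_even, evenPart_X_pow_even, ← h2, h]
  simp

lemma el_one : el 1 = oneE := by
  have h1 : oddPart 1 = 0 := by simpa using oddPart_X_pow_even 0
  have h2 : evenPart 1 = 1 := by simpa using evenPart_X_pow_even 0
  rw [el_apply, h1, h2]
  simp

lemma integral_derivative_eval (r : ℂ[X]) (x : ℝ) :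
    ∫ t in (0 : ℝ)..x, (derivative r).eval (t : ℂ) = r.eval (x : ℂ) - r.eval 0 := by
  have := intervalIntegral.integral_eq_sub_of_hasDerivAt (a := 0) (b := x)
    (fun t _ => (r.hasDerivAt (t : ℂ)).comp_ofReal)
    ((by fun_prop : Continuous fun t : ℝ => (derivative r).eval (t : ℂ)).intervalIntegrable _ _)
  simpa using this

lemma integral_polyL2_derivative (r : ℂ[X]) :
    (fun x : ℝ => ∫ t in (0 : ℝ)..x, polyL2 (derivative r) t) =ᵐ[unitVol]
      fun x : ℝ => r.eval (x : ℂ) - r.eval 0 :=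
  ae_unitVol_of_forall fun x hx => by
    exact (intervalIntegral_congr_fn (coeFn_polyL2 _) hx).trans (integral_derivative_eval r x)

lemma represents_el (q : ℂ[X]) : Represents (el q) (fun x : ℝ => (oddPart q).eval (x : ℂ))
    (fun x : ℝ => (evenPart q).eval (x : ℂ)) := by
  have h := ((represents_embOdd (polyL2 (derivative (oddPart q)))).add
    (represents_embEven (polyL2 (derivative (evenPart q))))).add (represents_oneE.smul (q.eval 0))
  have ho : (oddPart q).eval 0 = 0 := by simp [oddPart_apply, eval_comp]
  have he : (evenPart q).eval 0 = q.eval 0 := by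
    simp [evenPart_apply, eval_comp]; ring
  refine ⟨h.1.trans ?_, h.2.trans ?_⟩
  · filter_upwards [integral_polyL2_derivative (oddPart q)] with x hx
    simp only [Pi.add_apply, Pi.smul_apply, Pi.zero_apply]
    rw [hx, ho]; simp
  · filter_upwards [integral_polyL2_derivative (evenPart q)] with x hx
    simp only [Pi.add_apply, Pi.smul_apply, Pi.zero_apply]
    rw [hx, he]; simp

/-- Polynomials are dense in the energy space. -/
lemma denseRange_el : DenseRange el := by
  set W : Submodule ℂ EnergySpace := (LinearMap.range el).topologicalClosure with hW
  have hWc : IsClosed (W : Set EnergySpace) := Submodule.isClosed_topologicalClosure _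
  have hmem : ∀ q, el q ∈ W := fun q => Submodule.le_topologicalClosure _ ⟨q, rfl⟩
  have h1 : W.comap (embOdd : L2 →ₗ[ℂ] EnergySpace) = ⊤ :=
    eq_top_of_even_mem (hWc.preimage embOdd.continuous) fun k => by
      have := hmem (X ^ (2 * k + 1))
      rw [el_X_pow_odd] at this
      exact (W.smul_mem_iff (by exact_mod_cast Nat.succ_ne_zero (2 * k))).1 this
  have h2 : W.comap (embEven : L2 →ₗ[ℂ] EnergySpace) = ⊤ :=
    eq_top_of_odd_mem (hWc.preimage embEven.continuous) fun k => by
      have := hmem (X ^ (2 * k + 2))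
      rw [el_X_pow_even] at this
      exact (W.smul_mem_iff (by exact_mod_cast Nat.succ_ne_zero (2 * k + 1))).1 this
  intro u
  have : u ∈ W := by
    obtain ⟨d, hd⟩ := exists_eq_emb u
    rw [hd]
    refine W.add_mem (W.add_mem ?_ ?_) (W.smul_mem _ ?_)
    · exact h1.ge (Submodule.mem_top (x := weakD (u.fst : H1)))
    · exact h2.ge (Submodule.mem_top (x := weakD u.snd))
    · rw [← el_one]; exact hmem 1
  exact this

/-! ### The energy norm of a polynomial -/

lemma norm_polyL2_sq (r : ℂ[X]) : ‖polyL2 r‖ ^ 2 = ∫ x in (0 : ℝ)..1, ‖r.eval (x : ℂ)‖ ^ 2 := by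
  have h : ((‖polyL2 r‖ ^ 2 : ℝ) : ℂ) = ((∫ x, ‖r.eval (x : ℂ)‖ ^ 2 ∂unitVol : ℝ) : ℂ) := by
    rw [← integral_complex_ofReal, Complex.ofReal_pow]
    refine (inner_self_eq_norm_sq_to_K (𝕜 := ℂ) (polyL2 r)).symm.trans ?_
    rw [L2.inner_def]
    refine integral_congr_ae ?_
    filter_upwards [coeFn_polyL2 r] with x hx
    rw [hx, inner_self_eq_norm_sq_to_K]
    simp
  rw [Complex.ofReal_injective h, intervalIntegral.integral_of_le zero_le_one,
    integral_Ioc_eq_integral_Ioo]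

/-- The squared `L²(-1,1)` norm of a polynomial. -/
def sqNorm (r : ℂ[X]) : ℝ := ∫ x in (-1 : ℝ)..1, ‖r.eval (x : ℂ)‖ ^ 2

lemma continuous_eval_norm_sq (r : ℂ[X]) : Continuous fun x : ℝ => ‖r.eval (x : ℂ)‖ ^ 2 := by fun_prop

lemma sqNorm_nonneg (r : ℂ[X]) : 0 ≤ sqNorm r :=
  intervalIntegral.integral_nonneg (by norm_num) fun _ _ => by positivity

/-- By the parallelogram law, the odd and the even part of `r` on `(0,1)` together carry half of the
squared norm of `r` on `(-1,1)`. -/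
lemma integral_norm_sq_add {f g r : ℂ[X]} (hf : ∀ x, f.eval x = (1 / 2) * (r.eval x - r.eval (-x)))
    (hg : ∀ x, g.eval x = (1 / 2) * (r.eval x + r.eval (-x))) :
    (∫ x in (0 : ℝ)..1, ‖f.eval (x : ℂ)‖ ^ 2) + ∫ x in (0 : ℝ)..1, ‖g.eval (x : ℂ)‖ ^ 2 =
      1 / 2 * sqNorm r := by
  have hi : ∀ r : ℂ[X], ∀ a b : ℝ,
      IntervalIntegrable (fun x : ℝ => ‖r.eval (x : ℂ)‖ ^ 2) volume a b :=
    fun r a b => (continuous_eval_norm_sq r).intervalIntegrable a b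
  have hi' : IntervalIntegrable (fun x : ℝ => ‖r.eval (-(x : ℂ))‖ ^ 2) volume 0 1 :=
    (by fun_prop : Continuous fun x : ℝ => ‖r.eval (-(x : ℂ))‖ ^ 2).intervalIntegrable _ _
  have e : ∫ x in (-1 : ℝ)..0, ‖r.eval (x : ℂ)‖ ^ 2 = ∫ x in (0 : ℝ)..1, ‖r.eval (-(x : ℂ))‖ ^ 2 := by
    have := intervalIntegral.integral_comp_neg (a := 0) (b := 1)
      (fun x : ℝ => ‖r.eval (x : ℂ)‖ ^ 2)
    simpa using this.symm
  rw [sqNorm, ← intervalIntegral.integral_add_adjacent_intervals (hi r (-1) 0) (hi r 0 1), e,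
    ← intervalIntegral.integral_add (hi f 0 1) (hi g 0 1), ← intervalIntegral.integral_add hi' (hi r 0 1),
    ← intervalIntegral.integral_const_mul]
  refine intervalIntegral.integral_congr fun x _ => ?_
  simp only [hf, hg, norm_mul, mul_pow]
  have := parallelogram_law_with_norm ℂ (r.eval (x : ℂ)) (r.eval (-(x : ℂ)))
  simp only [one_div, norm_inv, RCLike.norm_ofNat]
  linarith

lemma toL2_weakD_of_represents {u : H1} {r : ℂ[X]} (h : fn u =ᵐ[unitVol] fun x : ℝ => r.eval (x : ℂ)) :
    toL2 u = polyL2 r ∧ weakD u = polyL2 (derivative r) := by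
  have h2 : u = anti (polyL2 (derivative r)) + r.eval 0 • oneH1 := by
    refine ext_fn (h.trans ?_)
    filter_upwards [integral_polyL2_derivative r, fn_anti (polyL2 (derivative r)),
      fn_add (anti (polyL2 (derivative r))) (r.eval 0 • oneH1), fn_smul (r.eval 0) oneH1, fn_oneH1]
      with x h1 h2 h3 h4 h5
    rw [h3, Pi.add_apply, h2, h1, h4, Pi.smul_apply, h5]
    simp
  refine ⟨Lp.ext (h.trans (coeFn_polyL2 r).symm), ?_⟩
  have h4 : weakD oneH1 = 0 := Lp.ext ((MemLp.coeFn_toLp (memLp_const (0 : ℂ))).trans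
    (Lp.coeFn_zero ℂ 2 unitVol).symm)
  rw [h2]
  change weakD (anti _) + r.eval 0 • weakD oneH1 = _
  rw [h4, smul_zero, add_zero, weakD_anti]

/-- The energy norm is, up to a factor, the norm of `H¹(-1,1)`. -/
lemma norm_el_sq (q : ℂ[X]) : ‖el q‖ ^ 2 = 1 / 2 * (sqNorm q + sqNorm (derivative q)) := by
  obtain ⟨a1, a2⟩ := toL2_weakD_of_represents (represents_el q).1
  obtain ⟨b1, b2⟩ := toL2_weakD_of_represents (represents_el q).2
  have e1 := integral_norm_sq_add (f := oddPart q) (g := evenPart q) (r := q)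
    (fun x => by simp [oddPart_apply, eval_comp]) (fun x => by simp [evenPart_apply, eval_comp, mul_add])
  have e2 := integral_norm_sq_add (f := derivative (evenPart q)) (g := derivative (oddPart q))
    (r := derivative q)
    (fun x => by simp [evenPart_apply, eval_comp, derivative_comp]; ring)
    (fun x => by simp [oddPart_apply, eval_comp, derivative_comp, mul_add])
  have hfst : ‖(el q).fst‖ = ‖((el q).fst : H1)‖ := rfl
  rw [EnergySpace.norm_sq, hfst, h1_norm_sq, h1_norm_sq, a1, a2, b1, b2, norm_polyL2_sq, norm_polyL2_sq,
    norm_polyL2_sq, norm_polyL2_sq]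
  linarith

/-- Sobolev embedding `H¹(-1,1) ⊆ L^∞(-1,1)` for polynomials. -/
lemma norm_eval_sq_le (q : ℂ[X]) {x : ℝ} (hx : x ∈ Icc (-1 : ℝ) 1) :
    ‖q.eval (x : ℂ)‖ ^ 2 ≤ sqNorm q + 4 * sqNorm (derivative q) := by
  have hc : Continuous fun t : ℝ => (derivative q).eval (t : ℂ) := by fun_prop
  set A : ℝ := ∫ t in (-1 : ℝ)..1, ‖(derivative q).eval (t : ℂ)‖ with hA
  have hA0 : 0 ≤ A := intervalIntegral.integral_nonneg (by norm_num) fun _ _ => norm_nonneg _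
  have hA2 : A ^ 2 ≤ 2 * sqNorm (derivative q) := by
    -- the Cauchy-Schwarz inequality, from `0 ≤ ∫ (‖q'‖ - A / 2)²`
    have h0 : 0 ≤ ∫ t in (-1 : ℝ)..1, (‖(derivative q).eval (t : ℂ)‖ - A / 2) ^ 2 :=
      intervalIntegral.integral_nonneg (by norm_num) fun _ _ => sq_nonneg _
    have h1 : ∀ t : ℝ, (‖(derivative q).eval (t : ℂ)‖ - A / 2) ^ 2 =
        ‖(derivative q).eval (t : ℂ)‖ ^ 2 - A * ‖(derivative q).eval (t : ℂ)‖ + A ^ 2 / 4 :=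
      fun t => by ring
    simp_rw [h1] at h0
    rw [intervalIntegral.integral_add, intervalIntegral.integral_sub,
      intervalIntegral.integral_const_mul, intervalIntegral.integral_const] at h0
    · change 0 ≤ sqNorm (derivative q) - A * A + (1 - -1) • (A ^ 2 / 4) at h0
      rw [smul_eq_mul] at h0
      nlinarith
    all_goals exact Continuous.intervalIntegrable (by fun_prop) _ _
  have hdiff : ∀ y ∈ Icc (-1 : ℝ) 1, ‖q.eval (x : ℂ)‖ ≤ ‖q.eval (y : ℂ)‖ + A := by
    intro y hy
    have h1 : q.eval (x : ℂ) - q.eval (y : ℂ) = ∫ t in y..x, (derivative q).eval (t : ℂ) :=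
      (intervalIntegral.integral_eq_sub_of_hasDerivAt
        (fun t _ => (q.hasDerivAt (t : ℂ)).comp_ofReal) (hc.intervalIntegrable _ _)).symm
    have h2 : ‖q.eval (x : ℂ) - q.eval (y : ℂ)‖ ≤ A := by
      rw [h1, hA, intervalIntegral.integral_of_le (by norm_num : (-1 : ℝ) ≤ 1)]
      refine intervalIntegral.norm_integral_le_integral_norm_uIoc.trans ?_
      refine setIntegral_mono_set ?_ (.of_forall fun t => norm_nonneg _) (LE.le.eventuallyLE ?_)
      · exact (hc.norm.integrableOn_Icc).mono_set Ioc_subset_Icc_self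
      · exact Ioc_subset_Ioc (le_min hy.1 hx.1) (max_le hy.2 hx.2)
    have := norm_sub_norm_le (q.eval (x : ℂ)) (q.eval (y : ℂ))
    linarith
  have hsq : ∀ y ∈ Icc (-1 : ℝ) 1, ‖q.eval (x : ℂ)‖ ^ 2 ≤ 2 * ‖q.eval (y : ℂ)‖ ^ 2 + 2 * A ^ 2 := by
    intro y hy
    have h1 := hdiff y hy
    have h2 : ‖q.eval (x : ℂ)‖ ^ 2 ≤ (‖q.eval (y : ℂ)‖ + A) ^ 2 :=
      pow_le_pow_left₀ (norm_nonneg _) h1 2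
    nlinarith [sq_nonneg (‖q.eval (y : ℂ)‖ - A)]
  have hint := intervalIntegral.integral_mono_on (by norm_num : (-1 : ℝ) ≤ 1)
    (intervalIntegrable_const (μ := volume))
    (Continuous.intervalIntegrable (by fun_prop) _ _) hsq
  rw [intervalIntegral.integral_const, intervalIntegral.integral_add,
    intervalIntegral.integral_const_mul, intervalIntegral.integral_const] at hint
  · change _ ≤ 2 * sqNorm q + _ at hint
    simp only [smul_eq_mul] at hint
    linarith
  all_goals exact Continuous.intervalIntegrable (by fun_prop) _ _

/-! ### The free semigroup -/

/-- The contraction `x ↦ 1 - s (1 - x)` of `[-1,1]` towards `1`, acting on polynomials. -/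
def dilate (s : ℝ) : ℂ[X] →ₗ[ℂ] ℂ[X] := compL (1 + C (s : ℂ) * (X - 1))

lemma dilate_apply (s : ℝ) (q : ℂ[X]) : dilate s q = q.comp (1 + C (s : ℂ) * (X - 1)) := rfl

lemma dilate_dilate (s t : ℝ) (q : ℂ[X]) : dilate s (dilate t q) = dilate (s * t) q := by
  rw [dilate_apply, dilate_apply, dilate_apply, comp_assoc]
  congr 1
  simp
  ring

lemma dilate_X_sub_one_pow (s : ℝ) (k : ℕ) :
    dilate s ((X - 1) ^ k) = ((s : ℂ) ^ k) • (X - 1) ^ k := by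
  rw [dilate_apply, pow_comp, sub_comp, X_comp, one_comp, add_sub_cancel_left, mul_pow, ← C_pow,
    smul_eq_C_mul]

lemma eval_dilate (s x : ℝ) (q : ℂ[X]) :
    (dilate s q).eval (x : ℂ) = q.eval ((1 + s * (x - 1) : ℝ) : ℂ) := by
  rw [dilate_apply, eval_comp]; simp

lemma derivative_dilate (s : ℝ) (q : ℂ[X]) :
    derivative (dilate s q) = (s : ℂ) • dilate s (derivative q) := by
  rw [dilate_apply, dilate_apply, derivative_comp, smul_eq_C_mul]; simp

/-- Induction principle for polynomials expanded around `1`. -/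
lemma polynomial_induction_sub_one {motive : ℂ[X] → Prop}
    (hadd : ∀ q r, motive q → motive r → motive (q + r))
    (hsmul : ∀ (c : ℂ) (k : ℕ), motive (c • (X - 1) ^ k)) (q : ℂ[X]) : motive q := by
  have h : ∀ r : ℂ[X], motive (r.comp (X - 1)) := by
    intro r
    induction r using Polynomial.induction_on' with
    | add p q hp hq => rw [add_comp]; exact hadd _ _ hp hq
    | monomial n c => rw [monomial_comp, ← smul_eq_C_mul]; exact hsmul c n
  have h2 := h (q.comp (X + 1))
  rw [comp_assoc] at h2
  simpa using h2

/-- Dilations are uniformly bounded in the energy norm, although not contractive: the `L²` part is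
controlled by the Sobolev embedding. -/
lemma norm_el_dilate_le {s : ℝ} (hs0 : 0 ≤ s) (hs1 : s ≤ 1) (q : ℂ[X]) :
    ‖el (dilate s q)‖ ≤ 3 * ‖el q‖ := by
  refine abs_le_of_sq_le_sq' ?_ (by positivity) |>.2
  rw [mul_pow, norm_el_sq, norm_el_sq]
  have h1 : sqNorm (dilate s q) ≤ 2 * (sqNorm q + 4 * sqNorm (derivative q)) := by
    have := intervalIntegral.integral_mono_on (by norm_num : (-1 : ℝ) ≤ 1)
      ((continuous_eval_norm_sq (dilate s q)).intervalIntegrable (-1) 1)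
      (intervalIntegrable_const (μ := volume)) fun x hx => by
        rw [eval_dilate]
        exact norm_eval_sq_le q (x := 1 + s * (x - 1))
          ⟨by nlinarith [hx.1, hx.2], by nlinarith [hx.1, hx.2]⟩
    rw [intervalIntegral.integral_const, smul_eq_mul] at this
    refine this.trans_eq (by norm_num)
  have h2 : sqNorm (derivative (dilate s q)) ≤ sqNorm (derivative q) := by
    have e : ∀ x : ℝ, ‖(derivative (dilate s q)).eval (x : ℂ)‖ ^ 2 =
        s * (s * ‖(derivative q).eval (((s * x + (1 - s)) : ℝ) : ℂ)‖ ^ 2) := by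
      intro x
      rw [derivative_dilate, eval_smul, eval_dilate, smul_eq_mul, norm_mul, Complex.norm_real,
        Real.norm_of_nonneg hs0, show 1 + s * (x - 1) = s * x + (1 - s) by ring]
      ring
    simp only [sqNorm]
    simp_rw [e]
    rw [intervalIntegral.integral_const_mul, intervalIntegral.integral_const_mul]
    have hsub := intervalIntegral.mul_integral_comp_mul_add (a := -1) (b := 1)
      (f := fun x : ℝ => ‖(derivative q).eval (x : ℂ)‖ ^ 2) s (1 - s)
    rw [hsub]
    have hle : ∫ x in (s * -1 + (1 - s))..(s * 1 + (1 - s)), ‖(derivative q).eval (x : ℂ)‖ ^ 2 ≤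
        ∫ x in (-1 : ℝ)..1, ‖(derivative q).eval (x : ℂ)‖ ^ 2 :=
      intervalIntegral.integral_mono_interval (by linarith) (by linarith) (by linarith)
        (.of_forall fun x => by positivity)
        ((continuous_eval_norm_sq _).intervalIntegrable _ _)
    have h0 : 0 ≤ ∫ x in (s * -1 + (1 - s))..(s * 1 + (1 - s)), ‖(derivative q).eval (x : ℂ)‖ ^ 2 :=
      intervalIntegral.integral_nonneg (by linarith) fun _ _ => by positivity
    nlinarith
  have h3 := sqNorm_nonneg q
  have h4 := sqNorm_nonneg (derivative q)
  nlinarith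

/-- The action `q ↦ (1 - x) q' - a q` of the free operator on polynomials. -/
def freePoly (a : ℂ) : ℂ[X] →ₗ[ℂ] ℂ[X] := (LinearMap.mulLeft ℂ (1 - X)) ∘ₗ derivative - a • LinearMap.id

lemma freePoly_apply (a : ℂ) (q : ℂ[X]) : freePoly a q = (1 - X) * derivative q - a • q := rfl

lemma freePoly_X_sub_one_pow (a : ℂ) (k : ℕ) :
    freePoly a ((X - 1) ^ k) = (-(a + k)) • (X - 1) ^ k := by
  rcases k with _ | k
  · simp [freePoly_apply]
  · rw [freePoly_apply, derivative_pow, derivative_sub, derivative_X, derivative_one,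
      smul_eq_C_mul, smul_eq_C_mul]
    simp
    ring

/-- The free operator, acting on functions on `(-1,1)` as `F ↦ (1 - x) F' - a F`, generates the
semigroup `F ↦ e^{-a t} F (1 - e^{-t} (1 - x))`. -/
lemma exists_freeSemigroup (a : ℝ) : ∃ S : C0Semigroup EnergySpace,
    (∀ t : ℝ, 0 ≤ t → ∀ x, ‖S.flow t x‖ ≤ 3 * Real.exp (-a * t) * ‖x‖) ∧
    ∀ q, S.Gen (el q) (el (freePoly a q)) := by
  let T : ℝ → ℂ[X] →ₗ[ℂ] EnergySpace := fun t =>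
    ((Real.exp (-a * t) : ℝ) : ℂ) • (el ∘ₗ dilate (Real.exp (-t)))
  have hT : ∀ t q, T t q = ((Real.exp (-a * t) : ℝ) : ℂ) • el (dilate (Real.exp (-t)) q) :=
    fun _ _ => rfl
  have hTn : ∀ t, 0 ≤ t → ∀ q, ‖T t q‖ ≤ (3 * Real.exp (-a * t)) * ‖el q‖ := by
    intro t ht q
    rw [hT, norm_smul, Complex.norm_real, Real.norm_of_nonneg (Real.exp_pos _).le, mul_comm 3, mul_assoc]
    exact mul_le_mul_of_nonneg_left (norm_el_dilate_le (Real.exp_pos _).le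
      (Real.exp_le_one_iff.2 (by linarith)) q) (Real.exp_pos _).le
  have hTp : ∀ (t : ℝ) (k : ℕ), T t ((X - 1) ^ k) = Complex.exp (-(a + k) * t) • el ((X - 1) ^ k) := by
    intro t k
    rw [hT, dilate_X_sub_one_pow, map_smul, smul_smul, Complex.ofReal_exp, Complex.ofReal_exp,
      ← Complex.exp_nat_mul, ← Complex.exp_add]
    congr 2
    push_cast
    ring
  have hTd : ∀ q t, HasDerivAt (fun t => T t q) (T t (freePoly a q)) t := by
    intro q t
    induction q using polynomial_induction_sub_one with
    | hadd q r hq hr =>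
      simp only [map_add]
      exact hq.add hr
    | hsmul c k =>
      simp only [map_smul, freePoly_X_sub_one_pow, hTp]
      have h1 : HasDerivAt (fun t : ℝ => Complex.exp (-(a + k) * t))
          (Complex.exp (-(a + k) * t) * (-(a + k) * 1)) t :=
        ((Complex.ofRealCLM.hasDerivAt (x := t)).const_mul (-(a + k : ℂ))).cexp
      refine ((h1.smul_const (el ((X - 1) ^ k))).const_smul c).congr_deriv ?_
      rw [smul_smul (-(a + k : ℂ)), mul_one, mul_comm]
  let op : ℝ≥0 → EnergySpace →L[ℂ] EnergySpace := fun t => (T t).extendOfNorm el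
  have hop : ∀ t q, op t (el q) = T t q := fun t q =>
    LinearMap.extendOfNorm_eq denseRange_el ⟨_, hTn t t.coe_nonneg⟩ q
  have hopn : ∀ t x, ‖op t x‖ ≤ (3 * Real.exp (-a * t)) * ‖x‖ := fun t =>
    LinearMap.norm_extendOfNorm_apply_le denseRange_el _ (hTn t t.coe_nonneg)
  have hext : ∀ A B : EnergySpace →L[ℂ] EnergySpace, (∀ q, A (el q) = B (el q)) → A = B :=
    fun A B h => ContinuousLinearMap.coeFn_injective
      (denseRange_el.equalizer A.continuous B.continuous (funext h))
  let S : C0Semigroup EnergySpace :=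
    { op := op
      op_zero := hext _ _ fun q => by
        rw [hop, hT]
        simp [dilate_apply]
      op_add := fun s t => hext _ _ fun q => by
        rw [mul_apply_eq_comp, hop, hop, hT, hT, map_smul, hop, hT, dilate_dilate,
          smul_smul, ← Complex.ofReal_mul, ← Real.exp_add, ← Real.exp_add]
        congr 4
        · push_cast; ring
        · rw [NNReal.coe_add, neg_add]
      continuous_orbit := fun x => by
        rw [continuous_iff_continuousAt]
        intro t₀
        -- the operators are bounded on bounded time intervals, so it suffices to consider the
        -- dense set of polynomials
        set M : ℝ := 3 * Real.exp (|a| * (t₀ + 1)) with hM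
        have hM0 : 0 < M := by positivity
        have hb : ∀ᶠ t : ℝ≥0 in 𝓝 t₀, ∀ y, ‖op t y‖ ≤ M * ‖y‖ := by
          filter_upwards [eventually_lt_nhds (lt_add_one t₀)] with t ht y
          refine (hopn t y).trans (mul_le_mul_of_nonneg_right ?_ (norm_nonneg y))
          refine mul_le_mul_of_nonneg_left (Real.exp_le_exp.2 ?_) (by norm_num)
          have h1 : (t : ℝ) ≤ t₀ + 1 := by exact_mod_cast ht.le
          calc -a * t ≤ |a| * t := mul_le_mul_of_nonneg_right (neg_le_abs a) t.coe_nonneg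
            _ ≤ _ := mul_le_mul_of_nonneg_left h1 (abs_nonneg a)
        rw [ContinuousAt, Metric.tendsto_nhds]
        intro ε hε
        obtain ⟨q, hq⟩ := denseRange_el.exists_dist_lt x (ε := ε / (3 * M)) (by positivity)
        have hc : Continuous fun t : ℝ≥0 => op t (el q) := by
          simp_rw [hop]
          exact (continuous_iff_continuousAt.2 fun t => (hTd q t).continuousAt).comp
            NNReal.continuous_coe
        filter_upwards [hb, Metric.tendsto_nhds.1 (hc.tendsto t₀) (ε / 3) (by positivity)] with t h1 h2
        have h3 : ∀ s, (∀ y, ‖op s y‖ ≤ M * ‖y‖) → dist (op s x) (op s (el q)) < ε / 3 := by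
          intro s hs
          rw [dist_eq_norm, ← map_sub]
          refine (hs _).trans_lt ?_
          rw [dist_eq_norm, lt_div_iff₀ (by positivity)] at hq
          linarith
        have h4 := h3 t h1
        have h5 := h3 t₀ hb.self_of_nhds
        rw [dist_comm] at h5
        have h6 := dist_triangle4 (op t x) (op t (el q)) (op t₀ (el q)) (op t₀ x)
        linarith }
  have hflow : ∀ t, 0 ≤ t → ∀ q, S.flow t (el q) = T t q := by
    intro t ht q
    lift t to ℝ≥0 using ht
    rw [S.flow_coe]
    exact hop t q
  refine ⟨S, fun t ht x => ?_, fun q => ?_⟩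
  · lift t to ℝ≥0 using ht
    rw [S.flow_coe]
    exact hopn t x
  · have h0 : T 0 (freePoly a q) = el (freePoly a q) := by
      rw [hT]
      simp [dilate_apply]
    have h1 := (hTd q 0).hasDerivWithinAt (s := Ici 0)
    rw [h0] at h1
    exact h1.congr (fun t ht => hflow t ht q) (hflow 0 le_rfl q)

/-! ### The generator of the free semigroup -/

section

variable {E : Type*} [NormedAddCommGroup E] [NormedSpace ℂ E]

/-- The graph of the generator of a semigroup. -/
def C0Semigroup.genGraph (S : C0Semigroup E) : Submodule ℂ (E × E) where
  carrier := {x | S.Gen x.1 x.2}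
  zero_mem' := by
    have h : (fun t : ℝ => S.flow t (0 : E)) = fun _ => 0 := funext fun t => map_zero _
    change HasDerivWithinAt _ _ _ _
    rw [Prod.fst_zero, Prod.snd_zero, h]
    exact hasDerivWithinAt_const _ _ _
  add_mem' := fun ha hb => C0Semigroup.Gen.add ha hb
  smul_mem' := fun c _ ha => C0Semigroup.Gen.smul c ha

lemma C0Semigroup.mem_genGraph {S : C0Semigroup E} {x y : E} : (x, y) ∈ S.genGraph ↔ S.Gen x y :=
  Iff.rfl

/-- The resolvent at `1` of the generator of an exponentially stable semigroup. -/
lemma C0Semigroup.exists_resolvent_one [CompleteSpace E] {S : C0Semigroup E} {M a : ℝ} (hM0 : 0 ≤ M)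
    (ha : 0 < a) (hM : ∀ t : ℝ, 0 ≤ t → ∀ x, ‖S.flow t x‖ ≤ M * Real.exp (-a * t) * ‖x‖) :
    ∃ R : E →L[ℂ] E, (∀ f, S.Gen (R f) (R f - f)) ∧ ∀ x y, S.Gen x y → R (x - y) = x := by
  have hb : ∀ t : ℝ, 0 ≤ t → ∀ x, ‖S.flow t x‖ ≤ M * ‖x‖ := fun t ht x =>
    (hM t ht x).trans (mul_le_mul_of_nonneg_right
      (mul_le_of_le_one_right hM0 (Real.exp_le_one_iff.2 (by nlinarith))) (norm_nonneg x))
  obtain ⟨R, hR⟩ := S.exists_laplace 1 hb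
  refine ⟨R, hR, fun x y hxy => ?_⟩
  have h1 : S.Gen (x - R (x - y)) ((1 : ℂ) • (x - R (x - y))) := by
    have := hxy.sub (hR (x - y))
    rw [one_apply_eq_self] at this
    convert this using 1
    rw [one_smul]; abel
  set z := x - R (x - y) with hz
  have h2 : ∀ t : ℝ, 0 ≤ t → ‖z‖ ≤ M * Real.exp (-t) * ‖z‖ := by
    intro t ht
    have h3 := hb t ht z
    rw [h1.flow_eigenvector ht, one_mul, norm_smul, ← Complex.ofReal_exp, Complex.norm_real,
      Real.norm_of_nonneg (Real.exp_pos t).le] at h3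
    rw [Real.exp_neg, mul_right_comm, ← div_eq_mul_inv, le_div_iff₀ (Real.exp_pos t)]
    linarith
  have h4 : Tendsto (fun t : ℝ => M * Real.exp (-t) * ‖z‖) atTop (𝓝 (M * 0 * ‖z‖)) :=
    (tendsto_const_nhds.mul Real.tendsto_exp_neg_atTop_nhds_zero).mul tendsto_const_nhds
  have h5 : ‖z‖ ≤ M * 0 * ‖z‖ :=
    ge_of_tendsto h4 ((eventually_ge_atTop 0).mono h2)
  rw [mul_zero, zero_mul, norm_le_zero_iff, hz, sub_eq_zero] at h5
  exact h5.symm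

end

lemma freePoly_X_pow (a : ℂ) (n : ℕ) :
    freePoly a (X ^ n) = (n : ℂ) • X ^ (n - 1) - (n + a) • X ^ n := by
  rcases n with _ | n
  · simp [freePoly_apply]
  · rw [freePoly_apply, derivative_X_pow]
    simp only [smul_eq_C_mul, map_add, Nat.add_sub_cancel]
    ring

/-- `1 - A` is surjective on polynomials, where `A` is the free operator. -/
lemma exists_sub_freePoly_eq {a : ℝ} (ha : 0 ≤ a) (q : ℂ[X]) : ∃ r, r - freePoly a r = q := by
  suffices h : LinearMap.range (LinearMap.id - freePoly (a : ℂ)) = ⊤ by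
    exact LinearMap.range_eq_top.1 h q
  rw [eq_top_iff]
  have hX : ∀ n : ℕ, (X ^ n : ℂ[X]) ∈ LinearMap.range (LinearMap.id - freePoly (a : ℂ)) := by
    intro n
    have hne : ∀ n : ℕ, (1 + (n + a) : ℂ) ≠ 0 := fun n h => by
      have h2 : (((1 + (n + a) : ℝ)) : ℂ) = 0 := by push_cast; exact h
      have h3 : (1 + (n + a) : ℝ) = 0 := by exact_mod_cast h2
      have : (0 : ℝ) ≤ n := n.cast_nonneg
      linarith
    induction n with
    | zero =>
      refine (Submodule.smul_mem_iff _ (hne 0)).1 ⟨X ^ 0, ?_⟩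
      rw [LinearMap.sub_apply, freePoly_X_pow, LinearMap.id_apply]
      module
    | succ n ih =>
      refine (Submodule.smul_mem_iff _ (hne (n + 1))).1 ?_
      have h1 := Submodule.add_mem _ (⟨X ^ (n + 1), rfl⟩ :
        (LinearMap.id - freePoly (a : ℂ) : ℂ[X] →ₗ[ℂ] ℂ[X]) (X ^ (n + 1)) ∈ LinearMap.range _)
        (Submodule.smul_mem _ ((n + 1 : ℕ) : ℂ) ih)
      rw [LinearMap.sub_apply, freePoly_X_pow, LinearMap.id_apply, Nat.add_sub_cancel] at h1
      convert h1 using 1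
      module
  intro q _
  induction q using Polynomial.induction_on' with
  | add p q hp hq => exact Submodule.add_mem _ (hp trivial) (hq trivial)
  | monomial n c =>
    rw [← C_mul_X_pow_eq_monomial, ← smul_eq_C_mul]
    exact Submodule.smul_mem _ _ (hX n)

/-- Polynomials are a core for the generator of the free semigroup. -/
lemma genGraph_le_closure {S : C0Semigroup EnergySpace} {a : ℝ} (ha : 0 < a)
    (hM : ∀ t : ℝ, 0 ≤ t → ∀ x, ‖S.flow t x‖ ≤ 3 * Real.exp (-a * t) * ‖x‖)
    (hG : ∀ q, S.Gen (el q) (el (freePoly a q))) :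
    S.genGraph ≤ (LinearMap.range (el.prod (el ∘ₗ freePoly a))).topologicalClosure := by
  obtain ⟨R, hR1, hR2⟩ := C0Semigroup.exists_resolvent_one (by norm_num) ha hM
  rintro ⟨x, y⟩ hxy
  have hc : Continuous fun f => (R f, R f - f) := by fun_prop
  have h : ∀ f, (R f, R f - f) ∈ (LinearMap.range (el.prod (el ∘ₗ freePoly a))).topologicalClosure := by
    intro f
    refine denseRange_el.induction_on (p := fun f => (R f, R f - f) ∈
      (LinearMap.range (el.prod (el ∘ₗ freePoly a))).topologicalClosure) f
      ((Submodule.isClosed_topologicalClosure _).preimage hc) fun q => ?_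
    obtain ⟨r, rfl⟩ := exists_sub_freePoly_eq ha.le q
    refine Submodule.le_topologicalClosure _ ⟨r, ?_⟩
    have h1 : R (el (r - freePoly a r)) = el r := by
      rw [map_sub]; exact hR2 _ _ (hG r)
    rw [h1, map_sub, sub_sub_cancel]
    rfl
  have h2 := h (x - y)
  rwa [hR2 x y hxy, sub_sub_cancel] at h2

lemma isClosed_genGraph {S : C0Semigroup EnergySpace} {a : ℝ} (ha : 0 < a)
    (hM : ∀ t : ℝ, 0 ≤ t → ∀ x, ‖S.flow t x‖ ≤ 3 * Real.exp (-a * t) * ‖x‖) :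
    IsClosed (S.genGraph : Set (EnergySpace × EnergySpace)) := by
  obtain ⟨R, hR1, hR2⟩ := C0Semigroup.exists_resolvent_one (by norm_num) ha hM
  have h : (S.genGraph : Set (EnergySpace × EnergySpace)) = {z | R (z.1 - z.2) = z.1} := by
    ext ⟨x, y⟩
    refine ⟨fun h => hR2 x y h, fun h => ?_⟩
    have h1 := hR1 (x - y)
    rw [show R (x - y) = x from h, sub_sub_cancel] at h1
    exact h1
  rw [h]
  exact isClosed_eq (by fun_prop) (by fun_prop)

/-! ### Classical functions belong to the domain of the generator -/

lemma memLp_mul_L2 (v : L2) : MemLp (fun x : ℝ => (x : ℂ) * v x) 2 unitVol := by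
  refine (Lp.memLp v).of_le (by fun_prop) (ae_unitVol_of_forall fun x hx => ?_)
  rw [norm_mul, Complex.norm_real, Real.norm_of_nonneg hx.1.le]
  exact mul_le_of_le_one_left (norm_nonneg _) hx.2.le

/-- Multiplication by the independent variable on `L²(0,1)`. -/
def mulX : L2 →L[ℂ] L2 :=
  LinearMap.mkContinuous
    { toFun := fun v => (memLp_mul_L2 v).toLp _
      map_add' := fun u v => by
        refine Lp.ext ?_
        filter_upwards [(memLp_mul_L2 (u + v)).coeFn_toLp, (memLp_mul_L2 u).coeFn_toLp,
          (memLp_mul_L2 v).coeFn_toLp, Lp.coeFn_add u v,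
          Lp.coeFn_add ((memLp_mul_L2 u).toLp _) ((memLp_mul_L2 v).toLp _)] with x h1 h2 h3 h4 h5
        rw [h1, h5, Pi.add_apply, h2, h3, h4, Pi.add_apply, mul_add]
      map_smul' := fun c v => by
        refine Lp.ext ?_
        filter_upwards [(memLp_mul_L2 (c • v)).coeFn_toLp, (memLp_mul_L2 v).coeFn_toLp,
          Lp.coeFn_smul c v, Lp.coeFn_smul c ((memLp_mul_L2 v).toLp _)] with x h1 h2 h3 h4
        rw [h1, RingHom.id_apply, h4, Pi.smul_apply, h2, h3, Pi.smul_apply, smul_eq_mul, smul_eq_mul]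
        ring } 1 fun v => by
    rw [one_mul]
    refine Lp.norm_le_norm_of_ae_le ?_
    filter_upwards [(memLp_mul_L2 v).coeFn_toLp,
      ae_unitVol_of_forall (q := fun x => x ∈ Ioo (0 : ℝ) 1) (fun x hx => hx)] with x h1 hx
    change ‖(memLp_mul_L2 v).toLp _ x‖ ≤ _
    rw [h1, norm_mul, Complex.norm_real, Real.norm_of_nonneg hx.1.le]
    exact mul_le_of_le_one_left (norm_nonneg _) hx.2.le

lemma coeFn_mulX (v : L2) : mulX v =ᵐ[unitVol] fun x : ℝ => (x : ℂ) * v x :=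
  (memLp_mul_L2 v).coeFn_toLp

lemma volt_polyL2_X_pow (n : ℕ) : volt (polyL2 (X ^ n)) = (1 / (n + 1) : ℂ) • polyL2 (X ^ (n + 1)) := by
  have hne : (n + 1 : ℂ) ≠ 0 := by exact_mod_cast n.succ_ne_zero
  have h : X ^ n = derivative ((1 / (n + 1) : ℂ) • X ^ (n + 1) : ℂ[X]) := by
    rw [derivative_smul, derivative_X_pow, ← smul_eq_C_mul, smul_smul]
    push_cast
    rw [one_div, inv_mul_cancel₀ hne, one_smul]
  refine Lp.ext ?_
  rw [← map_smul]
  filter_upwards [coeFn_volt (polyL2 (X ^ n)), coeFn_polyL2 ((1 / (n + 1) : ℂ) • X ^ (n + 1)),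
    integral_polyL2_derivative ((1 / (n + 1) : ℂ) • X ^ (n + 1))] with x h1 h2 h3
  rw [h1, h2, h, h3]
  simp

lemma mulX_polyL2_X_pow (n : ℕ) : mulX (polyL2 (X ^ n)) = polyL2 (X ^ (n + 1)) := by
  refine Lp.ext ?_
  filter_upwards [coeFn_mulX (polyL2 (X ^ n)), coeFn_polyL2 (X ^ n), coeFn_polyL2 (X ^ (n + 1))]
    with x h1 h2 h3
  rw [h1, h2, h3]
  simp [pow_succ']

/-- The pair consisting of the odd function with second derivative `v`, vanishing to second order at
`0`, and its image under the free operator, belongs to the graph of the generator. It suffices to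
check this for the dense set of odd polynomials `v`. -/
lemma mem_genGraph_of_odd {S : C0Semigroup EnergySpace} {a : ℝ}
    (hcl : IsClosed (S.genGraph : Set (EnergySpace × EnergySpace)))
    (hG : ∀ q, S.Gen (el q) (el (freePoly a q))) (v : L2) :
    (embOdd (volt v), embOdd (-(1 + a : ℂ) • volt v - mulX v) + embEven v) ∈ S.genGraph := by
  let Z : L2 →L[ℂ] EnergySpace × EnergySpace :=
    (embOdd ∘L volt).prod (embOdd ∘L (-(1 + a : ℂ) • volt - mulX) + embEven)
  have h : S.genGraph.comap (Z : L2 →ₗ[ℂ] EnergySpace × EnergySpace) = ⊤ := by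
    refine eq_top_of_odd_mem (hcl.preimage Z.continuous) fun k => ?_
    change (embOdd (volt _), embOdd (-(1 + a : ℂ) • volt _ - mulX _) + embEven _) ∈ S.genGraph
    have h1 : (2 * k + 2 : ℂ) ≠ 0 := by exact_mod_cast Nat.succ_ne_zero (2 * k + 1)
    have h2 : (2 * k + 3 : ℂ) ≠ 0 := by exact_mod_cast Nat.succ_ne_zero (2 * k + 2)
    have h1' : (2 * k + 1 + 1 : ℂ) ≠ 0 := by rwa [add_assoc, one_add_one_eq_two]
    have h3 := S.genGraph.smul_mem (1 / ((2 * k + 2) * (2 * k + 3)) : ℂ)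
      (C0Semigroup.mem_genGraph.2 (hG (X ^ (2 * k + 3))))
    rw [freePoly_X_pow, map_sub, map_smul, map_smul, show 2 * k + 3 - 1 = 2 * k + 2 by omega,
      show 2 * k + 3 = 2 * (k + 1) + 1 by ring, el_X_pow_odd, el_X_pow_even] at h3
    rw [volt_polyL2_X_pow, mulX_polyL2_X_pow]
    convert h3 using 1
    rw [show 2 * (k + 1) = 2 * k + 1 + 1 by ring, Prod.smul_mk]
    simp only [map_sub, map_smul, smul_smul, smul_sub]
    push_cast
    refine Prod.ext ?_ ?_
    · simp only
      congr 1
      field_simp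
      ring
    · simp only
      match_scalars <;> field_simp <;> ring
  exact h.ge (Submodule.mem_top (x := v))

/-- The pair consisting of the even function with second derivative `v`, vanishing to second order at
`0`, and its image under the free operator, belongs to the graph of the generator. -/
lemma mem_genGraph_of_even {S : C0Semigroup EnergySpace} {a : ℝ}
    (hcl : IsClosed (S.genGraph : Set (EnergySpace × EnergySpace)))
    (hG : ∀ q, S.Gen (el q) (el (freePoly a q))) (v : L2) :
    (embEven (volt v), embOdd v + embEven (-(1 + a : ℂ) • volt v - mulX v)) ∈ S.genGraph := by
  let Z : L2 →L[ℂ] EnergySpace × EnergySpace :=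
    (embEven ∘L volt).prod (embOdd + embEven ∘L (-(1 + a : ℂ) • volt - mulX))
  have h : S.genGraph.comap (Z : L2 →ₗ[ℂ] EnergySpace × EnergySpace) = ⊤ := by
    refine eq_top_of_even_mem (hcl.preimage Z.continuous) fun k => ?_
    change (embEven (volt _), embOdd _ + embEven (-(1 + a : ℂ) • volt _ - mulX _)) ∈ S.genGraph
    have h1 : (2 * k + 1 : ℂ) ≠ 0 := by exact_mod_cast Nat.succ_ne_zero (2 * k)
    have h2 : (2 * k + 2 : ℂ) ≠ 0 := by exact_mod_cast Nat.succ_ne_zero (2 * k + 1)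
    have h3 := S.genGraph.smul_mem (1 / ((2 * k + 1) * (2 * k + 2)) : ℂ)
      (C0Semigroup.mem_genGraph.2 (hG (X ^ (2 * k + 2))))
    rw [freePoly_X_pow, map_sub, map_smul, map_smul, show 2 * k + 2 - 1 = 2 * k + 1 by omega,
      el_X_pow_odd, el_X_pow_even] at h3
    rw [volt_polyL2_X_pow, mulX_polyL2_X_pow]
    convert h3 using 1
    rw [Prod.smul_mk]
    simp only [map_sub, map_smul, smul_smul, smul_sub]
    push_cast
    refine Prod.ext ?_ ?_
    · simp only
      congr 1
      field_simp
    · simp only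
      match_scalars <;> field_simp
      ring
  exact h.ge (Submodule.mem_top (x := v))

/-- A pair of continuously differentiable functions is recovered from its derivatives. -/
lemma Represents.eq_emb {u : EnergySpace} {f₁ f₂ : ℝ → ℂ} (hu : Represents u f₁ f₂)
    (h₁ : ContDiffOn ℝ 1 f₁ (Icc 0 1)) (h₂ : ContDiffOn ℝ 1 f₂ (Icc 0 1)) (h0 : f₁ 0 = 0)
    {v₁ v₂ : L2} (hv₁ : v₁ =ᵐ[unitVol] D f₁) (hv₂ : v₂ =ᵐ[unitVol] D f₂) :
    u = embOdd v₁ + embEven v₂ + f₂ 0 • oneE := by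
  refine hu.ext ?_
  have h := ((represents_embOdd v₁).add (represents_embEven v₂)).add (represents_oneE.smul (f₂ 0))
  refine ⟨h.1.trans (ae_unitVol_of_forall fun x hx => ?_),
    h.2.trans (ae_unitVol_of_forall fun x hx => ?_)⟩
  · have e := (ofPrimitive_of_contDiffOn h₁).2 x (Ioo_subset_Icc_self hx)
    simp only [Pi.add_apply, Pi.smul_apply, Pi.zero_apply]
    rw [e, intervalIntegral_congr_fn hv₁ hx, h0]
    simp
  · have e := (ofPrimitive_of_contDiffOn h₂).2 x (Ioo_subset_Icc_self hx)
    simp only [Pi.add_apply, Pi.smul_apply, Pi.zero_apply]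
    rw [e, intervalIntegral_congr_fn hv₂ hx]
    simp [add_comm]

/-- The generator of the free semigroup extends the free operator on classical functions. -/
lemma freeGraph_le_genGraph {p : ℝ} {S : C0Semigroup EnergySpace}
    (hcl : IsClosed (S.genGraph : Set (EnergySpace × EnergySpace)))
    (hG : ∀ q, S.Gen (el q) (el (freePoly (2 / (p - 1) : ℝ) q))) :
    freeGraph p ≤ S.genGraph := by
  rintro ⟨u, w⟩ ⟨f₁, f₂, ⟨h₁, h₂, h0, h0'⟩, hu, hw⟩
  simp only at hu hw
  set a : ℝ := 2 / (p - 1) with ha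
  have hud := uniqueDiffOn_Icc (zero_lt_one (α := ℝ))
  have c₁ : ContDiffOn ℝ 1 (D f₁) (Icc 0 1) := h₁.derivWithin hud (by norm_num)
  have c₂ : ContDiffOn ℝ 1 (D f₂) (Icc 0 1) := h₂.derivWithin hud (by norm_num)
  obtain ⟨m₁, i₁⟩ := ofPrimitive_of_contDiffOn c₁
  obtain ⟨m₂, i₂⟩ := ofPrimitive_of_contDiffOn c₂
  set v₁ : L2 := m₁.toLp _ with hv₁
  set v₂ : L2 := m₂.toLp _ with hv₂
  have e₁ : v₁ =ᵐ[unitVol] D (D f₁) := m₁.coeFn_toLp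
  have e₂ : v₂ =ᵐ[unitVol] D (D f₂) := m₂.coeFn_toLp
  set c : ℂ := D f₁ 0 with hc
  -- the derivatives of the components of `u`
  have d₁ : (volt v₁ + c • polyL2 1 : L2) =ᵐ[unitVol] D f₁ := by
    filter_upwards [Lp.coeFn_add (volt v₁) (c • polyL2 1), Lp.coeFn_smul c (polyL2 1),
      coeFn_polyL2 1, coeFn_volt v₁,
      ae_unitVol_of_forall (q := fun x => x ∈ Ioo (0 : ℝ) 1) (fun x hx => hx)] with x k1 k2 k3 k4 hx
    rw [k1, Pi.add_apply, k2, Pi.smul_apply, k3, k4, i₁ x (Ioo_subset_Icc_self hx),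
      intervalIntegral_congr_fn e₁ hx]
    simp [hc, add_comm]
  have d₂ : volt v₂ =ᵐ[unitVol] D f₂ := by
    filter_upwards [coeFn_volt v₂,
      ae_unitVol_of_forall (q := fun x => x ∈ Ioo (0 : ℝ) 1) (fun x hx => hx)] with x k4 hx
    rw [k4, i₂ x (Ioo_subset_Icc_self hx), intervalIntegral_congr_fn e₂ hx, h0', zero_add]
  have hU := hu.eq_emb (h₁.of_le (by norm_num)) (h₂.of_le (by norm_num)) h0 d₁ d₂
  have hid : ContDiffOn ℝ 1 (fun ρ : ℝ => (ρ : ℂ)) (Icc 0 1) :=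
    Complex.ofRealCLM.contDiff.contDiffOn
  have b₁ : ContDiffOn ℝ 1 (free₁ p f₁ f₂) (Icc 0 1) :=
    (c₂.sub (hid.mul c₁)).sub (contDiffOn_const.mul (h₁.of_le (by norm_num)))
  have b₂ : ContDiffOn ℝ 1 (free₂ p f₁ f₂) (Icc 0 1) :=
    (c₁.sub (hid.mul c₂)).sub (contDiffOn_const.mul (h₂.of_le (by norm_num)))
  -- the derivatives of the components of `w`
  have hder : ∀ f g : ℝ → ℂ, ContDiffOn ℝ 2 f (Icc 0 1) → ContDiffOn ℝ 2 g (Icc 0 1) →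
      ∀ x ∈ Icc (0 : ℝ) 1, D (fun ρ => D g ρ - ρ * D f ρ - (a : ℂ) * f ρ) x =
        D (D g) x - (1 + a) * D f x - x * D (D f) x := by
    intro f g hf hg x hx
    have k1 : HasDerivWithinAt (D g) (D (D g) x) (Icc 0 1) x :=
      (((hg.derivWithin hud (m := 1) (by norm_num)).differentiableOn (by norm_num)) x hx).hasDerivWithinAt
    have k2 : HasDerivWithinAt (D f) (D (D f) x) (Icc 0 1) x :=
      (((hf.derivWithin hud (m := 1) (by norm_num)).differentiableOn (by norm_num)) x hx).hasDerivWithinAt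
    have k3 : HasDerivWithinAt f (D f x) (Icc 0 1) x :=
      ((hf.differentiableOn (by norm_num)) x hx).hasDerivWithinAt
    have k4 : HasDerivWithinAt (fun ρ : ℝ => (ρ : ℂ)) 1 (Icc 0 1) x :=
      (Complex.ofRealCLM.hasDerivAt (x := x)).hasDerivWithinAt
    have k5 := (k1.sub (k4.mul k2)).sub (k3.const_mul (a : ℂ))
    refine (k5.derivWithin (hud x hx)).trans ?_
    ring
  have d₃ : (v₂ + (-(1 + a : ℂ) • (volt v₁ + c • polyL2 1) - mulX v₁) : L2) =ᵐ[unitVol]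
      D (free₁ p f₁ f₂) := by
    filter_upwards [Lp.coeFn_add v₂ (-(1 + a : ℂ) • (volt v₁ + c • polyL2 1) - mulX v₁),
      Lp.coeFn_sub (-(1 + a : ℂ) • (volt v₁ + c • polyL2 1)) (mulX v₁),
      Lp.coeFn_smul (-(1 + a : ℂ)) (volt v₁ + c • polyL2 1), coeFn_mulX v₁, d₁, e₁, e₂,
      ae_unitVol_of_forall (q := fun x => x ∈ Ioo (0 : ℝ) 1) (fun x hx => hx)]
      with x k1 k2 k3 k4 k5 k6 k7 hx
    rw [k1, Pi.add_apply, k2, Pi.sub_apply, k3, Pi.smul_apply, k4, k5, k6, k7]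
    refine Eq.trans ?_ (hder f₁ f₂ h₁ h₂ x (Ioo_subset_Icc_self hx)).symm
    rw [smul_eq_mul]; ring
  have d₄ : (v₁ + (-(1 + a : ℂ) • volt v₂ - mulX v₂) : L2) =ᵐ[unitVol] D (free₂ p f₁ f₂) := by
    filter_upwards [Lp.coeFn_add v₁ (-(1 + a : ℂ) • volt v₂ - mulX v₂),
      Lp.coeFn_sub (-(1 + a : ℂ) • volt v₂) (mulX v₂),
      Lp.coeFn_smul (-(1 + a : ℂ)) (volt v₂), coeFn_mulX v₂, d₂, e₁, e₂,
      ae_unitVol_of_forall (q := fun x => x ∈ Ioo (0 : ℝ) 1) (fun x hx => hx)]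
      with x k1 k2 k3 k4 k5 k6 k7 hx
    rw [k1, Pi.add_apply, k2, Pi.sub_apply, k3, Pi.smul_apply, k4, k5, k6, k7]
    refine Eq.trans ?_ (hder f₂ f₁ h₂ h₁ x (Ioo_subset_Icc_self hx)).symm
    rw [smul_eq_mul]; ring
  have hW := hw.eq_emb b₁ b₂ (by simp [free₁, h0, h0']) d₃ d₄
  have z1 := mem_genGraph_of_odd hcl hG v₁
  have z2 := mem_genGraph_of_even hcl hG v₂
  have z3 := S.genGraph.smul_mem c (C0Semigroup.mem_genGraph.2 (hG (X ^ 1)))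
  have z4 := S.genGraph.smul_mem (f₂ 0) (C0Semigroup.mem_genGraph.2 (hG (X ^ 0)))
  have hf20 : free₂ p f₁ f₂ 0 = c - a * f₂ 0 := by simp [free₂, hc, ha]
  have hz := S.genGraph.add_mem (S.genGraph.add_mem z1 z2) (S.genGraph.add_mem z3 z4)
  rw [freePoly_X_pow, freePoly_X_pow] at hz
  have hX : el X = embOdd (polyL2 1) := by simpa using el_X_pow_odd 0
  simp only [map_sub, map_smul, pow_one, Nat.sub_self, pow_zero, el_one, hX] at hz
  convert hz using 1
  rw [hU, hW, hf20]
  simp only [Prod.smul_mk, Prod.mk_add_mk, map_add, map_sub, map_smul]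
  refine Prod.ext ?_ ?_
  · simp only
    match_scalars <;> simp
  · simp only
    match_scalars <;> simp <;> ring

/-- Polynomial elements are classical. -/
lemma el_mem_freeGraph (p : ℝ) (q : ℂ[X]) :
    (el q, el (freePoly (2 / (p - 1) : ℝ) q)) ∈ freeGraph p := by
  have hD : ∀ r : ℂ[X], ∀ x ∈ Icc (0 : ℝ) 1, D (fun x : ℝ => r.eval (x : ℂ)) x =
      (derivative r).eval (x : ℂ) := fun r x hx =>
    (r.hasDerivAt (x : ℂ)).comp_ofReal.hasDerivWithinAt.derivWithin
      (uniqueDiffOn_Icc zero_lt_one x hx)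
  have hs : ∀ r : ℂ[X], ContDiffOn ℝ 2 (fun x : ℝ => r.eval (x : ℂ)) (Icc 0 1) := fun r =>
    ((r.differentiable.contDiff.restrict_scalars ℝ).comp Complex.ofRealCLM.contDiff).contDiffOn
  refine ⟨_, _, ⟨hs (oddPart q), hs (evenPart q), ?_, ?_⟩, represents_el q,
    (represents_el _).congr (fun x hx => ?_) fun x hx => ?_⟩
  · simp [oddPart_apply, eval_comp]
  · rw [hD _ 0 (by simp)]
    simp [evenPart_apply, eval_comp, derivative_comp]
  · simp only [free₁]
    rw [hD _ x hx, hD _ x hx]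
    simp [oddPart_apply, evenPart_apply, freePoly_apply, eval_comp, derivative_comp]
    ring
  · simp only [free₂]
    rw [hD _ x hx, hD _ x hx]
    simp [oddPart_apply, evenPart_apply, freePoly_apply, eval_comp, derivative_comp]
    ring

/-- The generator of the free semigroup is the closure of the free operator. -/
lemma closure_freeGraph {p : ℝ} (hp : 1 < p) {S : C0Semigroup EnergySpace}
    (hM : ∀ t : ℝ, 0 ≤ t → ∀ x, ‖S.flow t x‖ ≤ 3 * Real.exp (-(2 / (p - 1)) * t) * ‖x‖)
    (hG : ∀ q, S.Gen (el q) (el (freePoly (2 / (p - 1) : ℝ) q))) :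
    (freeOp p).graph.topologicalClosure = S.genGraph := by
  have ha : 0 < 2 / (p - 1) := div_pos two_pos (sub_pos.2 hp)
  have hcl := isClosed_genGraph ha hM
  rw [freeOp_graph]
  refine le_antisymm (Submodule.topologicalClosure_minimal _ (freeGraph_le_genGraph hcl hG) hcl)
    ((genGraph_le_closure ha hM hG).trans (Submodule.topologicalClosure_mono ?_))
  rintro _ ⟨q, rfl⟩
  exact el_mem_freeGraph p q

lemma isClosable_freeOp {p : ℝ} (hp : 1 < p) {S : C0Semigroup EnergySpace}
    (hM : ∀ t : ℝ, 0 ≤ t → ∀ x, ‖S.flow t x‖ ≤ 3 * Real.exp (-(2 / (p - 1)) * t) * ‖x‖)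
    (hG : ∀ q, S.Gen (el q) (el (freePoly (2 / (p - 1) : ℝ) q))) : (freeOp p).IsClosable := by
  refine ⟨S.genGraph.toLinearPMap, (closure_freeGraph hp hM hG).trans ?_⟩
  refine (Submodule.toLinearPMap_graph_eq _ ?_).symm
  rintro ⟨x, y⟩ hxy rfl
  have h0 := C0Semigroup.mem_genGraph.1 S.genGraph.zero_mem
  exact C0Semigroup.Gen.unique hxy h0

lemma mem_graph_linOp {p : ℝ} (hp : 1 < p) {S : C0Semigroup EnergySpace}
    (hM : ∀ t : ℝ, 0 ≤ t → ∀ x, ‖S.flow t x‖ ≤ 3 * Real.exp (-(2 / (p - 1)) * t) * ‖x‖)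
    (hG : ∀ q, S.Gen (el q) (el (freePoly (2 / (p - 1) : ℝ) q))) (x y : EnergySpace) :
    (x, y) ∈ (linOp p).graph ↔ S.Gen x (y - pertOp p x) := by
  have h1 : (freeOp p).closure.graph = S.genGraph := by
    rw [← (isClosable_freeOp hp hM hG).graph_closure_eq_closure_graph, closure_freeGraph hp hM hG]
  rw [← C0Semigroup.mem_genGraph, ← h1, linOp, LinearPMap.mem_graph_iff, LinearPMap.mem_graph_iff]
  constructor
  · rintro ⟨z, hz1, hz2⟩
    refine ⟨z, hz1, ?_⟩
    simp only at hz1 hz2 ⊢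
    rw [← hz2, ← hz1]
    change _ = pertOp p (z : EnergySpace) + _ - _
    rw [add_sub_cancel_left]
    rfl
  · rintro ⟨z, hz1, hz2⟩
    refine ⟨z, hz1, ?_⟩
    simp only at hz1 hz2 ⊢
    change pertOp p (z : EnergySpace) + (freeOp p).closure z = y
    rw [hz2, ← hz1, add_sub_cancel]

/-! ### The perturbation -/

/-- The perturbation `L'` as a bounded operator. -/
def pertL (p : ℝ) : EnergySpace →L[ℂ] EnergySpace :=
  ((p * kappa p : ℝ) : ℂ) • (embOdd ∘L toL2L ∘L sndL)

lemma pertL_apply (p : ℝ) (u : EnergySpace) :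
    pertL p u = ((p * kappa p : ℝ) : ℂ) • embOdd (toL2 u.snd) := rfl

lemma pertL_eq_pertOp (p : ℝ) (u : EnergySpace) : pertL p u = pertOp p u := by
  refine EnergySpace.ext rfl ?_
  change ((p * kappa p : ℝ) : ℂ) • (0 : H1) = 0
  rw [smul_zero]

/-- The inclusion of `H¹(0,1)` into `L²(0,1)` is compact. -/
lemma isCompactOperator_toL2L : IsCompactOperator toL2L := by
  set e : L2 := toL2 oneH1 with he
  -- up to the constant of integration, the inclusion factors through the Volterra operator
  set T : H1 →L[ℂ] L2 := toL2L - volt ∘L weakDL with hT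
  have he0 : inner ℂ e e ≠ 0 := by
    rw [inner_self_ne_zero]
    intro h
    have h1 : (fun _ : ℝ => (1 : ℂ)) =ᵐ[unitVol] 0 := by
      refine fn_oneH1.symm.trans ?_
      change (e : ℝ → ℂ) =ᵐ[unitVol] 0
      rw [h]; exact Lp.coeFn_zero ℂ 2 unitVol
    exact one_ne_zero (α := ℂ) (eqOn_of_ae_eq continuousOn_const continuousOn_const h1 (x := 0) (by simp))
  have hTe : ∀ u, T u = (inner ℂ e (T u) / inner ℂ e e) • e := by
    intro u
    obtain ⟨d, hd⟩ := exists_eq_anti_add u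
    have h1 : T u = d • e := by
      have h2 : toL2L u = toL2L (anti (weakD u) + d • oneH1) := congrArg _ hd
      rw [map_add, map_smul] at h2
      rw [hT, sub_apply, h2]
      exact add_sub_cancel_left _ _
    rw [h1, inner_smul_right, mul_div_cancel_right₀ _ he0]
  have hTc : IsCompactOperator T := by
    have h1 := isCompactOperator_smulRight ((inner ℂ e e)⁻¹ • (innerSL ℂ e ∘L T)) e
    convert h1 using 1
    funext u
    refine (hTe u).trans ?_
    rw [div_eq_inv_mul]
    rfl
  have h2 : IsCompactOperator (T + volt ∘L weakDL) := hTc.add (isCompactOperator_volt.comp_clm weakDL)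
  rwa [hT, sub_add_cancel] at h2

lemma isCompactOperator_pertL (p : ℝ) : IsCompactOperator (pertL p) := by
  have h : IsCompactOperator (embOdd ∘L toL2L ∘L sndL) :=
    (isCompactOperator_toL2L.comp_clm sndL).clm_comp embOdd
  exact h.smul ((p * kappa p : ℝ) : ℂ)

lemma pertL_el (p : ℝ) (q : ℂ[X]) :
    pertL p (el q) = ((p * kappa p : ℝ) : ℂ) • embOdd (polyL2 (evenPart q)) := by
  rw [pertL_apply, (toL2_weakD_of_represents (represents_el q).2).1]

lemma pertL_el_X_pow_even (p : ℝ) (k : ℕ) : pertL p (el (X ^ (2 * k))) =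
    (((p * kappa p : ℝ) : ℂ) / (2 * k + 1)) • el (X ^ (2 * k + 1)) := by
  have h1 : (2 * k + 1 : ℂ) ≠ 0 := by exact_mod_cast Nat.succ_ne_zero (2 * k)
  rw [pertL_el, evenPart_X_pow_even, el_X_pow_odd, smul_smul, div_mul_cancel₀ _ h1]

lemma pertL_el_X_pow_odd (p : ℝ) (k : ℕ) : pertL p (el (X ^ (2 * k + 1))) = 0 := by
  rw [pertL_el, evenPart_X_pow_odd]; simp

lemma p_mul_kappa {p : ℝ} (hp : 1 < p) :
    p * kappa p = (1 + 2 / (p - 1)) * (2 + 2 / (p - 1)) := by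
  have : p - 1 ≠ 0 := (sub_pos.2 hp).ne'
  rw [kappa]
  field_simp
  ring

/-! ### The eigenfunctional to the eigenvalue `1` -/

/-- The moments `∫₀¹ xⁿ (1 - x²)^a`. -/
def moment (a : ℝ) (n : ℕ) : ℝ := ∫ x in (0 : ℝ)..1, x ^ n * (1 - x ^ 2) ^ a

lemma continuous_weight {a : ℝ} (ha : 0 ≤ a) (n : ℕ) :
    Continuous fun x : ℝ => x ^ n * (1 - x ^ 2) ^ a :=
  (continuous_pow n).mul ((by fun_prop : Continuous fun x : ℝ => 1 - x ^ 2).rpow_const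
    fun _ => Or.inr ha)

lemma moment_pos {a : ℝ} (ha : 0 ≤ a) (n : ℕ) : 0 < moment a n := by
  refine intervalIntegral.intervalIntegral_pos_of_pos_on
    ((continuous_weight ha n).intervalIntegrable _ _) (fun x hx => ?_) one_pos
  have : 0 < 1 - x ^ 2 := by nlinarith [hx.1, hx.2]
  have := hx.1
  positivity

/-- Integration of the derivative of `xⁿ⁺¹ (1 - x²)^(1 + a)`. -/
lemma moment_recursion {a : ℝ} (ha : 0 ≤ a) (n : ℕ) :
    (n + 1) * moment a n = (n + 2 * a + 3) * moment a (n + 2) := by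
  have hd : ∀ x : ℝ, HasDerivAt (fun x : ℝ => x ^ (n + 1) * (1 - x ^ 2) ^ (1 + a))
      (((n + 1 : ℕ) * x ^ n) * (1 - x ^ 2) ^ (1 + a) +
        x ^ (n + 1) * (-(2 * x) * (1 + a) * (1 - x ^ 2) ^ a)) x := by
    intro x
    have h1 : HasDerivAt (fun x : ℝ => 1 - x ^ 2) (-(2 * x)) x := by
      simpa using (hasDerivAt_pow 2 x).const_sub 1
    have h2 := h1.rpow_const (p := 1 + a) (Or.inr (by linarith))
    rw [add_sub_cancel_left] at h2
    exact (hasDerivAt_pow (n + 1) x).mul h2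
  have hc : Continuous fun x : ℝ => ((n + 1 : ℕ) * x ^ n) * (1 - x ^ 2) ^ (1 + a) +
        x ^ (n + 1) * (-(2 * x) * (1 + a) * (1 - x ^ 2) ^ a) := by
    have c1 : Continuous fun x : ℝ => (1 - x ^ 2) ^ (1 + a) :=
      (by fun_prop : Continuous fun x : ℝ => 1 - x ^ 2).rpow_const fun _ => Or.inr (by linarith)
    have c2 : Continuous fun x : ℝ => (1 - x ^ 2) ^ a :=
      (by fun_prop : Continuous fun x : ℝ => 1 - x ^ 2).rpow_const fun _ => Or.inr ha
    fun_prop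
  have hint := intervalIntegral.integral_eq_sub_of_hasDerivAt (a := 0) (b := 1) (fun x _ => hd x)
    (hc.intervalIntegrable _ _)
  have e : ∀ x ∈ uIcc (0 : ℝ) 1, ((n + 1 : ℕ) * x ^ n) * (1 - x ^ 2) ^ (1 + a) +
      x ^ (n + 1) * (-(2 * x) * (1 + a) * (1 - x ^ 2) ^ a) =
      (n + 1) * (x ^ n * (1 - x ^ 2) ^ a) - (n + 2 * a + 3) * (x ^ (n + 2) * (1 - x ^ 2) ^ a) := by
    intro x hx
    rw [uIcc_of_le zero_le_one] at hx
    have h0 : 0 ≤ 1 - x ^ 2 := by nlinarith [hx.1, hx.2]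
    rw [add_comm 1 a, Real.rpow_add_one' h0 (by linarith)]
    push_cast
    ring
  rw [intervalIntegral.integral_congr e, intervalIntegral.integral_sub,
    intervalIntegral.integral_const_mul, intervalIntegral.integral_const_mul] at hint
  · have h0 : (0 : ℝ) ^ (1 + a) = 0 := Real.zero_rpow (by linarith)
    simp only [one_pow, sub_self, h0, mul_zero, ne_eq, Nat.succ_ne_zero, not_false_eq_true, zero_pow,
      zero_mul] at hint
    change (n + 1) * moment a n - (n + 2 * a + 3) * moment a (n + 2) = 0 at hint
    linarith
  · exact ((continuous_weight ha n).const_mul _).intervalIntegrable _ _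
  · exact ((continuous_weight ha (n + 2)).const_mul _).intervalIntegrable _ _

lemma memLp_weight {a : ℝ} (ha : 0 ≤ a) :
    MemLp (fun x : ℝ => ((x ^ 1 * (1 - x ^ 2) ^ a : ℝ) : ℂ)) 2 unitVol :=
  memLp_of_continuousOn (Complex.continuous_ofReal.comp (continuous_weight ha 1)).continuousOn

/-- The functional `u ↦ ∫₀¹ x (1 - x²)^a (u₁ + (1 + a) ∫₀ˣ u₂ + x u₂)`. For `a = 2 / (p - 1)`, it
is an eigenfunctional of the linearized operator to the eigenvalue `1`. -/
def dualMode {a : ℝ} (ha : 0 ≤ a) : EnergySpace →L[ℂ] ℂ :=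
  innerSL ℂ ((memLp_weight ha).toLp _) ∘L
    (toL2L ∘L H10.subtypeL ∘L fstL + ((1 + a : ℂ) • volt + mulX) ∘L toL2L ∘L sndL)

lemma dualMode_apply {a : ℝ} (ha : 0 ≤ a) (u : EnergySpace) : dualMode ha u =
    inner ℂ ((memLp_weight ha).toLp _)
      (toL2 (u.fst : H1) + ((1 + a : ℂ) • volt (toL2 u.snd) + mulX (toL2 u.snd))) := rfl

lemma inner_weight {a : ℝ} (ha : 0 ≤ a) (n : ℕ) :
    inner ℂ ((memLp_weight ha).toLp _) (polyL2 (X ^ n)) = (moment a (n + 1) : ℂ) := by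
  rw [L2.inner_def, moment, intervalIntegral.integral_of_le zero_le_one,
    integral_Ioc_eq_integral_Ioo, ← integral_complex_ofReal]
  refine integral_congr_ae ?_
  filter_upwards [(memLp_weight ha).coeFn_toLp, coeFn_polyL2 (X ^ n)] with x h1 h2
  rw [h1, h2, RCLike.inner_apply]
  simp only [eval_pow, eval_X, Complex.conj_ofReal]
  push_cast
  ring

lemma dualMode_el_X_pow_odd {a : ℝ} (ha : 0 ≤ a) (k : ℕ) :
    dualMode ha (el (X ^ (2 * k + 1))) = moment a (2 * k + 2) := by
  rw [dualMode_apply, (toL2_weakD_of_represents (represents_el _).1).1,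
    (toL2_weakD_of_represents (represents_el _).2).1, oddPart_X_pow_odd, evenPart_X_pow_odd]
  simp only [map_zero, smul_zero, add_zero]
  exact inner_weight ha _

lemma dualMode_el_X_pow_even {a : ℝ} (ha : 0 ≤ a) (k : ℕ) :
    dualMode ha (el (X ^ (2 * k))) = ((2 * k + 2 + a) / (2 * k + 1)) * moment a (2 * k + 2) := by
  have h1 : (2 * k + 1 : ℂ) ≠ 0 := by exact_mod_cast Nat.succ_ne_zero (2 * k)
  rw [dualMode_apply, (toL2_weakD_of_represents (represents_el _).1).1,
    (toL2_weakD_of_represents (represents_el _).2).1, oddPart_X_pow_even, evenPart_X_pow_even,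
    volt_polyL2_X_pow, mulX_polyL2_X_pow, map_zero, zero_add, inner_add_right, inner_smul_right,
    inner_smul_right, inner_weight ha]
  push_cast
  field_simp
  ring

/-- The symmetry mode as a polynomial. -/
lemma symMode_eq_el {p : ℝ} (hp : 1 < p) : symMode p = el ((1 + (2 / (p - 1) : ℝ) : ℂ) • X + 1) := by
  have hne : p - 1 ≠ 0 := (sub_pos.2 hp).ne'
  refine (represents_symMode p).ext ((represents_el _).congr (fun x _ => ?_) fun x _ => ?_)
  · have : (p + 1) / (p - 1) = 1 + 2 / (p - 1) := by field_simp; ring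
    rw [this]
    simp [oddPart_apply]
    ring
  · simp [evenPart_apply]
    ring

lemma dualMode_symMode_ne_zero {p : ℝ} (hp : 1 < p) (ha : 0 ≤ 2 / (p - 1)) :
    dualMode ha (symMode p) ≠ 0 := by
  have h1 := dualMode_el_X_pow_odd ha 0
  have h2 := dualMode_el_X_pow_even ha 0
  simp only [mul_zero, zero_add, pow_one, pow_zero, Nat.cast_zero, div_one] at h1 h2
  rw [symMode_eq_el hp, map_add, map_smul, map_add, map_smul, h1, h2, smul_eq_mul]
  have h3 : (0 : ℝ) < (3 + 2 * (2 / (p - 1))) * moment (2 / (p - 1)) 2 :=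
    mul_pos (by linarith) (moment_pos ha 2)
  have h4 := Complex.ofReal_ne_zero.2 h3.ne'
  convert h4 using 1
  push_cast
  ring

/-- The action of the linearized operator on polynomials. -/
def linPoly (p : ℝ) : ℂ[X] →ₗ[ℂ] EnergySpace :=
  el ∘ₗ freePoly (2 / (p - 1) : ℝ) + (pertL p : EnergySpace →ₗ[ℂ] EnergySpace) ∘ₗ el

lemma linPoly_apply (p : ℝ) (q : ℂ[X]) :
    linPoly p q = el (freePoly (2 / (p - 1) : ℝ) q) + pertL p (el q) := rfl

lemma linPoly_X_pow_odd (p : ℝ) (k : ℕ) : linPoly p (X ^ (2 * k + 1)) =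
    (2 * k + 1 : ℂ) • el (X ^ (2 * k)) -
      (2 * k + 1 + (2 / (p - 1) : ℝ) : ℂ) • el (X ^ (2 * k + 1)) := by
  rw [linPoly_apply, pertL_el_X_pow_odd, freePoly_X_pow, map_sub, map_smul, map_smul, add_zero,
    Nat.add_sub_cancel]
  push_cast
  rfl

lemma linPoly_X_pow_even (p : ℝ) (k : ℕ) : linPoly p (X ^ (2 * k)) =
    (2 * k : ℂ) • el (X ^ (2 * k - 1)) - (2 * k + (2 / (p - 1) : ℝ) : ℂ) • el (X ^ (2 * k)) +
      (((p * kappa p : ℝ) : ℂ) / (2 * k + 1)) • el (X ^ (2 * k + 1)) := by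
  rw [linPoly_apply, pertL_el_X_pow_even, freePoly_X_pow, map_sub, map_smul, map_smul]
  push_cast
  rfl

lemma linPoly_symMode {p : ℝ} (hp : 1 < p) :
    linPoly p ((1 + (2 / (p - 1) : ℝ) : ℂ) • X + 1) = symMode p := by
  have h1 := linPoly_X_pow_odd p 0
  have h2 := linPoly_X_pow_even p 0
  simp only [mul_zero, zero_add, pow_one, pow_zero, Nat.cast_zero, div_one, zero_smul, zero_sub] at h1 h2
  rw [symMode_eq_el hp, map_add, map_smul, map_add, map_smul, h1, h2, p_mul_kappa hp]
  push_cast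
  match_scalars <;> ring

lemma dualMode_linPoly {p : ℝ} (hp : 1 < p) (ha : 0 ≤ 2 / (p - 1)) (q : ℂ[X]) :
    dualMode ha (linPoly p q) = dualMode ha (el q) := by
  suffices h : (dualMode ha : EnergySpace →ₗ[ℂ] ℂ) ∘ₗ linPoly p =
      (dualMode ha : EnergySpace →ₗ[ℂ] ℂ) ∘ₗ el from LinearMap.congr_fun h q
  refine Polynomial.lhom_ext' fun n => LinearMap.ext_ring ?_
  change dualMode ha (linPoly p (monomial n 1)) = dualMode ha (el (monomial n 1))
  rw [monomial_one_right_eq_X_pow]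
  rcases Nat.even_or_odd' n with ⟨k, rfl | rfl⟩
  · rcases k with _ | k
    · have h1 := dualMode_el_X_pow_odd ha 0
      have h2 := dualMode_el_X_pow_even ha 0
      rw [linPoly_X_pow_even, map_add, map_sub, map_smul, map_smul, map_smul, h1, h2, p_mul_kappa hp]
      simp only [smul_eq_mul]
      push_cast
      ring
    · have hk : 2 * (k + 1) - 1 = 2 * k + 1 := by omega
      have hrec := moment_recursion ha (2 * k + 2)
      have hne : (2 * (k + 1 : ℕ) + 1 : ℂ) ≠ 0 := by exact_mod_cast Nat.succ_ne_zero (2 * (k + 1))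
      rw [linPoly_X_pow_even, map_add, map_sub, map_smul, map_smul, map_smul, hk,
        dualMode_el_X_pow_odd, dualMode_el_X_pow_odd, dualMode_el_X_pow_even, p_mul_kappa hp]
      simp only [smul_eq_mul]
      generalize 2 / (p - 1) = a at *
      have hrec' : ((2 * k + 2 : ℕ) + 1 : ℂ) * (moment a (2 * k + 2) : ℂ) =
          ((2 * k + 2 : ℕ) + 2 * a + 3 : ℂ) * (moment a (2 * k + 2 + 2) : ℂ) := by exact_mod_cast hrec
      rw [show 2 * (k + 1) + 2 = 2 * k + 2 + 2 by ring]
      generalize (moment a (2 * k + 2 + 2) : ℂ) = m at *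
      generalize (moment a (2 * k + 2) : ℂ) = m' at *
      push_cast at hrec' hne ⊢
      field_simp
      linear_combination (2 * (k : ℂ) + 2) * hrec'
  · have hne : (2 * k + 1 : ℂ) ≠ 0 := by exact_mod_cast Nat.succ_ne_zero (2 * k)
    rw [linPoly_X_pow_odd, map_sub, map_smul, map_smul, dualMode_el_X_pow_odd, dualMode_el_X_pow_even]
    simp only [smul_eq_mul]
    field_simp
    ring

/-- A functional that vanishes on the symmetry mode and is an eigenfunctional of the linearized
operator on polynomials to an eigenvalue in the half plane `Re z > -2/(p-1)` is trivial: its values on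
the monomials satisfy a two-term recursion. -/
lemma eigenfunctional_eq_zero {p : ℝ} (hp : 3 < p) {ψ : EnergySpace →L[ℂ] ℂ} {z : ℂ}
    (hz : -(2 / (p - 1)) < z.re) (hg : ψ (symMode p) = 0)
    (hψ : ∀ q, ψ (linPoly p q) = z * ψ (el q)) : ψ = 0 := by
  have hp1 : 1 < p := by linarith
  have ha0 : 0 < 2 / (p - 1) := div_pos two_pos (by linarith)
  have ha1 : 2 / (p - 1) < 1 := by rw [div_lt_one (by linarith)]; linarith
  have hm := p_mul_kappa hp1
  rw [symMode_eq_el hp1, map_add, map_smul, map_add, map_smul, smul_eq_mul] at hg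
  have hodd : ∀ k : ℕ, ψ (linPoly p (X ^ (2 * k + 1))) = z * ψ (el (X ^ (2 * k + 1))) :=
    fun k => hψ _
  have heven : ∀ k : ℕ, ψ (linPoly p (X ^ (2 * k))) = z * ψ (el (X ^ (2 * k))) := fun k => hψ _
  simp only [linPoly_X_pow_odd, linPoly_X_pow_even, map_sub, map_add, map_smul, smul_eq_mul, hm] at hodd heven
  generalize 2 / (p - 1) = a at *
  set s : ℕ → ℂ := fun n => ψ (el (X ^ n)) with hs
  have hsn : ∀ n, ψ (el (X ^ n)) = s n := fun _ => rfl
  simp only [hsn] at hodd heven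
  -- elimination of the even monomials
  have hrec : ∀ k : ℕ, (z + 2 * k - 1) * (z + 2 * k + 2 + 2 * a) * s (2 * k + 1) =
      (2 * k + 1) * (2 * k) * s (2 * k - 1) := by
    intro k
    have h1 : (2 * k + 1 : ℂ) ≠ 0 := by exact_mod_cast Nat.succ_ne_zero (2 * k)
    have h2 := hodd k
    have h3 := heven k
    push_cast at h3
    field_simp at h3
    linear_combination (-1 : ℂ) * h3 - (z + 2 * k + a) * h2
  have hne : ∀ k : ℕ, z + 2 * k + 2 + 2 * a ≠ 0 := fun k h => by
    have := congrArg Complex.re h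
    simp at this
    have h0 : (0 : ℝ) ≤ k := k.cast_nonneg
    linarith
  have hne' : ∀ k : ℕ, z + 2 * (k + 1 : ℕ) - 1 ≠ 0 := fun k h => by
    have := congrArg Complex.re h
    simp at this
    have h0 : (0 : ℝ) ≤ k := k.cast_nonneg
    linarith
  have hs1 : s 1 = 0 := by
    have h1 := hrec 0
    have h2 := hne 0
    have h3 := hodd 0
    simp only [Nat.cast_zero, mul_zero, add_zero, zero_mul, zero_add, one_mul] at h1 h2 h3
    rcases mul_eq_zero.1 h1 with h4 | h4
    · rcases mul_eq_zero.1 h4 with h5 | h5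
      · have hz1 : z = 1 := sub_eq_zero.1 h5
        have h6 : (1 + a) * s 1 + s 0 = 0 := by
          have e1 : ψ (el X) = s 1 := by rw [← hsn, pow_one]
          have e0 : ψ (el 1) = s 0 := by rw [← hsn, pow_zero]
          rw [← e1, ← e0]; exact hg
        have h7 : ((3 + 2 * a : ℝ) : ℂ) * s 1 = 0 := by
          push_cast
          rw [hz1] at h3
          linear_combination h6 - h3
        refine (mul_eq_zero.1 h7).resolve_left ?_
        exact Complex.ofReal_ne_zero.2 (by linarith)
      · exact absurd h5 h2
    · exact h4
  have hso : ∀ k : ℕ, s (2 * k + 1) = 0 := by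
    intro k
    induction k with
    | zero => exact hs1
    | succ k ih =>
      have h1 := hrec (k + 1)
      rw [show 2 * (k + 1) - 1 = 2 * k + 1 by omega, ih, mul_zero] at h1
      exact (mul_eq_zero.1 h1).resolve_left (mul_ne_zero (hne' k) (hne (k + 1)))
  have hse : ∀ k : ℕ, s (2 * k) = 0 := by
    intro k
    have h1 := hodd k
    rw [hso k, mul_zero, mul_zero, sub_zero] at h1
    exact (mul_eq_zero.1 h1).resolve_left (by exact_mod_cast Nat.succ_ne_zero (2 * k))
  have hlin : (ψ : EnergySpace →ₗ[ℂ] ℂ) ∘ₗ el = 0 := by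
    refine Polynomial.lhom_ext' fun n => LinearMap.ext_ring ?_
    change ψ (el (monomial n 1)) = 0
    rw [monomial_one_right_eq_X_pow]
    rcases Nat.even_or_odd' n with ⟨k, rfl | rfl⟩
    · exact hse k
    · exact hso k
  exact ContinuousLinearMap.coeFn_injective (denseRange_el.equalizer ψ.continuous
    (continuous_const (y := (0 : ℂ))) (funext fun q => LinearMap.congr_fun hlin q))

/-! ### The semigroup of the linearized operator and the projection onto the symmetry mode -/

/-- The projection onto the symmetry mode along the kernel of the eigenfunctional. -/
def symProj {p : ℝ} (ha : 0 ≤ 2 / (p - 1)) : EnergySpace →L[ℂ] EnergySpace :=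
  (dualMode ha).smulRight ((dualMode ha (symMode p))⁻¹ • symMode p)

lemma symProj_apply {p : ℝ} (ha : 0 ≤ 2 / (p - 1)) (x : EnergySpace) :
    symProj ha x = (dualMode ha x * (dualMode ha (symMode p))⁻¹) • symMode p := by
  rw [mul_smul]; rfl

lemma symProj_symMode {p : ℝ} (hp : 1 < p) (ha : 0 ≤ 2 / (p - 1)) :
    symProj ha (symMode p) = symMode p := by
  rw [symProj_apply, mul_inv_cancel₀ (dualMode_symMode_ne_zero hp ha), one_smul]

lemma symProj_symProj {p : ℝ} (hp : 1 < p) (ha : 0 ≤ 2 / (p - 1)) (x : EnergySpace) :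
    symProj ha (symProj ha x) = symProj ha x := by
  rw [symProj_apply ha x, map_smul, symProj_symMode hp]

lemma symMode_ne_zero {p : ℝ} (hp : 1 < p) : symMode p ≠ 0 := by
  intro h
  refine dualMode_symMode_ne_zero hp (div_pos two_pos (sub_pos.2 hp)).le ?_
  rw [h, map_zero]

lemma range_symProj {p : ℝ} (hp : 1 < p) (ha : 0 ≤ 2 / (p - 1)) :
    LinearMap.range (symProj ha : EnergySpace →ₗ[ℂ] EnergySpace) = Submodule.span ℂ {symMode p} := by
  refine le_antisymm ?_ ?_
  · rintro _ ⟨x, rfl⟩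
    exact Submodule.mem_span_singleton.2 ⟨_, (symProj_apply ha x).symm⟩
  · rw [Submodule.span_singleton_le_iff_mem]
    exact ⟨symMode p, symProj_symMode hp ha⟩

section

variable {p : ℝ} {S₀ S : C0Semigroup EnergySpace}

lemma gen_el (hG : ∀ q, S₀.Gen (el q) (el (freePoly (2 / (p - 1) : ℝ) q)))
    (hS : ∀ x y, S.Gen x y ↔ S₀.Gen x (y - pertL p x)) (q : ℂ[X]) : S.Gen (el q) (linPoly p q) := by
  rw [hS, linPoly_apply, add_sub_cancel_right]
  exact hG q

lemma dense_gen_domain (hG : ∀ q, S₀.Gen (el q) (el (freePoly (2 / (p - 1) : ℝ) q)))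
    (hS : ∀ x y, S.Gen x y ↔ S₀.Gen x (y - pertL p x)) : Dense {x | ∃ y, S.Gen x y} := by
  refine Dense.mono ?_ denseRange_el
  rintro _ ⟨q, rfl⟩
  exact ⟨_, gen_el hG hS q⟩

lemma gen_symMode (hp : 1 < p) (hG : ∀ q, S₀.Gen (el q) (el (freePoly (2 / (p - 1) : ℝ) q)))
    (hS : ∀ x y, S.Gen x y ↔ S₀.Gen x (y - pertL p x)) : S.Gen (symMode p) (symMode p) := by
  have h := gen_el hG hS ((1 + (2 / (p - 1) : ℝ) : ℂ) • X + 1)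
  rwa [linPoly_symMode hp, ← symMode_eq_el hp] at h

/-- The eigenvalue equation of `dualMode` extends from the core of polynomials to the domain of the
generator. -/
lemma dualMode_gen (hp : 1 < p) (ha : 0 < 2 / (p - 1))
    (hM : ∀ t : ℝ, 0 ≤ t → ∀ x, ‖S₀.flow t x‖ ≤ 3 * Real.exp (-(2 / (p - 1)) * t) * ‖x‖)
    (hG : ∀ q, S₀.Gen (el q) (el (freePoly (2 / (p - 1) : ℝ) q)))
    (hS : ∀ x y, S.Gen x y ↔ S₀.Gen x (y - pertL p x)) {x y : EnergySpace} (h : S.Gen x y) :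
    dualMode ha.le y = dualMode ha.le x := by
  let F : EnergySpace × EnergySpace →L[ℂ] ℂ :=
    dualMode ha.le ∘L (ContinuousLinearMap.snd ℂ _ _ + pertL p ∘L ContinuousLinearMap.fst ℂ _ _ -
      ContinuousLinearMap.fst ℂ _ _)
  have hF : ∀ z, F z = dualMode ha.le (z.2 + pertL p z.1 - z.1) := fun _ => rfl
  have hker : (LinearMap.range (el.prod (el ∘ₗ freePoly ((2 / (p - 1) : ℝ) : ℂ)))).topologicalClosure ≤
      LinearMap.ker (F : EnergySpace × EnergySpace →ₗ[ℂ] ℂ) := by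
    refine Submodule.topologicalClosure_minimal _ ?_ (isClosed_singleton.preimage F.continuous)
    rintro _ ⟨q, rfl⟩
    change dualMode ha.le (linPoly p q - el q) = 0
    rw [map_sub, dualMode_linPoly hp, sub_self]
  have h1 : F (x, y - pertL p x) = 0 :=
    hker (genGraph_le_closure ha hM hG (C0Semigroup.mem_genGraph.2 ((hS x y).1 h)))
  rw [hF] at h1
  simp only [sub_add_cancel, map_sub] at h1
  exact sub_eq_zero.1 h1

/-- The projection onto the symmetry mode commutes with the semigroup, which acts on its range by
`exp t`. -/
lemma symProj_comm (hp : 1 < p) (ha : 0 < 2 / (p - 1))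
    (hM : ∀ t : ℝ, 0 ≤ t → ∀ x, ‖S₀.flow t x‖ ≤ 3 * Real.exp (-(2 / (p - 1)) * t) * ‖x‖)
    (hG : ∀ q, S₀.Gen (el q) (el (freePoly (2 / (p - 1) : ℝ) q)))
    (hS : ∀ x y, S.Gen x y ↔ S₀.Gen x (y - pertL p x)) {t : ℝ} (ht : 0 ≤ t) (x : EnergySpace) :
    S.flow t (symProj ha.le x) = Complex.exp t • symProj ha.le x ∧
      symProj ha.le (S.flow t x) = S.flow t (symProj ha.le x) := by
  have h1 : S.flow t (symMode p) = Complex.exp t • symMode p := by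
    have h := gen_symMode hp hG hS
    rw [← one_smul ℂ (symMode p)] at h
    nth_rw 1 [one_smul] at h
    simpa using h.flow_eigenvector ht
  have h2 : dualMode ha.le (S.flow t x) = Complex.exp t * dualMode ha.le x := by
    have := S.flow_eigenfunctional (z := 1) (fun x y h => by
      rw [one_mul]; exact dualMode_gen hp ha hM hG hS h) (dense_gen_domain hG hS) ht x
    rwa [one_mul] at this
  have h3 : S.flow t (symProj ha.le x) = Complex.exp t • symProj ha.le x := by
    rw [symProj_apply, map_smul, h1, smul_comm]
  refine ⟨h3, ?_⟩
  rw [h3, symProj_apply, symProj_apply, h2, smul_smul, mul_assoc]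

/-- The semigroup of the linearized operator decays off the symmetry mode, at every rate below that of
the free semigroup. -/
lemma flow_decay (hp : 3 < p) (ha : 0 < 2 / (p - 1))
    (hM : ∀ t : ℝ, 0 ≤ t → ∀ x, ‖S₀.flow t x‖ ≤ 3 * Real.exp (-(2 / (p - 1)) * t) * ‖x‖)
    (hG : ∀ q, S₀.Gen (el q) (el (freePoly (2 / (p - 1) : ℝ) q)))
    (hS : ∀ x y, S.Gen x y ↔ S₀.Gen x (y - pertL p x))
    {M' w' : ℝ} (hM'0 : 0 ≤ M') (hM' : ∀ t : ℝ, 0 ≤ t → ∀ x, ‖S.flow t x‖ ≤ M' * Real.exp (w' * t) * ‖x‖)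
    (hK : ∀ t, 0 < t → IsCompactOperator (S.flow t - S₀.flow t)) {b : ℝ} (hb : b < 2 / (p - 1)) :
    ∃ C : ℝ, 0 < C ∧ ∀ t : ℝ, 0 ≤ t → ∀ f, ‖S.flow t ((1 - symProj ha.le) f)‖ ≤
      C * Real.exp (-b * t) * ‖(1 - symProj ha.le) f‖ := by
  have hp1 : 1 < p := by linarith
  refine C0Semigroup.exists_decay (by norm_num) hM hM'0 hM' hK (isCompactOperator_smulRight _ _)
    (symProj_symProj hp1 ha.le) (fun t ht x => (symProj_comm hp1 ha hM hG hS ht x).2) hb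
    fun ψ z hz hψP hψ => ?_
  refine eigenfunctional_eq_zero hp (z := z) (by linarith) ?_ fun q => ?_
  · rw [← symProj_symMode hp1 ha.le]; exact hψP _
  · -- differentiate the eigenvalue equation for the semigroup at time `0`
    have h1 : HasDerivWithinAt (fun t : ℝ => ψ (S.flow t (el q))) (ψ (linPoly p q)) (Ici 0) 0 :=
      (ψ.restrictScalars ℝ).hasFDerivAt.comp_hasDerivWithinAt 0 (gen_el hG hS q)
    have h2 : HasDerivAt (fun t : ℝ => Complex.exp (z * t) * ψ (el q))
        (Complex.exp (z * (0 : ℝ)) * (z * 1) * ψ (el q)) 0 :=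
      (((Complex.ofRealCLM.hasDerivAt (x := 0)).const_mul z).cexp).mul_const _
    have h3 := h2.hasDerivWithinAt (s := Ici 0).congr (fun t ht => hψ t ht (el q)) (hψ 0 le_rfl (el q))
    have h4 := (uniqueDiffWithinAt_Ici (0 : ℝ)).eq_deriv _ h1 h3
    simpa using h4

end

end SelfSimilarWave

end

open SelfSimilarWave

theorem lemma2p5 (p : ℝ) (hp : 3 < p) :
    (freeOp p).IsClosable ∧
    (∃ S : C0Semigroup EnergySpace, S.IsGeneratedBy (linOp p)) ∧
    ∀ S : C0Semigroup EnergySpace, S.IsGeneratedBy (linOp p) →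
      ∃ P : EnergySpace →L[ℂ] EnergySpace,
        IsIdempotentElem P ∧
        LinearMap.range (P : EnergySpace →ₗ[ℂ] EnergySpace) = Submodule.span ℂ {symMode p} ∧
        Module.finrank ℂ (LinearMap.range (P : EnergySpace →ₗ[ℂ] EnergySpace)) = 1 ∧
        IsSpectralProjection (linOp p) 1 P ∧
        (∀ τ : ℝ≥0, P * S.op τ = S.op τ * P) ∧
        (∀ (τ : ℝ≥0) (f : EnergySpace), S.op τ (P f) = ((Real.exp τ : ℝ) : ℂ) • P f) ∧
        ∀ ε : ℝ, 0 < ε → 0 < 2 / (p - 1) - ε →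
          ∃ C : ℝ, 0 < C ∧ ∀ (τ : ℝ≥0) (f : EnergySpace),
            ‖S.op τ ((1 - P) f)‖ ≤ C * Real.exp (-(2 / (p - 1) - ε) * τ) * ‖(1 - P) f‖ := by
  have hp1 : 1 < p := by linarith
  have ha : 0 < 2 / (p - 1) := div_pos two_pos (by linarith)
  obtain ⟨S₀, hM, hG⟩ := exists_freeSemigroup (2 / (p - 1))
  obtain ⟨S', ⟨M', w', hM'0, hM'⟩, hduh⟩ :=
    C0Semigroup.exists_duhamel S₀ (by norm_num) hM (pertL p)
  have hgen' : ∀ x y, S'.Gen x y ↔ S₀.Gen x (y - pertL p x) :=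
    C0Semigroup.gen_iff_of_duhamel hM hduh
  have hgraph : ∀ x y, (x, y) ∈ (linOp p).graph ↔ S'.Gen x y := fun x y => by
    rw [mem_graph_linOp hp1 hM hG, hgen', pertL_eq_pertOp]
  refine ⟨isClosable_freeOp hp1 hM hG, ⟨S', (S'.isGeneratedBy_iff _).2 hgraph⟩, fun S hSgen => ?_⟩
  have hgraphS := (S.isGeneratedBy_iff _).1 hSgen
  have hgen : ∀ x y, S.Gen x y ↔ S₀.Gen x (y - pertL p x) := fun x y => by
    rw [← hgraphS, hgraph, hgen']
  -- the generator determines the semigroup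
  have hflow : ∀ t : ℝ, 0 ≤ t → ∀ x, S.flow t x = S'.flow t x := fun t ht x =>
    C0Semigroup.flow_eq_of_gen hM' (fun x y h => (hgen' x y).2 ((hgen x y).1 h))
      (dense_gen_domain hG hgen) ht x
  have hMS : ∀ t : ℝ, 0 ≤ t → ∀ x, ‖S.flow t x‖ ≤ M' * Real.exp (w' * t) * ‖x‖ := fun t ht x => by
    rw [hflow t ht]; exact hM' t ht x
  have hK : ∀ t, 0 < t → IsCompactOperator (S.flow t - S₀.flow t) := fun t ht => by
    rw [show S.flow t = S'.flow t from ContinuousLinearMap.ext (hflow t ht.le)]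
    exact C0Semigroup.isCompactOperator_sub_of_duhamel hM hM'0 hM' hduh (isCompactOperator_pertL p) ht
  have hdecay : ∀ b < 2 / (p - 1), ∃ C : ℝ, 0 < C ∧ ∀ t : ℝ, 0 ≤ t → ∀ f,
      ‖S.flow t ((1 - symProj ha.le) f)‖ ≤ C * Real.exp (-b * t) * ‖(1 - symProj ha.le) f‖ :=
    fun b hb => flow_decay hp ha hM hG hgen hM'0 hMS hK hb
  have hcomm := fun (t : ℝ) (ht : 0 ≤ t) x => symProj_comm hp1 ha hM hG hgen ht x
  refine ⟨symProj ha.le, ContinuousLinearMap.ext (symProj_symProj hp1 ha.le), range_symProj hp1 ha.le,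
    ?_, ?_, fun τ => ?_, fun τ f => ?_, fun ε hε hε' => ?_⟩
  · rw [range_symProj hp1 ha.le]
    exact finrank_span_singleton (symMode_ne_zero hp1)
  · obtain ⟨C, -, hC⟩ := hdecay (2 / (p - 1) / 2) (half_lt_self ha)
    refine C0Semigroup.isSpectralProjection_of_decay hgraphS (symProj_symProj hp1 ha.le) ?_
      (fun t ht x => (hcomm t ht x).2) (fun x => ?_) (half_pos ha) hC
    · intro h
      refine symMode_ne_zero hp1 ?_
      rw [← symProj_symMode hp1 ha.le, h]; rfl
    · rw [symProj_apply]
      exact (gen_symMode hp1 hG hgen).smul _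
  · ext1 x
    rw [← S.flow_coe]
    exact (hcomm τ τ.coe_nonneg x).2
  · rw [← S.flow_coe, (hcomm τ τ.coe_nonneg f).1, Complex.ofReal_exp]
  · obtain ⟨C, hC0, hC⟩ := hdecay (2 / (p - 1) - ε) (by linarith)
    refine ⟨C, hC0, fun τ f => ?_⟩
    rw [← S.flow_coe]
    exact hC τ τ.coe_nonneg f
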